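/- **Setting.** Let $n\ge 1$ and let $M$ be a closed (compact, connected, without boundary) smooth $n$-manifold. Let $0<T_{\max}\le\infty$ and let $X:M\times[0,T_{\max})\to\mathbb R^{n+1}$ be smooth, such that each $X(\cdot,t)$ is an embedding; write $M_t=X(M,t)$. Let $\nu$ be its outer unit normal, $u=\langle X,\nu\rangle$ its support function, $d\mu$ its area measure and $\kappa_1,\dots,\kappa_n$ its principal curvatures with respect to $\nu$ (positive on round spheres). For $0\le k\le n$ let $$p_k=\binom nk^{-1}\sum_{1\le i_1<\dots<i_k\le n}\kappa_{i_1}\cdots\kappa_{i_k},\qquad p_0=1,$$ and for $\iota\in\mathbb R$ let $T_{\iota,k}(t)=\int_{M_t}p_k^{\iota}\,d\mu$; write $A(M_t)=\int_{M_t}d\mu$ for the area. The hypersurface $M_0$ is called *$k$-convex* if $p_1>0,\dots,p_k>0$ everywhere on $M_0$, and *convex* if $\kappa_i\ge 0$ everywhere on $M_0$ for all $i$. **Theorem 1.5.** Let $0<k\le n$ and suppose that $M_t$, $t\in[0,T_{\max})$, is a smooth solution of one of the flows $$\frac{\partial X}{\partial t}=p_k^{-1/k}\nu-X\qquad\text{or}\qquad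 \frac{\partial X}{\partial t}=\bigl(p_k^{-1/k}-u\bigr)\nu ,$$ where being a solution includes that $p_k>0$ on every $M_t$, so that the speed is defined. Monotonicity is understood in the non-strict sense, on $[0,T_{\max})$. Then the following hold. (i) If $M_0$ is $k$-convex and $\iota>1$, then $T_{\iota,k}$ is monotone decreasing, and it is a constant function of $t$ if and only if $M_t$ is a round sphere for each $t$. (ii) Let $M_0$ be $k$-convex. Then $T_{1,k}$ is monotone decreasing. If $k<n$, it is constant if and only if $M_t$ is a round sphere for each $t$; if $k=n$, it is always constant. If $k>1$, then $T_{1,k-1}$ is monotone decreasing, and it is constant if and only if $M_t$ is a round sphere for each $t$. (iii) If $k=n$, $M_0$ is convex and $0<\iota<1$, then $T_{\iota,n}$ is monotone increasing, and it is constant if and only if $M_t$ is a round sphere for each $t$. (iv) Let $M_0$ be $k$-convex and $0\le l\le n$. Then $T_{0,l}(t)=A(M_t)$ for each $t$. If $k>1$, then $T_{0,l}$ is monotone increasing, and it is constant if and only if $M_t$ is a round sphere for each $t$. If $k=1$, then $T_{0,l}$ is constant. (v) Let $M_0$ be $k$-convex and $\iota\in\mathbb R$. Then $T_{\iota,0}(t)=A(M_t)$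 for each $t$. If $k>1$, then $T_{\iota,0}$ is monotone increasing, and it is constant if and only if $M_t$ is a round sphere for each $t$. If $k=1$, then $T_{\iota,0}$ is constant. -/

import Mathlib

open Set
open scoped Manifold ContDiff

noncomputable section

namespace InverseCurvatureFlow

/-- The ambient Euclidean space `ℝⁿ⁺¹`. -/
abbrev Amb (n : ℕ) : Type := EuclideanSpace ℝ (Fin (n + 1))

/-- The `i`-th coordinate vector, in the coordinates of the preferred chart at `x`, of the tangent
space at `x` of an `n`-dimensional manifold. -/
def coordVec {n : ℕ} {M : Type*} [TopologicalSpace M] [ChartedSpace (EuclideanSpace ℝ (Fin n)) M]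
    (x : M) (i : Fin n) : TangentSpace (𝓡 n) x :=
  (EuclideanSpace.single i (1 : ℝ) : EuclideanSpace ℝ (Fin n))

section Pointwise

variable {n : ℕ} {M : Type*} [TopologicalSpace M] [ChartedSpace (EuclideanSpace ℝ (Fin n)) M]

/-- The partial derivative `∂ᵢY` at `x` of a map `Y : M → ℝⁿ⁺¹`. -/
def partialDeriv (Y : M → Amb n) (x : M) (i : Fin n) : Amb n :=
  mvfderiv (𝓡 n) Y x (coordVec x i)

/-- The induced metric `g_ij = ⟨∂ᵢX, ∂ⱼX⟩`. -/
def metricMatrix (X : M → Amb n) (x : M) : Matrix (Fin n) (Fin n) ℝ :=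
  Matrix.of fun i j => inner ℝ (partialDeriv X x i) (partialDeriv X x j)

/-- The second fundamental form with respect to the unit normal `ν`,
`h_ij = ⟨∂ᵢν, ∂ⱼX⟩` (positive on round spheres with the outer normal). -/
def secondFormMatrix (X ν : M → Amb n) (x : M) : Matrix (Fin n) (Fin n) ℝ :=
  Matrix.of fun i j => inner ℝ (partialDeriv ν x i) (partialDeriv X x j)

/-- The Weingarten matrix `g^{ik} h_kj`. -/
def weingartenMatrix (X ν : M → Amb n) (x : M) : Matrix (Fin n) (Fin n) ℝ :=
  (metricMatrix X x)⁻¹ * secondFormMatrix X ν x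

/-- The principal curvatures `κ₁, …, κₙ` at `x`: the eigenvalues of the Weingarten matrix,
with multiplicity. -/
def principalCurvatures (X ν : M → Amb n) (x : M) : Multiset ℝ :=
  (weingartenMatrix X ν x).charpoly.roots

/-- The normalized `k`-th elementary symmetric function `p_k = σ_k / C(n,k)` of the
principal curvatures. -/
def p (k : ℕ) (X ν : M → Amb n) (x : M) : ℝ :=
  (principalCurvatures X ν x).esymm k / (n.choose k : ℝ)

/-- `M` is `k`-convex: the principal curvatures lie everywhere in the cone
`Γ_k⁺ = {p₁ > 0, …, p_k > 0}`. -/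
def KConvex (k : ℕ) (X ν : M → Amb n) : Prop :=
  ∀ x : M, ∀ i : ℕ, 1 ≤ i → i ≤ k → 0 < p i X ν x

/-- `M` is convex: no principal curvature is negative anywhere. -/
def IsConvex (X ν : M → Amb n) : Prop :=
  ∀ x : M, ∀ κ ∈ principalCurvatures X ν x, 0 ≤ κ

/-- The support function `u = ⟨X, ν⟩`. -/
def support (X ν : M → Amb n) (x : M) : ℝ := inner ℝ (X x) (ν x)

/-- `ν` is an outer unit normal field along `X`: it has length one, it is orthogonal to the
tangent spaces, and it points into the unbounded component of the complement of the image. -/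
structure IsOuterUnitNormal (X ν : M → Amb n) : Prop where
  norm_eq_one : ∀ x, ‖ν x‖ = 1
  orthogonal : ∀ x, ∀ v : TangentSpace (𝓡 n) x,
    inner ℝ (mvfderiv (𝓡 n) X x v) (ν x) = 0
  outer : ∀ x, ∀ᶠ s : ℝ in nhdsWithin 0 (Ioi 0),
    ¬ Bornology.IsBounded (connectedComponentIn (range X)ᶜ (X x + s • ν x))

/-- `X` is an injective immersion; for compact `M` and smooth `X` this says that `X` is a smooth
embedding, so that its image is a closed embedded hypersurface. -/
structure IsInjectiveImmersion (X : M → Amb n) : Prop where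
  injective : Function.Injective X
  deriv_injective : ∀ x, Function.Injective (mvfderiv (𝓡 n) X x)

end Pointwise

/-- The Riemannian area density `√(det g_ij)` at the point `y`, in the chart of `M` around `c`. -/
def areaDensity {n : ℕ} {M : Type*} [TopologicalSpace M]
    [ChartedSpace (EuclideanSpace ℝ (Fin n)) M]
    (X : M → Amb n) (c : M) (y : EuclideanSpace ℝ (Fin n)) : ℝ :=
  Real.sqrt (Matrix.det (Matrix.of fun i j : Fin n =>
    inner ℝ
      (fderiv ℝ (X ∘ (chartAt (EuclideanSpace ℝ (Fin n)) c).symm) y (EuclideanSpace.single i 1))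
      (fderiv ℝ (X ∘ (chartAt (EuclideanSpace ℝ (Fin n)) c).symm) y (EuclideanSpace.single j 1))))

section Integral

variable {n : ℕ} {M : Type*} [TopologicalSpace M] [ChartedSpace (EuclideanSpace ℝ (Fin n)) M]
  [IsManifold (𝓡 n) ∞ M] [CompactSpace M] [T2Space M]

/-- A smooth partition of unity on `M` subordinate to the cover by chart domains. -/
def chartPartition (n : ℕ) (M : Type*) [TopologicalSpace M]
    [ChartedSpace (EuclideanSpace ℝ (Fin n)) M]
    [IsManifold (𝓡 n) ∞ M] [CompactSpace M] [T2Space M] :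
    SmoothPartitionOfUnity M (𝓡 n) M univ :=
  (SmoothPartitionOfUnity.exists_isSubordinate_chartAt_source (𝓡 n) M).choose

/-- The support of the function with index `c` lies in the domain of the chart around `c`. -/
theorem chartPartition_isSubordinate :
    (chartPartition n M).IsSubordinate
      (fun c => (chartAt (EuclideanSpace ℝ (Fin n)) c).source) :=
  (SmoothPartitionOfUnity.exists_isSubordinate_chartAt_source (𝓡 n) M).choose_spec

/-- The integral `∫_M f dμ` with respect to the area measure `dμ = √(det g_ij) dy` of the metric
induced by `X`, computed with a partition of unity `(ρ_c)` subordinate to the charts: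
`∑_c ∫ ρ_c f √(det g_ij) dy`. Only finitely many summands are nonzero, and by the change of
variables formula the value does not depend on the partition of unity. -/
def surfaceIntegral (X : M → Amb n) (f : M → ℝ) : ℝ :=
  ∑ᶠ c : M, ∫ y in (chartAt (EuclideanSpace ℝ (Fin n)) c).target,
    chartPartition n M c ((chartAt (EuclideanSpace ℝ (Fin n)) c).symm y) *
      f ((chartAt (EuclideanSpace ℝ (Fin n)) c).symm y) * areaDensity X c y

/-- The area `A(M)` of the hypersurface. -/
def area (X : M → Amb n) : ℝ := surfaceIntegral X fun _ => 1

/-- `T_{ι,k} = ∫_M p_k^ι dμ`. -/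
def T (ι : ℝ) (k : ℕ) (X ν : M → Amb n) : ℝ := surfaceIntegral X fun x => p k X ν x ^ ι

end Integral

/-- The time interval `[0, Tmax)`, where `Tmax ≤ ∞`. -/
def timeInterval (Tmax : EReal) : Set ℝ := {t | 0 ≤ t ∧ (t : EReal) < Tmax}

section Flow

variable {n : ℕ} {M : Type*} [TopologicalSpace M] [ChartedSpace (EuclideanSpace ℝ (Fin n)) M]

/-- A smooth family `X(·,t) : M → ℝⁿ⁺¹`, `t ∈ [0, Tmax)`, of embedded hypersurfaces, with
outer unit normals `ν(·,t)`. -/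
structure IsSmoothFamily (Tmax : EReal) (X ν : ℝ → M → Amb n) : Prop where
  smooth_X : ContMDiffOn ((𝓡 n).prod 𝓘(ℝ, ℝ)) 𝓘(ℝ, Amb n) ∞
    (fun q : M × ℝ => X q.2 q.1) (univ ×ˢ timeInterval Tmax)
  smooth_ν : ContMDiffOn ((𝓡 n).prod 𝓘(ℝ, ℝ)) 𝓘(ℝ, Amb n) ∞
    (fun q : M × ℝ => ν q.2 q.1) (univ ×ˢ timeInterval Tmax)
  embedded : ∀ t ∈ timeInterval Tmax, IsInjectiveImmersion (X t)
  normal : ∀ t ∈ timeInterval Tmax, IsOuterUnitNormal (X t) (ν t)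

/-- Solutions of `∂X/∂t = p_k^{-1/k} ν - X`. The speed is defined where `p_k > 0`, which is
therefore part of being a solution. -/
structure SolvesRescaledFlow (k : ℕ) (Tmax : EReal) (X ν : ℝ → M → Amb n) : Prop
    extends IsSmoothFamily Tmax X ν where
  p_pos : ∀ t ∈ timeInterval Tmax, ∀ x, 0 < p k (X t) (ν t) x
  evolution : ∀ t ∈ timeInterval Tmax, ∀ x,
    HasDerivWithinAt (fun s => X s x)
      ((p k (X t) (ν t) x ^ (-(1 / (k : ℝ)))) • ν t x - X t x) (timeInterval Tmax) t

/-- Solutions of `∂X/∂t = (p_k^{-1/k} - u) ν`, again with `p_k > 0`. -/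
structure SolvesNormalFlow (k : ℕ) (Tmax : EReal) (X ν : ℝ → M → Amb n) : Prop
    extends IsSmoothFamily Tmax X ν where
  p_pos : ∀ t ∈ timeInterval Tmax, ∀ x, 0 < p k (X t) (ν t) x
  evolution : ∀ t ∈ timeInterval Tmax, ∀ x,
    HasDerivWithinAt (fun s => X s x)
      ((p k (X t) (ν t) x ^ (-(1 / (k : ℝ))) - support (X t) (ν t) x) • ν t x)
      (timeInterval Tmax) t

/-- The hypersurface parametrized by `X` is a round sphere, with some centre and radius. -/
def IsRoundSphere (X : M → Amb n) : Prop :=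
  ∃ (c : Amb n) (r : ℝ), 0 < r ∧ range X = Metric.sphere c r

/-- `M_t` is a round sphere for each `t`. -/
def AllRoundSpheres (Tmax : EReal) (X : ℝ → M → Amb n) : Prop :=
  ∀ t ∈ timeInterval Tmax, IsRoundSphere (X t)

end Flow

/-- `F` is a constant function of `t ∈ [0, Tmax)`. -/
def ConstantInTime (Tmax : EReal) (F : ℝ → ℝ) : Prop :=
  ∀ s ∈ timeInterval Tmax, ∀ t ∈ timeInterval Tmax, F s = F t

end InverseCurvatureFlow

end

noncomputable section

namespace InverseCurvatureFlow

/-! ### Newton's inequalities for elementary symmetric functions of real numbers -/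

section Symmetric

open Polynomial

/-! All curvature functions are treated at once through parallel hypersurfaces. In a chart, `D(s) =
det(ν, ∂ᵢX + s ∂ᵢν) = D(0) ∏ (1 + s κᵢ)`, so up to orientation the coefficient of `s^l` in `D` is
the density of `σ_l dμ`. Both flows have the same normal component `⟨∂ₜX + X, ν⟩ = F := p_k^{-1/k}`,
and this is all that is used of them. Differentiating the determinant gives `∂ₜD = div + (F + s) D'
- n D` (`dT_parJac`), and the coefficients of `s^l` give `∂ₜ(p_l dμ) = div + (n - l)(F p_{l+1} -
p_l) dμ`.

Since `p_l^ι dμ = (p_l dμ)^ι (dμ)^{1-ι}`, the product rule and the divergence theorem on the closed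
manifold yield (`dT_density`, `hasDerivAt_T`) `d/dt T_{ι,l} = ∫ [ι p_l^{ι-1} (n-l)(F p_{l+1} - p_l)
+ (1-ι) p_l^ι n (F p_1 - 1) - ι(ι-1) p_l^{ι-2} Q] dμ`. Here `Q` comes from differentiating the
weights in the divergence. For `l = k` it is a positive definite quadratic form in `dp_k`: `dF` is a
negative multiple of `dp_k`, and in the cone `Γ_k⁺` the Newton tensor has positive eigenvalues
(`gradient_term`).

The signs of the other terms are the Newton-Maclaurin inequalities `F p_{k+1} ≤ p_k`, `F p_k ≤
p_{k-1}` and `1 ≤ F p_1`. They hold for all times because `k`-convexity cannot be lost while `p_k >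
0` (`kConvex`).

If a functional is constant, its signed integrand vanishes. The equality case of Maclaurin gives
`p_2 = p_1²`, that is, umbilicity; for curves the term `Q` gives constant curvature instead. Then
`dν = p_1 dX` with `p_1` constant, so `ν - p_1 X` is constant and the image lies in a sphere, which
it fills by connectedness (`isRoundSphere_of_isSpherical`). Conversely, on round spheres every term
of the integrand vanishes. -/

theorem esymm_cons_succ {R : Type*} [CommSemiring R] (a : R) (s : Multiset R) (k : ℕ) :
    (a ::ₘ s).esymm (k + 1) = s.esymm (k + 1) + a * s.esymm k := by
  simp [Multiset.esymm, Multiset.powersetCard_cons, Multiset.sum_map_mul_left]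

theorem esymm_zero' {R : Type*} [CommSemiring R] (s : Multiset R) : s.esymm 0 = 1 := by
  simp [Multiset.esymm]

theorem esymm_eq_zero_of_card_lt {R : Type*} [CommSemiring R] {s : Multiset R} {k : ℕ}
    (h : Multiset.card s < k) : s.esymm k = 0 := by
  simp [Multiset.esymm, Multiset.powersetCard_eq_empty k h]

/-- The normalized elementary symmetric function of a multiset of real numbers. -/
def normEsymm (s : Multiset ℝ) (k : ℕ) : ℝ := s.esymm k / ((Multiset.card s).choose k : ℝ)

theorem normEsymm_zero (s : Multiset ℝ) : normEsymm s 0 = 1 := by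
  simp [normEsymm, esymm_zero']

theorem esymm_eq_choose_mul_normEsymm (s : Multiset ℝ) (k : ℕ) :
    s.esymm k = ((Multiset.card s).choose k : ℝ) * normEsymm s k := by
  unfold normEsymm
  rcases le_or_gt k (Multiset.card s) with h | h
  · have : ((Multiset.card s).choose k : ℝ) ≠ 0 := by
      exact_mod_cast (Nat.choose_pos h).ne'
    field_simp
  · rw [esymm_eq_zero_of_card_lt h]; simp

/-- Newton's inequality for the last three symmetric functions, with denominators cleared. Adjoining
one number `a` turns the defect into a perfect square plus `a²` times the old defect, so induction
on the number of entries needs no sign assumption. -/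
theorem top_newton : ∀ (n : ℕ) (s : Multiset ℝ), Multiset.card s = n + 2 →
    2 * (n + 2 : ℝ) * s.esymm (n + 2) * s.esymm n ≤ (n + 1) * s.esymm (n + 1) ^ 2 := by
  intro n
  induction n with
  | zero =>
    intro s hs
    obtain ⟨x, y, rfl⟩ := Multiset.card_eq_two.1 hs
    have h1 : ({x, y} : Multiset ℝ) = x ::ₘ y ::ₘ 0 := rfl
    rw [h1]
    have z1 : (0 : Multiset ℝ).esymm 1 = 0 := esymm_eq_zero_of_card_lt (by simp)
    have z2 : (0 : Multiset ℝ).esymm 2 = 0 := esymm_eq_zero_of_card_lt (by simp)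
    simp only [zero_add, esymm_zero', z1, z2,
      esymm_cons_succ _ _ 1, esymm_cons_succ _ _ 0]
    norm_num
    nlinarith [sq_nonneg (x - y)]
  | succ n ih =>
    intro s hs
    obtain ⟨a, ha⟩ := Multiset.card_pos_iff_exists_mem.1 (show 0 < Multiset.card s by omega)
    obtain ⟨t, rfl⟩ := Multiset.exists_cons_of_mem ha
    have ht : Multiset.card t = n + 2 := by simpa using hs
    have h := ih t ht
    have z : t.esymm (n + 3) = 0 := esymm_eq_zero_of_card_lt (by omega)
    rw [show n + 1 + 2 = (n + 2) + 1 by ring, show n + 1 + 1 = (n + 1) + 1 by ring,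
      esymm_cons_succ, esymm_cons_succ, esymm_cons_succ, z]
    rw [show n + 1 + 1 = n + 2 by ring]
    set x := t.esymm (n + 2)
    set y := t.esymm (n + 1)
    set w := t.esymm n
    have hn : (0 : ℝ) < n + 2 := by positivity
    -- The factor `n + 2` completes the square `((n + 2) x - a y)²`; what remains is the inductive
    -- defect.
    have key : 0 ≤ (n + 2 : ℝ) * (((n : ℝ) + 2) * (x + a * y) ^ 2
        - 2 * (n + 3) * (a * x) * (y + a * w)) := by
      have e : (n + 2 : ℝ) * (((n : ℝ) + 2) * (x + a * y) ^ 2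
        - 2 * (n + 3) * (a * x) * (y + a * w)) = ((n + 2) * x - a * y) ^ 2
        + (n + 3) * a ^ 2 * ((n + 1) * y ^ 2 - 2 * (n + 2) * x * w) := by ring
      rw [e]
      have : 0 ≤ (n + 1) * y ^ 2 - 2 * (n + 2) * x * w := by linarith
      positivity
    have := nonneg_of_mul_nonneg_right key hn
    push_cast
    nlinarith [this]

theorem normEsymm_top_newton (n : ℕ) (s : Multiset ℝ) (hs : Multiset.card s = n + 2) :
    normEsymm s n * normEsymm s (n + 2) ≤ normEsymm s (n + 1) ^ 2 := by
  have h := top_newton n s hs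
  have c0 : (((n + 2).choose n : ℕ) : ℝ) = (n + 2) * (n + 1) / 2 := by
    rw [show (n + 2).choose n = (n + 2).choose 2 by
      rw [← Nat.choose_symm (show 2 ≤ n + 2 by omega)]; simp, Nat.cast_choose_two]
    push_cast; ring
  have c1 : (((n + 2).choose (n + 1) : ℕ) : ℝ) = n + 2 := by
    rw [Nat.choose_succ_self_right]; push_cast; ring
  unfold normEsymm
  rw [hs, c0, c1, Nat.choose_self, div_mul_div_comm, div_pow, div_le_div_iff₀ (by positivity)
    (by positivity)]
  push_cast
  have hn : (0 : ℝ) ≤ (n + 2) / 2 := by positivity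
  nlinarith [mul_le_mul_of_nonneg_left h hn]

/-- The roots of the derivative of a real-rooted polynomial have the same normalized elementary
symmetric functions. -/
theorem exists_normEsymm_eq (n : ℕ) (s : Multiset ℝ) (hs : Multiset.card s = n + 1) :
    ∃ t : Multiset ℝ, Multiset.card t = n ∧ ∀ j ≤ n, normEsymm t j = normEsymm s j := by
  set P : ℝ[X] := (s.map fun a => X - C a).prod with hP
  have hPm : P.Monic := monic_multiset_prod_of_monic _ _ fun a _ => monic_X_sub_C a
  have hPd : P.natDegree = n + 1 := by
    rw [hP, natDegree_multiset_prod_X_sub_C_eq_card, hs]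
  have hPr : P.roots = s := by rw [hP, roots_multiset_prod_X_sub_C]
  have hdc : P.derivative.coeff n = n + 1 := by
    rw [coeff_derivative, ← hPd, hPm.coeff_natDegree]; simp
  have hn1 : (n + 1 : ℝ) ≠ 0 := by positivity
  have hdd : P.derivative.natDegree = n := by
    refine le_antisymm ?_ (le_natDegree_of_ne_zero (by rw [hdc]; exact hn1))
    have := natDegree_derivative_le P
    omega
  have hlc : P.derivative.leadingCoeff = n + 1 := by rw [leadingCoeff, hdd, hdc]
  -- By Rolle a polynomial has at most one root more than its derivative, so here the derivative
  -- splits.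
  have hcard : Multiset.card P.derivative.roots = n := by
    have h1 := card_roots_le_derivative P
    rw [hPr, hs] at h1
    have h2 := card_roots' P.derivative
    omega
  refine ⟨P.derivative.roots, hcard, fun j hj => ?_⟩
  have h1 := coeff_eq_esymm_roots_of_card (p := P.derivative) (by rw [hcard, hdd])
    (k := n - j) (by omega)
  have h2 := coeff_eq_esymm_roots_of_card (p := P) (by rw [hPr, hs, hPd])
    (k := n - j + 1) (by omega)
  rw [coeff_derivative, h2, hlc, hdd, hPd, hPr, hPm.leadingCoeff] at h1
  rw [show n - (n - j) = j by omega, show n + 1 - (n - j + 1) = j by omega] at h1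
  have h3 : (s.esymm j) * ((n : ℝ) - j + 1) = (n + 1) * P.derivative.roots.esymm j := by
    have hc : ((n - j : ℕ) : ℝ) = n - j := by rw [Nat.cast_sub hj]
    rw [hc] at h1
    have hne : ((-1 : ℝ) ^ j) ≠ 0 := by simp
    apply mul_left_cancel₀ hne
    linear_combination h1
  -- The factor produced by differentiating a monomial is the ratio of the two binomial
  -- normalizations.
  have h4 : ((n + 1).choose j : ℝ) * (n - j + 1) = (n + 1) * (n.choose j : ℝ) := by
    have := Nat.add_one_mul_choose_eq n (n - j)
    rw [Nat.choose_symm hj] at this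
    have e : (n + 1).choose (n - j + 1) = (n + 1).choose j := by
      rw [← Nat.choose_symm (show j ≤ n + 1 by omega)]; congr 1; omega
    rw [e] at this
    have this' : ((n + 1 : ℕ) : ℝ) * (n.choose j : ℝ) = ((n + 1).choose j : ℝ) * ((n - j + 1 : ℕ) : ℝ) := by
      exact_mod_cast this
    rw [Nat.cast_add (n - j) 1, Nat.cast_sub hj] at this'
    push_cast at this'
    linarith
  unfold normEsymm
  rw [hcard, hs]
  have c1 : ((n + 1).choose j : ℝ) ≠ 0 := by exact_mod_cast (Nat.choose_pos (by omega)).ne'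
  have c2 : (n.choose j : ℝ) ≠ 0 := by exact_mod_cast (Nat.choose_pos hj).ne'
  have c3 : ((n : ℝ) - j + 1) ≠ 0 := by
    have : (j : ℝ) ≤ n := by exact_mod_cast hj
    linarith
  rw [div_eq_div_iff c2 c1]
  apply mul_left_cancel₀ hn1
  linear_combination (-((n + 1).choose j : ℝ)) * h3 + s.esymm j * h4

/-- **Newton's inequality**. -/
theorem newton (s : Multiset ℝ) (j : ℕ) (hj : j + 2 ≤ Multiset.card s) :
    normEsymm s j * normEsymm s (j + 2) ≤ normEsymm s (j + 1) ^ 2 := by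
  obtain ⟨d, hd⟩ := Nat.exists_eq_add_of_le hj
  induction d generalizing s with
  | zero => exact normEsymm_top_newton j s (by omega)
  | succ d ih =>
    -- Each differentiation lowers the number of entries by one without changing the `normEsymm`
    -- that occur, until only `j + 2` entries are left.
    obtain ⟨t, ht, h⟩ := exists_normEsymm_eq (j + 2 + d) s (by omega)
    rw [← h j (by omega), ← h (j + 2) (by omega), ← h (j + 1) (by omega)]
    exact ih t (by omega) (by omega)

/-! ### Maclaurin's inequalities and their equality cases -/

section Maclaurin

variable {q : ℕ → ℝ} {k : ℕ}

/-- With `a, b, c` consecutive terms, `b^j c^{j+1} ≤ a^{j+1} c^{j+1} ≤ b^{2j+2}` by induction and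
Newton; cancel `b^j`. Equality forces equality one step lower and so descends to `q 2 = q 1 ^ 2`.
The top term need only be nonnegative, as `p_{k+1}` has no sign in `Γ_k⁺`. -/
theorem maclaurin_pow (h0 : q 0 = 1) (hpos : ∀ i, 1 ≤ i → i ≤ k → 0 < q i) :
    ∀ j, 1 ≤ j → j ≤ k → (∀ i, i + 1 ≤ j → q i * q (i + 2) ≤ q (i + 1) ^ 2) → 0 ≤ q (j + 1) →
      q (j + 1) ^ j ≤ q j ^ (j + 1) ∧ (q (j + 1) ^ j = q j ^ (j + 1) → q 2 = q 1 ^ 2) := by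
  intro j hj
  induction j, hj using Nat.le_induction with
  | base =>
    intro hk hN hp
    have := hN 0 (by omega)
    rw [h0, one_mul] at this
    simpa using this
  | succ j hj ih =>
    intro hk hN hp
    obtain ⟨h1, h2⟩ := ih (by omega) (fun i hi => hN i (by omega)) (hpos _ (by omega) hk).le
    have hb := hpos (j + 1) (by omega) hk
    have ha := hpos j (by omega) (by omega)
    have hN' := hN j (by omega)
    set a := q j
    set b := q (j + 1)
    set c := q (j + 1 + 1)
    have e1 : (a * c) ^ (j + 1) ≤ (b ^ 2) ^ (j + 1) := pow_le_pow_left₀ (by positivity) hN' _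
    have e2 : b ^ j * c ^ (j + 1) ≤ a ^ (j + 1) * c ^ (j + 1) :=
      mul_le_mul_of_nonneg_right h1 (by positivity)
    have hbj : 0 < b ^ j := by positivity
    have e3 : b ^ j * c ^ (j + 1) ≤ b ^ j * b ^ (j + 1 + 1) := by
      calc _ ≤ _ := e2
        _ = (a * c) ^ (j + 1) := by ring
        _ ≤ _ := e1
        _ = _ := by ring
    refine ⟨le_of_mul_le_mul_left e3 hbj, fun he => h2 ?_⟩
    have hc : 0 < c ^ (j + 1) := by rw [he]; positivity
    refine le_antisymm h1 (le_of_mul_le_mul_right ?_ hc)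
    calc a ^ (j + 1) * c ^ (j + 1) = (a * c) ^ (j + 1) := by ring
        _ ≤ _ := e1
        _ = b ^ j * b ^ (j + 1 + 1) := by ring
        _ = _ := by rw [he]

theorem maclaurin_one (h0 : q 0 = 1) (hpos : ∀ i, 1 ≤ i → i ≤ k → 0 < q i)
    (hN : ∀ i, i + 2 ≤ k → q i * q (i + 2) ≤ q (i + 1) ^ 2) :
    ∀ j, 1 ≤ j → j ≤ k → q j ≤ q 1 ^ j ∧ (1 < j → q j = q 1 ^ j → q 2 = q 1 ^ 2) := by
  intro j hj
  induction j, hj using Nat.le_induction with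
  | base => intro hk; simp
  | succ j hj ih =>
    intro hk
    obtain ⟨h1, h2⟩ := ih (by omega)
    have hb := hpos (j + 1) (by omega) hk
    have ha := hpos j (by omega) (by omega)
    have h1p := hpos 1 le_rfl (by omega)
    obtain ⟨m1, m2⟩ := maclaurin_pow h0 hpos j hj (by omega) (fun i hi => hN i (by omega)) hb.le
    have hle : q (j + 1) ^ j ≤ (q 1 ^ (j + 1)) ^ j := by
      calc _ ≤ _ := m1
        _ ≤ (q 1 ^ j) ^ (j + 1) := pow_le_pow_left₀ ha.le h1 _
        _ = _ := by ring
    refine ⟨le_of_pow_le_pow_left₀ (by omega) (by positivity) hle, fun _ he => m2 ?_⟩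
    refine le_antisymm m1 ?_
    calc _ ≤ (q 1 ^ j) ^ (j + 1) := pow_le_pow_left₀ ha.le h1 _
        _ = (q 1 ^ (j + 1)) ^ j := by ring
        _ = _ := by rw [he]

/-- This bounds `q i` below by a power of `q k`, which keeps `q i` from tending to zero while `q k`
stays positive. -/
theorem maclaurin_pow_le (h0 : q 0 = 1) (hpos : ∀ i, 1 ≤ i → i ≤ k → 0 < q i)
    (hN : ∀ i, i + 2 ≤ k → q i * q (i + 2) ≤ q (i + 1) ^ 2) (i : ℕ) (hi : 1 ≤ i) :
    ∀ j, i ≤ j → j ≤ k → q j ^ i ≤ q i ^ j := by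
  intro j hj
  induction j, hj using Nat.le_induction with
  | base => intro _; exact le_rfl
  | succ j hj ih =>
    intro hk
    have hb := hpos (j + 1) (by omega) hk
    have ha := hpos j (by omega) (by omega)
    have hp := hpos i hi (by omega)
    obtain ⟨m1, -⟩ := maclaurin_pow h0 hpos j (by omega) (by omega)
      (fun i hi => hN i (by omega)) hb.le
    refine le_of_pow_le_pow_left₀ (n := j) (by omega) (by positivity) ?_
    calc (q (j + 1) ^ i) ^ j = (q (j + 1) ^ j) ^ i := by ring
      _ ≤ (q j ^ (j + 1)) ^ i := pow_le_pow_left₀ (by positivity) m1 _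
      _ = (q j ^ i) ^ (j + 1) := by ring
      _ ≤ (q i ^ j) ^ (j + 1) := pow_le_pow_left₀ (by positivity) (ih (by omega)) _
      _ = _ := by ring

theorem rpow_root_pow {x : ℝ} (hx : 0 < x) (hk : 0 < k) : (x ^ (1 / (k : ℝ))) ^ k = x := by
  rw [← Real.rpow_natCast, ← Real.rpow_mul hx.le, one_div,
    inv_mul_cancel₀ (by exact_mod_cast hk.ne'), Real.rpow_one]

theorem rpow_neg_root_pow {x : ℝ} (hx : 0 < x) (hk : 0 < k) :
    (x ^ (-(1 / (k : ℝ)))) ^ k = x⁻¹ := by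
  rw [Real.rpow_neg hx.le, inv_pow, rpow_root_pow hx hk]

/-- Maclaurin's inequality between `q_{k+1}` and `q_k`, with its equality case. -/
theorem maclaurin_next (hk : 0 < k) (h0 : q 0 = 1) (hpos : ∀ i, 1 ≤ i → i ≤ k → 0 < q i)
    (hN : ∀ i, i + 1 ≤ k → q i * q (i + 2) ≤ q (i + 1) ^ 2) :
    q k ^ (-(1 / (k : ℝ))) * q (k + 1) ≤ q k ∧
      (q k ^ (-(1 / (k : ℝ))) * q (k + 1) = q k → q 2 = q 1 ^ 2) := by
  have hq := hpos k hk le_rfl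
  have hF : 0 < q k ^ (-(1 / (k : ℝ))) := Real.rpow_pos_of_pos hq _
  have hFk := rpow_neg_root_pow hq hk
  set F := q k ^ (-(1 / (k : ℝ)))
  -- For `q (k + 1) ≤ 0` the inequality is strict and trivial; otherwise compare `k`-th powers,
  -- where `F ^ k = (q k)⁻¹`.
  rcases le_or_gt (q (k + 1)) 0 with h | h
  · exact ⟨(mul_nonpos_of_nonneg_of_nonpos hF.le h).trans hq.le, fun he => absurd he
      (by nlinarith [mul_nonpos_of_nonneg_of_nonpos hF.le h])⟩
  obtain ⟨m1, m2⟩ := maclaurin_pow h0 hpos k hk le_rfl hN h.le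
  have e : (F * q (k + 1)) ^ k = (q k)⁻¹ * q (k + 1) ^ k := by rw [mul_pow, hFk]
  have e' : (q k) ^ k = (q k)⁻¹ * q k ^ (k + 1) := by field_simp; ring
  constructor
  · refine le_of_pow_le_pow_left₀ hk.ne' hq.le ?_
    rw [e, e']
    exact mul_le_mul_of_nonneg_left m1 (by positivity)
  · intro he
    apply m2
    have : (F * q (k + 1)) ^ k = q k ^ k := by rw [he]
    rw [e, e'] at this
    exact mul_left_cancel₀ (by positivity) this

/-- Since `F ^ k = (q k)⁻¹`, the `k`-th power of the inequality is `q k ^ (k - 1) ≤ q (k - 1) ^ k`.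
-/
theorem maclaurin_prev (hk : 1 < k) (h0 : q 0 = 1) (hpos : ∀ i, 1 ≤ i → i ≤ k → 0 < q i)
    (hN : ∀ i, i + 2 ≤ k → q i * q (i + 2) ≤ q (i + 1) ^ 2) :
    q k ^ (-(1 / (k : ℝ))) * q k ≤ q (k - 1) ∧
      (q k ^ (-(1 / (k : ℝ))) * q k = q (k - 1) → q 2 = q 1 ^ 2) := by
  obtain ⟨j, rfl⟩ : ∃ j, k = j + 1 := ⟨k - 1, by omega⟩
  rw [Nat.add_sub_cancel]
  have hq := hpos (j + 1) (by omega) le_rfl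
  have hj := hpos j (by omega) (by omega)
  have hF : 0 < q (j + 1) ^ (-(1 / ((j + 1 : ℕ) : ℝ))) := Real.rpow_pos_of_pos hq _
  have hFk := rpow_neg_root_pow (k := j + 1) hq (by omega)
  set F := q (j + 1) ^ (-(1 / ((j + 1 : ℕ) : ℝ)))
  obtain ⟨m1, m2⟩ := maclaurin_pow h0 hpos j (by omega) (by omega)
    (fun i hi => hN i (by omega)) hq.le
  have e : (F * q (j + 1)) ^ (j + 1) = q (j + 1) ^ j := by
    rw [mul_pow, hFk]; field_simp; ring
  constructor
  · refine le_of_pow_le_pow_left₀ (n := j + 1) (by omega) hj.le ?_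
    rw [e]; exact m1
  · intro he
    apply m2
    rw [← e, he]

/-- The `k`-th power of the inequality is `q k ≤ q 1 ^ k`. For `k = 1` equality always holds, so the
rigidity clause needs `1 < k`. -/
theorem maclaurin_first (hk : 0 < k) (h0 : q 0 = 1) (hpos : ∀ i, 1 ≤ i → i ≤ k → 0 < q i)
    (hN : ∀ i, i + 2 ≤ k → q i * q (i + 2) ≤ q (i + 1) ^ 2) :
    1 ≤ q k ^ (-(1 / (k : ℝ))) * q 1 ∧
      (1 < k → q k ^ (-(1 / (k : ℝ))) * q 1 = 1 → q 2 = q 1 ^ 2) := by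
  have hq := hpos k hk le_rfl
  have h1 := hpos 1 le_rfl hk
  have hF : 0 < q k ^ (-(1 / (k : ℝ))) := Real.rpow_pos_of_pos hq _
  have hFk := rpow_neg_root_pow hq hk
  set F := q k ^ (-(1 / (k : ℝ)))
  obtain ⟨m1, m2⟩ := maclaurin_one h0 hpos hN k hk le_rfl
  have e : (F * q 1) ^ k = (q k)⁻¹ * q 1 ^ k := by rw [mul_pow, hFk]
  constructor
  · refine le_of_pow_le_pow_left₀ hk.ne' (by positivity) ?_
    rw [e, one_pow, ← inv_mul_cancel₀ hq.ne']
    exact mul_le_mul_of_nonneg_left m1 (by positivity)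
  · intro hk1 he
    apply m2 hk1
    have h : (F * q 1) ^ k = 1 := by rw [he, one_pow]
    rw [e] at h
    field_simp at h
    linarith

end Maclaurin

/-- In the cone `Γ_k⁺`, omitting one entry leaves `σ_j` positive for `j < k`. -/
theorem esymm_pos_of_cons (a : ℝ) (s : Multiset ℝ) (k : ℕ)
    (h : ∀ i, i ≤ k → 0 < (a ::ₘ s).esymm i) : ∀ j, j < k → 0 < s.esymm j := by
  intro j
  induction j with
  | zero => intro _; simp [esymm_zero']
  | succ j ih =>
    intro hj
    have hpos := ih (by omega)
    by_contra! hneg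
    have h1 := h (j + 1) (by omega)
    have h2 := h (j + 2) (by omega)
    rw [esymm_cons_succ] at h1 h2
    set x := s.esymm j with hx
    set y := s.esymm (j + 1) with hy
    set z := s.esymm (j + 2) with hz
    -- If `σ_{j+1}(s) = y ≤ 0`, then `y + a x > 0` forces `a > 0`, and `z + a y > 0` gives `z > -a y
    -- ≥ 0`. Hence `y² ≤ (-y) a x < x z`, against Newton's inequality and the log-concavity of
    -- binomial coefficients.
    have ha : 0 < a := by
      by_contra! hle
      nlinarith
    have hzpos : 0 < z := by nlinarith
    have hlt : y ^ 2 < x * z := by nlinarith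
    have hcard : j + 2 ≤ Multiset.card s := by
      by_contra! hc
      rw [hz, esymm_eq_zero_of_card_lt hc] at hzpos
      exact lt_irrefl _ hzpos
    have hN := newton s j hcard
    rw [hx, hy, hz, esymm_eq_choose_mul_normEsymm s j, esymm_eq_choose_mul_normEsymm s (j + 1),
      esymm_eq_choose_mul_normEsymm s (j + 2)] at hlt
    set m := Multiset.card s
    have hbin : (m.choose j : ℝ) * m.choose (j + 2) ≤ (m.choose (j + 1) : ℝ) ^ 2 := by
      have b1 := Nat.choose_succ_right_eq m j
      have b2 := Nat.choose_succ_right_eq m (j + 1)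
      obtain ⟨d, hd⟩ := Nat.exists_eq_add_of_le hcard
      rw [show m - j = d + 2 by omega] at b1
      rw [show m - (j + 1) = d + 1 by omega] at b2
      have b1' : (m.choose (j + 1) : ℝ) * (j + 1) = m.choose j * (d + 2) := by exact_mod_cast b1
      have b2' : (m.choose (j + 2) : ℝ) * (j + 2) = m.choose (j + 1) * (d + 1) := by
        exact_mod_cast b2
      have hpos' : (0 : ℝ) < (d + 2) * (j + 2) := by positivity
      refine le_of_mul_le_mul_right ?_ hpos'
      have : (m.choose j : ℝ) * m.choose (j + 2) * ((d + 2) * (j + 2))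
          = (m.choose (j + 1) : ℝ) ^ 2 * ((j + 1) * (d + 1)) := by
        linear_combination (-(m.choose (j + 2) : ℝ) * (j + 2)) * b1' +
          ((m.choose (j + 1) : ℝ) * (j + 1)) * b2'
      rw [this]
      refine mul_le_mul_of_nonneg_left ?_ (by positivity)
      nlinarith [Nat.cast_nonneg (α := ℝ) j, Nat.cast_nonneg (α := ℝ) d]
    have hxz : 0 < normEsymm s j * normEsymm s (j + 2) := by
      have c1 : 0 < normEsymm s j := by unfold normEsymm; have := Nat.choose_pos (show j ≤ m by omega); positivity
      have c2 : 0 < normEsymm s (j + 2) := by unfold normEsymm; have := Nat.choose_pos (show j + 2 ≤ m by omega); positivity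
      positivity
    have := mul_le_mul hbin hN hxz.le (by positivity)
    nlinarith

end Symmetric

/-! ### Determinants of frames and orthonormal principal directions -/

section LinearAlgebra

variable {n : ℕ}

/-- The parameter space `ℝⁿ`. -/
abbrev Par (n : ℕ) : Type := EuclideanSpace ℝ (Fin n)

/-- The coordinate vectors of `ℝⁿ`. -/
def stdDir (i : Fin n) : Par n := EuclideanSpace.single i (1 : ℝ)

/-- The standard volume form of `ℝⁿ⁺¹`. -/
def volForm (n : ℕ) : Amb n [⋀^Fin (n + 1)]→ₗ[ℝ] ℝ :=
  (EuclideanSpace.basisFun (Fin (n + 1)) ℝ).toBasis.det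

theorem continuous_volForm (n : ℕ) : Continuous (volForm n) := by
  have : (volForm n : (Fin (n + 1) → Amb n) → ℝ) =
      fun v => Matrix.det (Matrix.of fun i j => v j i) := by
    ext v
    simp only [volForm, Module.Basis.det_apply]
    rfl
  rw [this]
  refine Continuous.matrix_det ?_
  refine continuous_matrix fun i j => ?_
  simp only [Matrix.of_apply]
  fun_prop

/-- The volume form as a continuous multilinear map. -/
def volFormL (n : ℕ) : ContinuousMultilinearMap ℝ (fun _ : Fin (n + 1) => Amb n) ℝ :=
  ⟨(volForm n).toMultilinearMap, continuous_volForm n⟩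

theorem volFormL_apply (v : Fin (n + 1) → Amb n) : volFormL n v = volForm n v := rfl

/-- The volume form of the hyperplane orthogonal to `ν`. -/
def hyperVol (ν : Amb n) : Amb n [⋀^Fin n]→ₗ[ℝ] ℝ := (volForm n).curryLeft ν

theorem hyperVol_apply (ν : Amb n) (v : Fin n → Amb n) :
    hyperVol ν v = volForm n (Fin.cons ν v) := rfl

/-- The Jacobian determinant of a linear map into the hyperplane orthogonal to `ν`. -/
def jac (A : Par n →L[ℝ] Amb n) (ν : Amb n) : ℝ := hyperVol ν fun i => A (stdDir i)

/-- The flux of the vector `w` through the frame given by `A`, contracted with the covector `η`. -/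
def fluxForm (A : Par n →L[ℝ] Amb n) (ν w : Amb n) (η : Par n →L[ℝ] ℝ) : ℝ :=
  ∑ i, η (stdDir i) * hyperVol ν (Function.update (fun j => A (stdDir j)) i w)

theorem alternating_comp_eq_det_mul (f : Par n [⋀^Fin n]→ₗ[ℝ] ℝ) (L : Par n →ₗ[ℝ] Par n) :
    f (fun i => L (stdDir i)) = LinearMap.det L * f stdDir := by
  set e := (EuclideanSpace.basisFun (Fin n) ℝ).toBasis
  have he : (e : Fin n → Par n) = stdDir := by
    ext i; simp [e, stdDir]
  have h := f.eq_smul_basis_det e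
  have hd := Module.Basis.det_comp e L e
  rw [Module.Basis.det_self, mul_one, he] at hd
  rw [h]
  simp only [AlternatingMap.smul_apply, smul_eq_mul]
  have h2 : (fun i => L (stdDir i)) = (L ∘ stdDir : Fin n → Par n) := rfl
  rw [h2, hd, ← he, Module.Basis.det_self]
  ring

theorem jac_comp (A : Par n →L[ℝ] Amb n) (ν : Amb n) (L : Par n →L[ℝ] Par n) :
    jac (A ∘L L) ν = LinearMap.det (L : Par n →ₗ[ℝ] Par n) * jac A ν :=
  alternating_comp_eq_det_mul ((hyperVol ν).compLinearMap (A : Par n →ₗ[ℝ] Amb n))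
    (L : Par n →ₗ[ℝ] Par n)

theorem update_cons_succ' (ν : Amb n) (v : Fin n → Amb n) (i : Fin n) (w : Amb n) :
    Function.update (Fin.cons ν v : Fin (n + 1) → Amb n) i.succ w =
      Fin.cons ν (Function.update v i w) := (Fin.cons_update _ _ _ _).symm

/-- Derivative of the volume form along a curve of frames. -/
theorem hasFDerivAt_volForm {V : Type*} [NormedAddCommGroup V] [NormedSpace ℝ V]
    {ν : V → Amb n} {v : V → Fin n → Amb n} {ν' : V →L[ℝ] Amb n} {v' : Fin n → V →L[ℝ] Amb n}
    {q : V} (hν : HasFDerivAt ν ν' q) (hv : ∀ i, HasFDerivAt (fun x => v x i) (v' i) q) :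
    ∃ D : V →L[ℝ] ℝ, HasFDerivAt (fun x => hyperVol (ν x) (v x)) D q ∧ ∀ d : V,
      D d = hyperVol (ν' d) (v q) + ∑ i, hyperVol (ν q) (Function.update (v q) i (v' i d)) := by
  have hc : HasFDerivAt (fun x => (Fin.cons (ν x) (v x) : Fin (n + 1) → Amb n))
      (ContinuousLinearMap.pi (Fin.cons ν' v' : Fin (n + 1) → V →L[ℝ] Amb n)) q := by
    rw [hasFDerivAt_pi']
    intro i
    refine Fin.cases ?_ (fun i => ?_) i
    · simpa using! hν
    · simpa using! hv i
  refine ⟨_, ((volFormL n).hasFDerivAt _).comp q hc, fun d => ?_⟩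
  simp only [ContinuousLinearMap.comp_apply, ContinuousMultilinearMap.linearDeriv_apply,
    Fin.sum_univ_succ, volFormL_apply, hyperVol_apply]
  congr 1
  · simp
  · refine Finset.sum_congr rfl fun i _ => ?_
    rw [update_cons_succ']
    simp

theorem hasDerivAt_hyperVol {v : ℝ → Fin n → Amb n} {v' : Fin n → Amb n} (ν : Amb n) {s : ℝ}
    (hv : ∀ i, HasDerivAt (fun x => v x i) (v' i) s) :
    HasDerivAt (fun x => hyperVol ν (v x))
      (∑ i, hyperVol ν (Function.update (v s) i (v' i))) s := by
  obtain ⟨D, hD, hD'⟩ := hasFDerivAt_volForm (hasFDerivAt_const ν s)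
    (fun i => (hv i).hasFDerivAt)
  have h := hD.hasDerivAt
  have e := hD' 1
  have z : hyperVol (0 : Amb n) (v s) = 0 := by simp [hyperVol]
  simp [z] at e
  rwa [e] at h

/-- Seeing the flux as the first variation of `jac` in the direction `η ⊗ w` lets it inherit the
transformation law of `jac`. -/
theorem hasDerivAt_jac_flux (A : Par n →L[ℝ] Amb n) (ν w : Amb n) (η : Par n →L[ℝ] ℝ) :
    HasDerivAt (fun ε : ℝ => jac (A + ε • η.smulRight w) ν) (fluxForm A ν w η) 0 := by
  have := hasDerivAt_hyperVol (n := n) (s := 0) ν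
    (v := fun ε i => (A + ε • η.smulRight w) (stdDir i))
    (v' := fun i => η (stdDir i) • w) (fun i => by
      simp only [add_apply, smul_apply,
        ContinuousLinearMap.smulRight_apply]
      have h := ((hasDerivAt_id (0 : ℝ)).smul_const (η (stdDir i) • w)).const_add (A (stdDir i))
      simpa using! h)
  convert! this using 1
  simp [fluxForm]

theorem fluxForm_comp (A : Par n →L[ℝ] Amb n) (ν w : Amb n) (η : Par n →L[ℝ] ℝ)
    (L : Par n →L[ℝ] Par n) :
    fluxForm (A ∘L L) ν w (η ∘L L) =
      LinearMap.det (L : Par n →ₗ[ℝ] Par n) * fluxForm A ν w η := by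
  have h1 := hasDerivAt_jac_flux (A ∘L L) ν w (η ∘L L)
  have h2 := (hasDerivAt_jac_flux A ν w η).const_mul (LinearMap.det (L : Par n →ₗ[ℝ] Par n))
  refine h1.unique (h2.congr_of_eventuallyEq (Filter.Eventually.of_forall fun ε => ?_))
  show _ = _ * _
  rw [← jac_comp]
  rfl

/-- Simultaneous diagonalization of the first and second fundamental forms. -/
theorem exists_principal_frame (A B : Par n →L[ℝ] Amb n) (ν : Amb n) (hν : ‖ν‖ = 1)
    (hA : Function.Injective A) (hAν : ∀ v, inner ℝ (A v) ν = 0)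
    (hBν : ∀ v, inner ℝ (B v) ν = 0)
    (hsymm : ∀ v w, inner ℝ (B v) (A w) = inner ℝ (A v) (B w)) :
    ∃ (L : Par n ≃L[ℝ] Par n) (κ : Fin n → ℝ), Orthonormal ℝ (fun i => A (L (stdDir i))) ∧
      ∀ i, B (L (stdDir i)) = κ i • A (L (stdDir i)) := by
  set V : Submodule ℝ (Amb n) := (Submodule.span ℝ {ν})ᗮ with hV
  have hν0 : ν ≠ 0 := by
    rintro rfl; simp at hν
  have : Fact (Module.finrank ℝ (Amb n) = n + 1) := ⟨by simp⟩
  have hfin : Module.finrank ℝ V = n := Submodule.finrank_orthogonal_span_singleton hν0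
  have memV : ∀ x : Amb n, inner ℝ x ν = 0 → x ∈ V := fun x hx =>
    Submodule.mem_orthogonal_singleton_iff_inner_left.2 hx
  let A' : Par n →ₗ[ℝ] V := LinearMap.codRestrict V (A : Par n →ₗ[ℝ] Amb n)
    fun v => memV _ (hAν v)
  let B' : Par n →ₗ[ℝ] V := LinearMap.codRestrict V (B : Par n →ₗ[ℝ] Amb n)
    fun v => memV _ (hBν v)
  have hA' : Function.Injective A' := fun x y h => hA (congrArg Subtype.val h)
  let e : Par n ≃ₗ[ℝ] V := LinearEquiv.ofInjectiveOfFinrankEq A' hA' (by rw [hfin]; simp)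
  have he : ∀ v, ((e v : V) : Amb n) = A v := fun v => rfl
  -- The shape operator on the tangent hyperplane; the principal frame is its orthonormal eigenbasis
  -- pulled back through `A`.
  let S : V →ₗ[ℝ] V := B' ∘ₗ e.symm.toLinearMap
  have hS : S.IsSymmetric := by
    intro x y
    obtain ⟨v, rfl⟩ := e.surjective x
    obtain ⟨w, rfl⟩ := e.surjective y
    simp only [S, LinearMap.comp_apply, LinearEquiv.coe_coe, LinearEquiv.symm_apply_apply]
    exact hsymm v w
  set b := hS.eigenvectorBasis hfin
  let L : Par n ≃ₗ[ℝ] Par n := b.repr.symm.toLinearEquiv.trans e.symm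
  have hL : ∀ i, e (L (stdDir i)) = b i := by
    intro i
    have : b.repr.symm (stdDir i) = b i := by simp [stdDir]
    show e (e.symm (b.repr.symm (stdDir i))) = b i
    rw [this, LinearEquiv.apply_symm_apply]
  refine ⟨L.toContinuousLinearEquiv, hS.eigenvalues hfin, ?_, fun i => ?_⟩
  · have h1 : (fun i => A (L.toContinuousLinearEquiv (stdDir i))) =
        V.subtypeₗᵢ ∘ b := by
      ext1 i
      show A (L (stdDir i)) = _
      rw [← he, hL]; rfl
    rw [h1]
    exact b.orthonormal.comp_linearIsometry _
  · show B (L (stdDir i)) = _ • A (L (stdDir i))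
    have h2 := hS.apply_eigenvectorBasis hfin i
    have h3 : S (b i) = B' (L (stdDir i)) := by
      rw [← hL]; simp [S]
    have h4 := congrArg Subtype.val (h3.symm.trans h2)
    rw [← he, hL]
    exact h4

theorem orthonormal_cons (ν : Amb n) (hν : ‖ν‖ = 1) {u : Fin n → Amb n} (hu : Orthonormal ℝ u)
    (huν : ∀ i, inner ℝ (u i) ν = 0) :
    Orthonormal ℝ (Fin.cons ν u : Fin (n + 1) → Amb n) := by
  rw [orthonormal_iff_ite]
  intro i j
  refine Fin.cases ?_ (fun i => ?_) i <;> refine Fin.cases ?_ (fun j => ?_) j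
  · simp [hν]
  · simp only [Fin.cons_zero, Fin.cons_succ]
    rw [real_inner_comm, huν, if_neg (by simp [Fin.ext_iff])]
  · simp only [Fin.cons_zero, Fin.cons_succ]
    rw [huν, if_neg (by simp [Fin.ext_iff])]
  · simp only [Fin.cons_succ, Fin.succ_inj]
    exact (orthonormal_iff_ite.1 hu) i j

/-- The orthonormal basis consisting of a unit vector and an orthonormal frame orthogonal to it. -/
theorem exists_orthonormalBasis_cons (ν : Amb n) (hν : ‖ν‖ = 1) {u : Fin n → Amb n}
    (hu : Orthonormal ℝ u) (huν : ∀ i, inner ℝ (u i) ν = 0) :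
    ∃ b : OrthonormalBasis (Fin (n + 1)) ℝ (Amb n), (b : Fin (n + 1) → Amb n) = Fin.cons ν u := by
  have h := orthonormal_cons ν hν hu huν
  let b := basisOfOrthonormalOfCardEqFinrank h (by simp)
  have hb : (b : Fin (n + 1) → Amb n) = Fin.cons ν u :=
    coe_basisOfOrthonormalOfCardEqFinrank _ _
  refine ⟨b.toOrthonormalBasis (by rw [hb]; exact h), ?_⟩
  rw [Module.Basis.coe_toOrthonormalBasis, hb]

theorem abs_hyperVol_orthonormal (ν : Amb n) (hν : ‖ν‖ = 1) {u : Fin n → Amb n}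
    (hu : Orthonormal ℝ u) (huν : ∀ i, inner ℝ (u i) ν = 0) : |hyperVol ν u| = 1 := by
  obtain ⟨b, hb⟩ := exists_orthonormalBasis_cons ν hν hu huν
  rw [hyperVol_apply, ← hb]
  rcases (EuclideanSpace.basisFun (Fin (n + 1)) ℝ).det_to_matrix_orthonormalBasis_real b with h | h
  · rw [volForm, h]; simp
  · rw [volForm, h]; simp

theorem sum_inner_frame (ν : Amb n) (hν : ‖ν‖ = 1) {u : Fin n → Amb n}
    (hu : Orthonormal ℝ u) (huν : ∀ i, inner ℝ (u i) ν = 0) (w : Amb n) :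
    w = inner ℝ ν w • ν + ∑ i, inner ℝ (u i) w • u i := by
  obtain ⟨b, hb⟩ := exists_orthonormalBasis_cons ν hν hu huν
  have := b.sum_repr' w
  rw [Fin.sum_univ_succ, hb] at this
  simpa using this.symm

end LinearAlgebra

/-! ### Area element, flux and Weingarten matrix in a principal frame -/

section PrincipalFrame

variable {n : ℕ}

/-- Pointwise data of an immersed hypersurface: `A` is the differential of the immersion, `B` the
differential of the unit normal `ν`. -/
structure IsHypersurfacePoint (A B : Par n →L[ℝ] Amb n) (ν : Amb n) : Prop where
  norm_eq_one : ‖ν‖ = 1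
  injective : Function.Injective A
  inner_left : ∀ v, inner ℝ (A v) ν = 0
  inner_right : ∀ v, inner ℝ (B v) ν = 0
  symm : ∀ v w, inner ℝ (B v) (A w) = inner ℝ (A v) (B w)

/-- The frame `L e₁, …, L eₙ` consists of orthonormal principal directions with principal
curvatures `κ`. -/
structure IsPrincipalFrame (A B : Par n →L[ℝ] Amb n) (L : Par n ≃L[ℝ] Par n) (κ : Fin n → ℝ) :
    Prop where
  orthonormal : Orthonormal ℝ (fun i => A (L (stdDir i)))
  principal : ∀ i, B (L (stdDir i)) = κ i • A (L (stdDir i))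

theorem IsHypersurfacePoint.exists_frame {A B : Par n →L[ℝ] Amb n} {ν : Amb n}
    (h : IsHypersurfacePoint A B ν) : ∃ L κ, IsPrincipalFrame A B L κ := by
  obtain ⟨L, κ, h1, h2⟩ := exists_principal_frame A B ν h.norm_eq_one h.injective h.inner_left
    h.inner_right h.symm
  exact ⟨L, κ, h1, h2⟩

variable {A B : Par n →L[ℝ] Amb n} {ν : Amb n} {L : Par n ≃L[ℝ] Par n} {κ : Fin n → ℝ}

theorem det_ne_zero_of_equiv (L : Par n ≃L[ℝ] Par n) :
    LinearMap.det ((L : Par n →L[ℝ] Par n) : Par n →ₗ[ℝ] Par n) ≠ 0 :=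
  (LinearEquiv.isUnit_det' L.toLinearEquiv).ne_zero

theorem IsPrincipalFrame.abs_jac_comp (hF : IsPrincipalFrame A B L κ)
    (h : IsHypersurfacePoint A B ν) : |jac (A ∘L (L : Par n →L[ℝ] Par n)) ν| = 1 :=
  abs_hyperVol_orthonormal ν h.norm_eq_one hF.orthonormal fun _ => h.inner_left _

theorem IsHypersurfacePoint.jac_ne_zero (h : IsHypersurfacePoint A B ν) : jac A ν ≠ 0 := by
  obtain ⟨L, κ, hF⟩ := h.exists_frame
  have := hF.abs_jac_comp h
  rw [jac_comp] at this
  intro h0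
  simp [h0] at this

/-- In the principal frame `A + s B` merely rescales the `i`-th vector by `1 + s κᵢ`; the
determinant of `L` cancels on both sides. -/
theorem IsPrincipalFrame.jac_add_smul (hF : IsPrincipalFrame A B L κ) (s : ℝ) :
    jac (A + s • B) ν = jac A ν * ∏ i, (1 + s * κ i) := by
  have h1 := jac_comp (A + s • B) ν (L : Par n →L[ℝ] Par n)
  have h2 := jac_comp A ν (L : Par n →L[ℝ] Par n)
  have h3 : jac ((A + s • B) ∘L (L : Par n →L[ℝ] Par n)) ν =
      (∏ i, (1 + s * κ i)) * jac (A ∘L (L : Par n →L[ℝ] Par n)) ν := by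
    have := (hyperVol ν).toMultilinearMap.map_smul_univ (fun i => 1 + s * κ i)
      (fun i => A (L (stdDir i)))
    simp only [AlternatingMap.coe_multilinearMap, smul_eq_mul] at this
    refine Eq.trans (congrArg (hyperVol ν) ?_) this
    ext1 i
    simp [hF.principal, add_smul, mul_smul]
  rw [h1, h2] at h3
  apply mul_left_cancel₀ (det_ne_zero_of_equiv L)
  linear_combination h3

theorem prod_one_add_mul_eq_sum {ι : Type*} (t : Finset ι) (κ : ι → ℝ) (s : ℝ) :
    ∏ i ∈ t, (1 + s * κ i) =
      ∑ j ∈ Finset.range (t.card + 1), (t.val.map κ).esymm j * s ^ j := by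
  rw [Finset.prod_one_add, Finset.sum_powerset]
  refine Finset.sum_congr rfl fun j hj => ?_
  rw [Finset.esymm_map_val, Finset.sum_mul]
  refine Finset.sum_congr rfl fun r hr => ?_
  rw [Finset.prod_mul_distrib, Finset.prod_const, (Finset.mem_powersetCard.1 hr).2, mul_comm]

/-- Only the `uᵢ`-component of `w` survives in slot `i`: its other components repeat a vector
already present in the determinant. -/
theorem hyperVol_update_frame (hν : ‖ν‖ = 1) {u : Fin n → Amb n}
    (hu : Orthonormal ℝ u) (huν : ∀ i, inner ℝ (u i) ν = 0) (a : Fin n → ℝ) (i : Fin n)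
    (w : Amb n) :
    hyperVol ν (Function.update (fun j => a j • u j) i w) =
      inner ℝ (u i) w * (∏ j ∈ Finset.univ.erase i, a j) * hyperVol ν u := by
  have e1 : Function.update (fun j => a j • u j) i w =
      fun j => (Function.update a i 1 j) • (Function.update u i w j) := by
    ext1 j
    rcases eq_or_ne j i with rfl | hj
    · simp
    · simp [hj]
  have h := (hyperVol ν).toMultilinearMap.map_smul_univ (Function.update a i 1)
    (Function.update u i w)
  simp only [AlternatingMap.coe_multilinearMap, smul_eq_mul] at h
  rw [e1, h]
  have e2 : ∏ j, Function.update a i 1 j = ∏ j ∈ Finset.univ.erase i, a j := by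
    rw [← Finset.mul_prod_erase _ _ (Finset.mem_univ i)]
    simp only [Function.update_self, one_mul]
    refine Finset.prod_congr rfl fun j hj => ?_
    rw [Function.update_of_ne (Finset.ne_of_mem_erase hj)]
  have e3 : hyperVol ν (Function.update u i w) = inner ℝ (u i) w * hyperVol ν u := by
    conv_lhs => rw [sum_inner_frame ν hν hu huν w]
    rw [AlternatingMap.map_update_add, AlternatingMap.map_update_smul,
      AlternatingMap.map_update_sum, Finset.sum_eq_single i]
    · have z : hyperVol ν (Function.update u i ν) = 0 := by
        rw [hyperVol_apply, ← update_cons_succ']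
        have := (volForm n).map_update_self (Fin.cons ν u : Fin (n + 1) → Amb n)
          (i := i.succ) (j := 0) (by simp [Fin.ext_iff])
        simpa using! this
      rw [z, AlternatingMap.map_update_smul, Function.update_eq_self]
      simp
    · intro j _ hj
      rw [AlternatingMap.map_update_smul, (hyperVol ν).map_update_self u hj.symm, smul_zero]
    · simp
  rw [e2, e3]
  ring

/-- The flux through the parallel frame `A + s B` of the vector `w₀ + s w₁`, where `w₁` is
determined by the variation of the normal. -/
theorem IsPrincipalFrame.fluxForm_eq (hF : IsPrincipalFrame A B L κ)
    (h : IsHypersurfacePoint A B ν) (w₀ w₁ : Amb n) (φ η : Par n →L[ℝ] ℝ)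
    (hw : ∀ v, inner ℝ w₁ (A v) = - φ v + inner ℝ (B v) w₀) (s : ℝ) :
    fluxForm (A + s • B) ν (w₀ + s • w₁) η = jac A ν *
      ∑ i, η (L (stdDir i)) * (inner ℝ (A (L (stdDir i))) w₀ * ∏ j, (1 + s * κ j) -
        φ (L (stdDir i)) * (s * ∏ j ∈ Finset.univ.erase i, (1 + s * κ j))) := by
  have h1 := fluxForm_comp (A + s • B) ν (w₀ + s • w₁) η (L : Par n →L[ℝ] Par n)
  have h2 := jac_comp A ν (L : Par n →L[ℝ] Par n)
  have h3 : fluxForm ((A + s • B) ∘L (L : Par n →L[ℝ] Par n)) ν (w₀ + s • w₁)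
      (η ∘L (L : Par n →L[ℝ] Par n)) = jac (A ∘L (L : Par n →L[ℝ] Par n)) ν *
      ∑ i, η (L (stdDir i)) * (inner ℝ (A (L (stdDir i))) w₀ * ∏ j, (1 + s * κ j) -
        φ (L (stdDir i)) * (s * ∏ j ∈ Finset.univ.erase i, (1 + s * κ j))) := by
    rw [fluxForm, Finset.mul_sum]
    refine Finset.sum_congr rfl fun i _ => ?_
    have e : (fun j => ((A + s • B) ∘L (L : Par n →L[ℝ] Par n)) (stdDir j)) =
        fun j => (1 + s * κ j) • A (L (stdDir j)) := by
      ext1 j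
      simp [hF.principal, add_smul, mul_smul]
    rw [e, hyperVol_update_frame h.norm_eq_one hF.orthonormal (fun _ => h.inner_left _)]
    -- The `B`-part of `hw` supplies the factor `1 + s κᵢ` missing from the product over `j ≠ i`, so
    -- the `w₀`-part of the flux carries the full product.
    have e2 : inner ℝ (A (L (stdDir i))) (w₀ + s • w₁) =
        (1 + s * κ i) * inner ℝ (A (L (stdDir i))) w₀ - s * φ (L (stdDir i)) := by
      rw [inner_add_right, inner_smul_right, real_inner_comm w₁, hw, hF.principal,
        inner_smul_left]
      simp only [conj_trivial]
      ring
    rw [e2, ← Finset.mul_prod_erase Finset.univ (fun j => 1 + s * κ j) (Finset.mem_univ i)]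
    simp only [ContinuousLinearMap.comp_apply, ContinuousLinearEquiv.coe_coe, jac]
    ring
  rw [h1, h2] at h3
  apply mul_left_cancel₀ (det_ne_zero_of_equiv L)
  rw [h3]; ring

/-- The matrix of the metric in a frame. -/
def gramMat (A B : Par n →L[ℝ] Amb n) : Matrix (Fin n) (Fin n) ℝ :=
  Matrix.of fun i j => inner ℝ (A (stdDir i)) (B (stdDir j))

theorem map_eq_sum_stdDir {G : Type*} [NormedAddCommGroup G] [NormedSpace ℝ G]
    (A : Par n →L[ℝ] G) (v : Par n) : A v = ∑ i, v i • A (stdDir i) := by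
  conv_lhs => rw [← (EuclideanSpace.basisFun (Fin n) ℝ).sum_repr v]
  simp [stdDir]

theorem gramMat_comp (A B : Par n →L[ℝ] Amb n) (L : Par n ≃L[ℝ] Par n) :
    (Matrix.of fun i j => (L (stdDir j)) i).transpose * gramMat A B *
      (Matrix.of fun i j => (L (stdDir j)) i) =
      Matrix.of fun i j => inner ℝ (A (L (stdDir i))) (B (L (stdDir j))) := by
  ext i j
  simp only [Matrix.mul_apply, Matrix.transpose_apply, Matrix.of_apply, gramMat]
  rw [map_eq_sum_stdDir A, map_eq_sum_stdDir B, sum_inner, Finset.sum_congr rfl fun _ _ =>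
    Finset.sum_mul _ _ _, Finset.sum_comm]
  refine Finset.sum_congr rfl fun a _ => ?_
  rw [inner_sum]
  refine Finset.sum_congr rfl fun b _ => ?_
  rw [inner_smul_left, inner_smul_right]
  simp only [conj_trivial]
  ring

theorem det_frameMatrix (L : Par n ≃L[ℝ] Par n) :
    (Matrix.of fun i j => (L (stdDir j)) i).det =
      LinearMap.det ((L : Par n →L[ℝ] Par n) : Par n →ₗ[ℝ] Par n) := by
  rw [← LinearMap.det_toMatrix (EuclideanSpace.basisFun (Fin n) ℝ).toBasis]
  congr 1

theorem IsPrincipalFrame.gram_eq_one (hF : IsPrincipalFrame A B L κ) :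
    (Matrix.of fun i j => (L (stdDir j)) i).transpose * gramMat A A *
      (Matrix.of fun i j => (L (stdDir j)) i) = 1 := by
  rw [gramMat_comp]
  ext i j
  rw [Matrix.of_apply, (orthonormal_iff_ite.1 hF.orthonormal) i j, Matrix.one_apply]

theorem IsPrincipalFrame.gram_eq_diagonal (hF : IsPrincipalFrame A B L κ) :
    (Matrix.of fun i j => (L (stdDir j)) i).transpose * gramMat B A *
      (Matrix.of fun i j => (L (stdDir j)) i) = Matrix.diagonal κ := by
  rw [gramMat_comp]
  ext i j
  rw [Matrix.of_apply, hF.principal, inner_smul_left, (orthonormal_iff_ite.1 hF.orthonormal) i j,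
    Matrix.diagonal_apply]
  simp

/-- In the principal frame the Gram matrix is the identity and `jac` is `±1`; changing back
multiplies them by the square of a determinant and by that determinant. The orientation is not
controlled, hence the absolute value. -/
theorem IsHypersurfacePoint.sqrt_det_gram (h : IsHypersurfacePoint A B ν) :
    Real.sqrt (gramMat A A).det = |jac A ν| := by
  obtain ⟨L, κ, hF⟩ := h.exists_frame
  have h1 := congrArg Matrix.det hF.gram_eq_one
  rw [Matrix.det_mul, Matrix.det_mul, Matrix.det_transpose, Matrix.det_one, det_frameMatrix] at h1
  have h2 := hF.abs_jac_comp h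
  rw [jac_comp] at h2
  have h3 := det_ne_zero_of_equiv L
  set d := LinearMap.det ((L : Par n →L[ℝ] Par n) : Par n →ₗ[ℝ] Par n)
  have h4 : (d * jac A ν) ^ 2 = 1 := by rw [← sq_abs, h2, one_pow]
  have h5 : (gramMat A A).det = jac A ν ^ 2 := by
    apply mul_left_cancel₀ (pow_ne_zero 2 h3)
    linear_combination h1 - h4
  rw [h5, Real.sqrt_sq_eq_abs]

/-- With `P` the matrix of the frame, `Pᵀ g P = 1` gives `g⁻¹ = P Pᵀ`, so `g⁻¹ h = P (Pᵀ h P) P⁻¹`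
is similar to `diag κ`. -/
theorem IsPrincipalFrame.roots_charpoly (hF : IsPrincipalFrame A B L κ) :
    ((gramMat A A)⁻¹ * gramMat B A).charpoly.roots = Finset.univ.val.map κ := by
  set P : Matrix (Fin n) (Fin n) ℝ := Matrix.of fun i j => (L (stdDir j)) i with hP
  have h1 := hF.gram_eq_one
  have h2 := hF.gram_eq_diagonal
  rw [← hP] at h1 h2
  have hu : IsUnit P := by
    rw [Matrix.isUnit_iff_isUnit_det, det_frameMatrix]
    exact (det_ne_zero_of_equiv L).isUnit
  obtain ⟨U, hU⟩ := hu
  have h3 : (gramMat A A)⁻¹ = P * P.transpose := by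
    refine Matrix.inv_eq_left_inv ?_
    have : P * P.transpose * gramMat A A = P * (P.transpose * gramMat A A * P) *
        (U⁻¹).val := by
      rw [← hU]; simp only [Matrix.mul_assoc]
      rw [Units.mul_inv, Matrix.mul_one]
    rw [this, h1, Matrix.mul_one, ← hU, Units.mul_inv]
  have h4 : (gramMat A A)⁻¹ * gramMat B A = U.val * Matrix.diagonal κ * (U⁻¹).val := by
    rw [h3, ← h2, ← hU]; simp only [Matrix.mul_assoc]
    rw [Units.mul_inv, Matrix.mul_one]
  have h5 := Matrix.charpoly_units_conj U (Matrix.diagonal κ)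
  rw [h4, Matrix.coe_units_inv, h5, Matrix.charpoly_diagonal]
  have h6 := Polynomial.roots_multiset_prod_X_sub_C (Finset.univ.val.map κ)
  rwa [Multiset.map_map] at h6

end PrincipalFrame

/-! ### Extracting coefficients of polynomials in the parallel distance -/

section Coefficients

/-- The `l`-th coefficient of a polynomial function of degree at most `n`, as a linear combination
of its values at `0, …, n`. -/
def coefAt (n l : ℕ) (φ : ℝ → ℝ) : ℝ :=
  ∑ m ∈ Finset.range (n + 1),
    (Lagrange.basis (Finset.range (n + 1)) (fun m : ℕ => (m : ℝ)) m).coeff l * φ m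

-- By Lagrange interpolation a coefficient is a fixed linear combination of values at the nodes `0,
-- …, n`. Thus `coefAt` commutes with sums and derivatives in space and time, and identities in `s`
-- can be differentiated for each fixed `s`.
open Polynomial in
theorem coefAt_eq {n l : ℕ} (hl : l ≤ n) {φ : ℝ → ℝ} (α : ℕ → ℝ)
    (h : ∀ s, φ s = ∑ j ∈ Finset.range (n + 1), α j * s ^ j) : coefAt n l φ = α l := by
  set P : ℝ[X] := ∑ j ∈ Finset.range (n + 1), C (α j) * X ^ j with hP
  have hdeg : P.degree < ((Finset.range (n + 1)).card : ℕ) := by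
    rw [Finset.card_range]
    refine (degree_sum_le _ _).trans_lt ?_
    rw [Finset.sup_lt_iff (WithBot.bot_lt_coe _)]
    intro j hj
    refine (degree_C_mul_X_pow_le _ _).trans_lt ?_
    exact_mod_cast Finset.mem_range.1 hj
  have hev : ∀ s, P.eval s = φ s := by
    intro s; rw [h, hP, eval_finsetSum]; simp
  have hinj : Set.InjOn (fun m : ℕ => (m : ℝ)) (Finset.range (n + 1) : Set ℕ) :=
    fun a _ b _ hab => Nat.cast_injective hab
  have h1 := Lagrange.eq_interpolate hinj hdeg
  have h2 : P.coeff l = α l := by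
    rw [hP, finsetSum_coeff, Finset.sum_eq_single l]
    · simp
    · intro b _ hb; simp [coeff_X_pow, hb.symm]
    · intro hn; exact absurd (Finset.mem_range.2 (by omega)) hn
  rw [← h2, h1, Lagrange.interpolate_apply, finsetSum_coeff, coefAt]
  refine Finset.sum_congr rfl fun m _ => ?_
  rw [coeff_C_mul, hev, mul_comm]

theorem coefAt_add (n l : ℕ) (φ ψ : ℝ → ℝ) :
    coefAt n l (fun s => φ s + ψ s) = coefAt n l φ + coefAt n l ψ := by
  simp [coefAt, mul_add, Finset.sum_add_distrib]

theorem coefAt_const_mul (n l : ℕ) (c : ℝ) (φ : ℝ → ℝ) :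
    coefAt n l (fun s => c * φ s) = c * coefAt n l φ := by
  simp only [coefAt, Finset.mul_sum]
  exact Finset.sum_congr rfl fun _ _ => by ring

theorem coefAt_sum {ι : Type*} (t : Finset ι) (n l : ℕ) (φ : ι → ℝ → ℝ) :
    coefAt n l (fun s => ∑ i ∈ t, φ i s) = ∑ i ∈ t, coefAt n l (φ i) := by
  simp only [coefAt, Finset.mul_sum]
  exact Finset.sum_comm

end Coefficients

/-! ### Coefficients of the area element and of the flux at a point -/

section Pointwise

variable {n : ℕ} {A B : Par n →L[ℝ] Amb n} {ν : Amb n} {L : Par n ≃L[ℝ] Par n} {κ : Fin n → ℝ}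

theorem IsPrincipalFrame.jac_add_smul_eq_sum (hF : IsPrincipalFrame A B L κ) (s : ℝ) :
    jac (A + s • B) ν = ∑ j ∈ Finset.range (n + 1),
      (jac A ν * (Finset.univ.val.map κ).esymm j) * s ^ j := by
  rw [hF.jac_add_smul, prod_one_add_mul_eq_sum, Finset.card_fin, Finset.mul_sum]
  exact Finset.sum_congr rfl fun _ _ => by ring

theorem IsPrincipalFrame.coefAt_jac (hF : IsPrincipalFrame A B L κ) {l : ℕ} (hl : l ≤ n) :
    coefAt n l (fun s => jac (A + s • B) ν) = jac A ν * (Finset.univ.val.map κ).esymm l :=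
  coefAt_eq hl (fun j => jac A ν * (Finset.univ.val.map κ).esymm j) hF.jac_add_smul_eq_sum

/-- The `l`-th coefficient of the derivative terms `(F + s) D'(s) - n D(s)` of
`D(s) = det(A + s B)`. -/
theorem IsPrincipalFrame.coefAt_deriv (hF : IsPrincipalFrame A B L κ) {l : ℕ} (hl : l ≤ n)
    (F : ℝ) {D' : ℝ → ℝ} (hD : ∀ s, HasDerivAt (fun s => jac (A + s • B) ν) (D' s) s) :
    coefAt n l (fun s => (F + s) * D' s - n * jac (A + s • B) ν) =
      jac A ν * (F * ((l + 1) * (Finset.univ.val.map κ).esymm (l + 1)) -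
        (n - l) * (Finset.univ.val.map κ).esymm l) := by
  set σ := fun j => (Finset.univ.val.map κ).esymm j with hσ
  set J := jac A ν
  have hfun : (fun s => jac (A + s • B) ν) =
      fun s => ∑ j ∈ Finset.range (n + 1), (J * σ j) * s ^ j :=
    funext fun s => hF.jac_add_smul_eq_sum s
  have hz : σ (n + 1) = 0 := esymm_eq_zero_of_card_lt (by simp)
  have hD' : ∀ s, D' s = ∑ j ∈ Finset.range (n + 1), (J * σ j) * (j * s ^ (j - 1)) := by
    intro s
    refine (hD s).unique ?_
    rw [hfun]
    exact HasDerivAt.fun_sum fun j _ => (hasDerivAt_pow j s).const_mul _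
  refine coefAt_eq hl (fun j => J * (F * ((j + 1) * σ (j + 1)) - (n - j) * σ j)) fun s => ?_
  rw [congrFun hfun s, hD']
  -- The shifted sum may keep the range up to `n` because its added top term contains `σ (n + 1) =
  -- 0`.
  have e1 : ∑ j ∈ Finset.range (n + 1), (J * σ j) * (j * s ^ (j - 1)) =
      ∑ j ∈ Finset.range (n + 1), (J * σ (j + 1)) * ((j + 1) * s ^ j) := by
    rw [Finset.sum_range_succ', Finset.sum_range_succ _ n, hz]
    simp
  have e2 : s * ∑ j ∈ Finset.range (n + 1), (J * σ j) * (j * s ^ (j - 1)) =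
      ∑ j ∈ Finset.range (n + 1), (J * σ j) * (j * s ^ j) := by
    rw [Finset.mul_sum]
    refine Finset.sum_congr rfl fun j _ => ?_
    rcases j with _ | j
    · simp
    · rw [Nat.add_sub_cancel]; ring
  rw [add_mul, e2, e1, Finset.mul_sum, Finset.mul_sum, ← Finset.sum_add_distrib,
    ← Finset.sum_sub_distrib]
  exact Finset.sum_congr rfl fun j _ => by ring

/-- The product over the `m` indices `j ≠ i` has degree `m`; the factor `s` shifts it, so `σ_{l-1}`
without `κᵢ` sits at `s^l` and nothing at `s^0`. -/
theorem flux_polynomial {m : ℕ} (hn : n = m + 1) (κ : Fin n → ℝ) (J : ℝ) (a b : Fin n → ℝ)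
    (e : Fin n → ℝ) (s : ℝ) :
    J * ∑ i, e i * (a i * ∏ j, (1 + s * κ j) -
        b i * (s * ∏ j ∈ Finset.univ.erase i, (1 + s * κ j))) =
      ∑ l ∈ Finset.range (n + 1), (J * ((∑ i, e i * a i) * (Finset.univ.val.map κ).esymm l -
        if l = 0 then 0 else
          ∑ i, e i * b i * ((Finset.univ.erase i).val.map κ).esymm (l - 1))) * s ^ l := by
  subst hn
  have h1 : ∀ i, s * ∏ j ∈ Finset.univ.erase i, (1 + s * κ j) =
      ∑ l ∈ Finset.range (m + 1 + 1),
        (if l = 0 then 0 else ((Finset.univ.erase i).val.map κ).esymm (l - 1)) * s ^ l := by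
    intro i
    rw [prod_one_add_mul_eq_sum, Finset.card_erase_of_mem (Finset.mem_univ i), Finset.card_fin,
      Finset.sum_range_succ' _ (m + 1), Nat.add_sub_cancel, Finset.mul_sum]
    simp only [if_true, zero_mul, add_zero, Nat.add_eq_zero_iff, one_ne_zero, and_false, if_false,
      Nat.add_sub_cancel]
    exact Finset.sum_congr rfl fun _ _ => by ring
  simp only [h1]
  simp only [prod_one_add_mul_eq_sum, Finset.card_fin]
  simp only [Finset.mul_sum, ← Finset.sum_sub_distrib]
  rw [Finset.sum_comm]
  refine Finset.sum_congr rfl fun l _ => ?_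
  rcases eq_or_ne l 0 with rfl | hl
  · simp only [if_true, Finset.sum_mul, Finset.mul_sum, sub_zero]
    exact Finset.sum_congr rfl fun _ _ => by ring
  · simp only [hl, if_false, Finset.sum_mul, Finset.mul_sum, ← Finset.sum_sub_distrib]
    exact Finset.sum_congr rfl fun _ _ => by ring

theorem IsPrincipalFrame.coefAt_flux (hn : 0 < n) (hF : IsPrincipalFrame A B L κ)
    (h : IsHypersurfacePoint A B ν) (w₀ w₁ : Amb n) (φ η : Par n →L[ℝ] ℝ)
    (hw : ∀ v, inner ℝ w₁ (A v) = - φ v + inner ℝ (B v) w₀) {l : ℕ} (hl : l ≤ n) :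
    coefAt n l (fun s => fluxForm (A + s • B) ν (w₀ + s • w₁) η) =
      jac A ν * ((∑ i, η (L (stdDir i)) * inner ℝ (A (L (stdDir i))) w₀) *
        (Finset.univ.val.map κ).esymm l - if l = 0 then 0 else
          ∑ i, η (L (stdDir i)) * φ (L (stdDir i)) *
            ((Finset.univ.erase i).val.map κ).esymm (l - 1)) := by
  obtain ⟨m, hm⟩ : ∃ m, n = m + 1 := ⟨n - 1, by omega⟩
  refine coefAt_eq hl (fun l => jac A ν * ((∑ i, η (L (stdDir i)) *
    inner ℝ (A (L (stdDir i))) w₀) * (Finset.univ.val.map κ).esymm l - if l = 0 then 0 else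
          ∑ i, η (L (stdDir i)) * φ (L (stdDir i)) *
            ((Finset.univ.erase i).val.map κ).esymm (l - 1))) fun s => ?_
  rw [hF.fluxForm_eq h w₀ w₁ φ η hw]
  exact flux_polynomial hm κ _ _ _ _ s

/-- The bracket of the flux coefficients which only involves the Newton tensor. -/
theorem IsPrincipalFrame.coefAt_flux_sub (hn : 0 < n) (hF : IsPrincipalFrame A B L κ)
    (h : IsHypersurfacePoint A B ν) (w₀ w₁ : Amb n) (φ η : Par n →L[ℝ] ℝ)
    (hw : ∀ v, inner ℝ w₁ (A v) = - φ v + inner ℝ (B v) w₀) {l : ℕ} (hl : l ≤ n) (hl0 : 0 < l) :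
    coefAt n l (fun s => fluxForm (A + s • B) ν (w₀ + s • w₁) η) -
      (Finset.univ.val.map κ).esymm l *
        coefAt n 0 (fun s => fluxForm (A + s • B) ν (w₀ + s • w₁) η) =
      - (jac A ν * ∑ i, η (L (stdDir i)) * φ (L (stdDir i)) *
            ((Finset.univ.erase i).val.map κ).esymm (l - 1)) := by
  rw [hF.coefAt_flux hn h w₀ w₁ φ η hw hl, hF.coefAt_flux hn h w₀ w₁ φ η hw (Nat.zero_le n),
    if_neg hl0.ne', if_pos rfl, esymm_zero']
  ring

/-- These numbers `∂σ_k/∂κᵢ` are the eigenvalues of the Newton tensor; their positivity is the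
ellipticity that makes the gradient term definite. -/
theorem esymm_erase_pos {k : ℕ} (hκ : ∀ i, i ≤ k → 0 < (Finset.univ.val.map κ).esymm i)
    (hk : 0 < k) (i : Fin n) : 0 < ((Finset.univ.erase i).val.map κ).esymm (k - 1) := by
  have e : (Finset.univ.val.map κ) = κ i ::ₘ ((Finset.univ.erase i).val.map κ) := by
    rw [← Multiset.map_cons, Finset.erase_val,
      Multiset.cons_erase (by exact Finset.mem_univ_val i)]
  rw [e] at hκ
  exact esymm_pos_of_cons _ _ k hκ _ (by omega)

end Pointwise

/-! ### Evolution of the area element of parallel hypersurfaces in a chart -/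

section LocalCalculus

variable {n : ℕ} {G : Type*} [NormedAddCommGroup G] [NormedSpace ℝ G]

/-- The spatial derivative of a function of `(y, t)`. -/
def dS (f : Par n × ℝ → G) (q : Par n × ℝ) : Par n →L[ℝ] G := fderiv ℝ (fun y => f (y, q.2)) q.1

/-- The time derivative of a function of `(y, t)`. -/
def dT (f : Par n × ℝ → G) (q : Par n × ℝ) : G := deriv (fun t => f (q.1, t)) q.2

theorem HasFDerivAt.dS_eq {f : Par n × ℝ → G} {f' : Par n × ℝ →L[ℝ] G} {q : Par n × ℝ}
    (h : HasFDerivAt f f' q) : dS f q = f' ∘L ContinuousLinearMap.inl ℝ (Par n) ℝ := by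
  have h1 : HasFDerivAt (fun y : Par n => (y, q.2)) (ContinuousLinearMap.inl ℝ (Par n) ℝ) q.1 :=
    hasFDerivAt_prodMk_left q.1 q.2
  exact (HasFDerivAt.comp q.1 (g := f) (f := fun y : Par n => (y, q.2)) h h1).fderiv

theorem HasFDerivAt.dT_eq {f : Par n × ℝ → G} {f' : Par n × ℝ →L[ℝ] G} {q : Par n × ℝ}
    (h : HasFDerivAt f f' q) : dT f q = f' (0, 1) := by
  have h1 : HasDerivAt (fun t : ℝ => (q.1, t)) ((0 : Par n), (1 : ℝ)) q.2 :=
    (hasDerivAt_const _ _).prodMk (hasDerivAt_id _)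
  exact (HasFDerivAt.comp_hasDerivAt q.2 (l := f) (f := fun t : ℝ => (q.1, t)) h h1).deriv

variable {O : Set (Par n × ℝ)}

theorem dS_eqOn {f : Par n × ℝ → G} (hO : IsOpen O) (hf : ContDiffOn ℝ ∞ f O) {q : Par n × ℝ}
    (hq : q ∈ O) : dS f q = (fderiv ℝ f q) ∘L ContinuousLinearMap.inl ℝ (Par n) ℝ :=
  HasFDerivAt.dS_eq ((hf.contDiffAt (hO.mem_nhds hq)).differentiableAt (by simp)).hasFDerivAt

theorem dT_eqOn {f : Par n × ℝ → G} (hO : IsOpen O) (hf : ContDiffOn ℝ ∞ f O) {q : Par n × ℝ}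
    (hq : q ∈ O) : dT f q = fderiv ℝ f q (0, 1) :=
  HasFDerivAt.dT_eq ((hf.contDiffAt (hO.mem_nhds hq)).differentiableAt (by simp)).hasFDerivAt

theorem contDiffOn_dS {f : Par n × ℝ → G} (hO : IsOpen O) (hf : ContDiffOn ℝ ∞ f O) (v : Par n) :
    ContDiffOn ℝ ∞ (fun q => dS f q v) O :=
  ((hf.fderiv_of_isOpen hO (m := ∞) (by simp)).clm_apply
    (contDiffOn_const (c := (ContinuousLinearMap.inl ℝ (Par n) ℝ v)))).congr
    fun q hq => by rw [dS_eqOn hO hf hq]; rfl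

theorem contDiffOn_dT {f : Par n × ℝ → G} (hO : IsOpen O) (hf : ContDiffOn ℝ ∞ f O) :
    ContDiffOn ℝ ∞ (dT f) O :=
  ((hf.fderiv_of_isOpen hO (m := ∞) (by simp)).clm_apply
    (contDiffOn_const (c := ((0 : Par n), (1 : ℝ))))).congr
    fun q hq => by rw [dT_eqOn hO hf hq]

theorem second_symm {f : Par n × ℝ → G} (hO : IsOpen O) (hf : ContDiffOn ℝ ∞ f O)
    {q : Par n × ℝ} (hq : q ∈ O) (v w : Par n × ℝ) :
    fderiv ℝ (fun x => fderiv ℝ f x v) q w = fderiv ℝ (fun x => fderiv ℝ f x w) q v := by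
  have h2 : ContDiffAt ℝ ∞ f q := hf.contDiffAt (hO.mem_nhds hq)
  have hd : DifferentiableAt ℝ (fderiv ℝ f) q :=
    (h2.fderiv_right (m := 1) (by norm_cast)).differentiableAt (by simp)
  have hs : IsSymmSndFDerivAt ℝ f q := h2.isSymmSndFDerivAt (by
    simpa using WithTop.coe_le_coe.2 (le_top (a := (2 : ℕ∞))))
  have e : ∀ v w, fderiv ℝ (fun x => fderiv ℝ f x v) q w = fderiv ℝ (fderiv ℝ f) q w v := by
    intro v w
    rw [fderiv_clm_apply hd (differentiableAt_const v)]
    simp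
  rw [e, e]
  exact hs.eq w v

theorem dS_dS_comm {f : Par n × ℝ → G} (hO : IsOpen O) (hf : ContDiffOn ℝ ∞ f O)
    {q : Par n × ℝ} (hq : q ∈ O) (v w : Par n) :
    dS (fun x => dS f x v) q w = dS (fun x => dS f x w) q v := by
  have e : ∀ v w, dS (fun x => dS f x v) q w =
      fderiv ℝ (fun x => fderiv ℝ f x (v, 0)) q (w, 0) := by
    intro v w
    rw [dS_eqOn hO (contDiffOn_dS hO hf v) hq]
    have : (fun x => dS f x v) =ᶠ[nhds q] fun x => fderiv ℝ f x (v, 0) :=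
      Filter.eventuallyEq_of_mem (hO.mem_nhds hq) fun x hx => by rw [dS_eqOn hO hf hx]; simp
    rw [this.fderiv_eq]; simp
  rw [e, e, second_symm hO hf hq]

theorem dS_dT_comm {f : Par n × ℝ → G} (hO : IsOpen O) (hf : ContDiffOn ℝ ∞ f O)
    {q : Par n × ℝ} (hq : q ∈ O) (v : Par n) :
    dS (dT f) q v = dT (fun x => dS f x v) q := by
  rw [dS_eqOn hO (contDiffOn_dT hO hf) hq, dT_eqOn hO (contDiffOn_dS hO hf v) hq]
  have h1 : (fun x => dS f x v) =ᶠ[nhds q] fun x => fderiv ℝ f x (v, 0) :=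
    Filter.eventuallyEq_of_mem (hO.mem_nhds hq) fun x hx => by rw [dS_eqOn hO hf hx]; simp
  have h2 : dT f =ᶠ[nhds q] fun x => fderiv ℝ f x (0, 1) :=
    Filter.eventuallyEq_of_mem (hO.mem_nhds hq) fun x hx => by rw [dT_eqOn hO hf hx]
  rw [h1.fderiv_eq, h2.fderiv_eq, ContinuousLinearMap.comp_apply, second_symm hO hf hq]; simp

theorem contDiffOn_hyperVol {V : Type*} [NormedAddCommGroup V] [NormedSpace ℝ V] {s : Set V}
    {ν : V → Amb n} {v : Fin n → V → Amb n} (hν : ContDiffOn ℝ ∞ ν s)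
    (hv : ∀ i, ContDiffOn ℝ ∞ (v i) s) :
    ContDiffOn ℝ ∞ (fun x => hyperVol (ν x) fun i => v i x) s := by
  have hc : ContDiffOn ℝ ∞ (fun x => (Fin.cons (ν x) (fun i => v i x) : Fin (n + 1) → Amb n)) s := by
    rw [contDiffOn_pi]
    intro i
    refine Fin.cases ?_ (fun i => ?_) i
    · simpa using! hν
    · simpa using! hv i
  exact (volFormL n).contDiff.comp_contDiffOn hc

theorem volForm_eq_zero_of_orthogonal {ν : Amb n} (hν : ν ≠ 0) {v : Fin (n + 1) → Amb n}
    (hv : ∀ i, inner ℝ (v i) ν = 0) : volForm n v = 0 := by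
  apply AlternatingMap.map_linearDependent
  intro hli
  have hspan := hli.span_eq_top_of_card_eq_finrank (by simp)
  have : ν ∈ Submodule.span ℝ (Set.range v) := by rw [hspan]; trivial
  have hle : Submodule.span ℝ (Set.range v) ≤ (Submodule.span ℝ {ν})ᗮ := by
    rw [Submodule.span_le]
    rintro _ ⟨i, rfl⟩
    exact Submodule.mem_orthogonal_singleton_iff_inner_left.2 (hv i)
  have h0 := Submodule.mem_orthogonal_singleton_iff_inner_left.1 (hle this)
  exact hν (inner_self_eq_zero.1 h0)

/-- With `b` and the `r j` all tangential, only the normal part of `w` contributes, and exchanging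
`ν` with `b` costs a sign. With `b = ∂ᵢν` this turns derivatives of the normal in the divergence
into curvature terms. -/
theorem hyperVol_tangent {ν b : Amb n} (hν : ‖ν‖ = 1) (hb : inner ℝ b ν = 0) {r : Fin n → Amb n}
    (hr : ∀ i, inner ℝ (r i) ν = 0) (i : Fin n) (w : Amb n) :
    hyperVol b (Function.update r i w) =
      - (inner ℝ w ν * hyperVol ν (Function.update r i b)) := by
  have hν0 : ν ≠ 0 := by rintro rfl; simp at hν
  have hw : w = inner ℝ w ν • ν + (w - inner ℝ w ν • ν) := by abel
  have h1 : hyperVol b (Function.update r i (w - inner ℝ w ν • ν)) = 0 := by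
    rw [hyperVol_apply]
    refine volForm_eq_zero_of_orthogonal hν0 fun j => ?_
    refine Fin.cases ?_ (fun j => ?_) j
    · simpa using! hb
    · rw [Fin.cons_succ]
      rcases eq_or_ne j i with rfl | hj
      · rw [Function.update_self, inner_sub_left, inner_smul_left, real_inner_self_eq_norm_sq, hν]
        simp
      · rw [Function.update_of_ne hj]; exact hr j
  have h2 : hyperVol b (Function.update r i ν) = - hyperVol ν (Function.update r i b) := by
    rw [hyperVol_apply, hyperVol_apply]
    have := (volForm n).map_swap (Fin.cons ν (Function.update r i b) : Fin (n + 1) → Amb n)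
      (i := 0) (j := i.succ) (by simp [Fin.ext_iff])
    rw [← this]
    congr 1
    ext1 j
    refine Fin.cases ?_ (fun j => ?_) j
    · simp
    · rcases eq_or_ne j i with rfl | hj
      · simp [Function.update_of_ne (Fin.succ_ne_zero j).symm]
      · have : Equiv.swap 0 i.succ j.succ = j.succ :=
          Equiv.swap_apply_of_ne_of_ne (Fin.succ_ne_zero j) (by simpa using hj)
        simp [this, hj]
  conv_lhs => rw [hw]
  rw [AlternatingMap.map_update_add, AlternatingMap.map_update_smul, h1, h2, smul_eq_mul]
  ring

/-- Exchanging `i` and `j` swaps two slots of an alternating form while the entries `h i j` are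
symmetric, so the terms cancel in pairs. It disposes of the second derivatives of the frame. -/
theorem sum_hyperVol_antisymm (ν w : Amb n) (r : Fin n → Amb n) (h : Fin n → Fin n → Amb n)
    (hs : ∀ i j, h i j = h j i) :
    ∑ i, ∑ j ∈ Finset.univ.erase i,
      hyperVol ν (Function.update (Function.update r i w) j (h i j)) = 0 := by
  set f : Fin n → Fin n → ℝ := fun i j => if i = j then 0 else
    hyperVol ν (Function.update (Function.update r i w) j (h i j)) with hf
  have e : ∀ i, ∑ j ∈ Finset.univ.erase i,
      hyperVol ν (Function.update (Function.update r i w) j (h i j)) = ∑ j, f i j := by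
    intro i
    rw [← Finset.add_sum_erase _ _ (Finset.mem_univ i)]
    simp only [hf, if_true, zero_add]
    refine Finset.sum_congr rfl fun j hj => ?_
    rw [if_neg (Finset.ne_of_mem_erase hj).symm]
  have anti : ∀ i j, f i j = - f j i := by
    intro i j
    rcases eq_or_ne i j with rfl | hij
    · simp [hf]
    · simp only [hf, if_neg hij, if_neg hij.symm]
      rw [← (hyperVol ν).map_swap _ hij, hs i j]
      congr 1
      ext1 a
      simp only [Function.comp_apply]
      rcases eq_or_ne a i with rfl | hai
      · simp [hij, hij.symm]
      · rcases eq_or_ne a j with rfl | haj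
        · simp
        · rw [Equiv.swap_apply_of_ne_of_ne hai haj]
          simp [hai, haj]
  simp only [e]
  have h1 : ∑ i, ∑ j, f i j = - ∑ i, ∑ j, f i j := by
    conv_lhs => rw [Finset.sum_comm]
    rw [← Finset.sum_neg_distrib]
    refine Finset.sum_congr rfl fun i _ => ?_
    rw [← Finset.sum_neg_distrib]
    exact Finset.sum_congr rfl fun j _ => anti j i
  linarith

/-- The frame of the parallel hypersurface at distance `s`. -/
def parFrame (X ν : Par n × ℝ → Amb n) (s : ℝ) (q : Par n × ℝ) (i : Fin n) : Amb n :=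
  dS X q (stdDir i) + s • dS ν q (stdDir i)

/-- The area element of the parallel hypersurface at distance `s`. -/
def parJac (X ν : Par n × ℝ → Amb n) (s : ℝ) (q : Par n × ℝ) : ℝ :=
  hyperVol (ν q) (parFrame X ν s q)

/-- The velocity of the parallel hypersurface, corrected by the rescaling. -/
def parVel (X ν : Par n × ℝ → Amb n) (s : ℝ) (q : Par n × ℝ) : Amb n :=
  (dT X q + X q) + s • dT ν q

/-- The components of the flux of `parVel`. -/
def parFlux (X ν : Par n × ℝ → Amb n) (s : ℝ) (q : Par n × ℝ) (i : Fin n) : ℝ :=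
  hyperVol (ν q) (Function.update (parFrame X ν s q) i (parVel X ν s q))

theorem parJac_eq_jac (X ν : Par n × ℝ → Amb n) (s : ℝ) (q : Par n × ℝ) :
    parJac X ν s q = jac (dS X q + s • dS ν q) (ν q) := rfl

theorem fluxForm_eq_sum_parFlux (X ν : Par n × ℝ → Amb n) (s : ℝ) (q : Par n × ℝ)
    (η : Par n →L[ℝ] ℝ) :
    fluxForm (dS X q + s • dS ν q) (ν q) (dT X q + X q + s • dT ν q) η =
      ∑ i, η (stdDir i) * parFlux X ν s q i := rfl

variable {X ν : Par n × ℝ → Amb n}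

theorem contDiffOn_parFrame (hO : IsOpen O) (hX : ContDiffOn ℝ ∞ X O) (hν : ContDiffOn ℝ ∞ ν O)
    (s : ℝ) (i : Fin n) : ContDiffOn ℝ ∞ (fun q => parFrame X ν s q i) O :=
  (contDiffOn_dS hO hX _).add ((contDiffOn_dS hO hν _).const_smul s)

theorem contDiffOn_parJac (hO : IsOpen O) (hX : ContDiffOn ℝ ∞ X O) (hν : ContDiffOn ℝ ∞ ν O)
    (s : ℝ) : ContDiffOn ℝ ∞ (parJac X ν s) O :=
  contDiffOn_hyperVol hν (contDiffOn_parFrame hO hX hν s)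

theorem contDiffOn_parVel (hO : IsOpen O) (hX : ContDiffOn ℝ ∞ X O) (hν : ContDiffOn ℝ ∞ ν O)
    (s : ℝ) : ContDiffOn ℝ ∞ (parVel X ν s) O :=
  ((contDiffOn_dT hO hX).add hX).add ((contDiffOn_dT hO hν).const_smul s)

theorem contDiffOn_parFlux (hO : IsOpen O) (hX : ContDiffOn ℝ ∞ X O) (hν : ContDiffOn ℝ ∞ ν O)
    (s : ℝ) (i : Fin n) : ContDiffOn ℝ ∞ (fun q => parFlux X ν s q i) O := by
  refine contDiffOn_hyperVol hν (v := fun j q =>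
    Function.update (parFrame X ν s q) i (parVel X ν s q) j) fun j => ?_
  rcases eq_or_ne j i with rfl | hj
  · simpa using contDiffOn_parVel hO hX hν s
  · simpa [hj] using contDiffOn_parFrame hO hX hν s j

/-- Evolution of the area element of the parallel hypersurfaces, up to a divergence. -/
theorem dT_parJac (hO : IsOpen O) (hX : ContDiffOn ℝ ∞ X O) (hν : ContDiffOn ℝ ∞ ν O)
    {q : Par n × ℝ} (hq : q ∈ O) (hν1 : ‖ν q‖ = 1)
    (hXt : ∀ v, inner ℝ (dS X q v) (ν q) = 0) (hνt : ∀ v, inner ℝ (dS ν q v) (ν q) = 0)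
    (hνT : inner ℝ (dT ν q) (ν q) = 0) (s : ℝ) :
    dT (parJac X ν s) q = ∑ i, dS (fun x => parFlux X ν s x i) q (stdDir i) +
      ((inner ℝ (dT X q + X q) (ν q) + s) *
        (∑ i, hyperVol (ν q) (Function.update (parFrame X ν s q) i (dS ν q (stdDir i)))) -
        n * parJac X ν s q) := by
  have hd : ∀ {H : Type} [NormedAddCommGroup H] [NormedSpace ℝ H] {f : Par n × ℝ → H},
      ContDiffOn ℝ ∞ f O → HasFDerivAt f (fderiv ℝ f q) q := fun hf =>
    ((hf.contDiffAt (hO.mem_nhds hq)).differentiableAt (by simp)).hasFDerivAt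
  have hr := contDiffOn_parFrame hO hX hν s
  have hW := contDiffOn_parVel hO hX hν s
  have hrt : ∀ i, inner ℝ (parFrame X ν s q i) (ν q) = 0 := by
    intro i
    rw [parFrame, inner_add_left, inner_smul_left, hXt, hνt]; simp
  have hν0 : ν q ≠ 0 := by intro h; simp [h] at hν1
  obtain ⟨D, hD, hD'⟩ := hasFDerivAt_volForm (hd hν) (v := parFrame X ν s) fun i => hd (hr i)
  -- The derivative of `ν` is tangential, as are all frame vectors, so the slot of `ν` contributes
  -- nothing.
  have e1 : dT (parJac X ν s) q =
      ∑ i, hyperVol (ν q) (Function.update (parFrame X ν s q) i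
        (dT (fun x => parFrame X ν s x i) q)) := by
    have hD2 : HasFDerivAt (parJac X ν s) D q := hD
    rw [HasFDerivAt.dT_eq hD2, hD']
    have z : hyperVol (fderiv ℝ ν q (0, 1)) (parFrame X ν s q) = 0 := by
      rw [hyperVol_apply]
      refine volForm_eq_zero_of_orthogonal hν0 fun j => ?_
      refine Fin.cases ?_ (fun j => ?_) j
      · simpa [← dT_eqOn hO hν hq] using! hνT
      · rw [Fin.cons_succ]; exact hrt j
    rw [z, zero_add]
    refine Finset.sum_congr rfl fun i _ => ?_
    rw [dT_eqOn hO (hr i) hq]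
  -- Mixed derivatives commute; the extra `X` in `parVel` contributes `∂ᵢX = parFrame - s ∂ᵢν`,
  -- which is where `- n D` and `s D'` come from.
  have e2 : ∀ i, dT (fun x => parFrame X ν s x i) q = dS (parVel X ν s) q (stdDir i) -
      parFrame X ν s q i + s • dS ν q (stdDir i) := by
    intro i
    have h1 : dT (fun x => parFrame X ν s x i) q =
        dT (fun x => dS X x (stdDir i)) q + s • dT (fun x => dS ν x (stdDir i)) q := by
      have a := hd (contDiffOn_dS hO hX (stdDir i))
      have b := hd (contDiffOn_dS hO hν (stdDir i))
      have c : HasFDerivAt (fun x => parFrame X ν s x i) _ q := a.add (b.const_smul s)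
      rw [HasFDerivAt.dT_eq a, HasFDerivAt.dT_eq b, HasFDerivAt.dT_eq c]
      simp
    have h2 : dS (parVel X ν s) q (stdDir i) = dS (dT X) q (stdDir i) + dS X q (stdDir i) +
        s • dS (dT ν) q (stdDir i) := by
      have a := hd (contDiffOn_dT hO hX)
      have b := hd (contDiffOn_dT hO hν)
      have c := hd hX
      have d : HasFDerivAt (parVel X ν s) _ q := (a.add c).add (b.const_smul s)
      rw [HasFDerivAt.dS_eq a, HasFDerivAt.dS_eq b, HasFDerivAt.dS_eq c, HasFDerivAt.dS_eq d]
      simp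
    rw [h1, h2, dS_dT_comm hO hX hq, dS_dT_comm hO hν hq, parFrame]
    abel
  -- The product rule for the divergence has three kinds of terms: the derivative of `ν`, that of
  -- the velocity in slot `i`, and that of the frame in the other slots.
  have e3 : ∀ i, dS (fun x => parFlux X ν s x i) q (stdDir i) =
      - (inner ℝ (parVel X ν s q) (ν q) *
        hyperVol (ν q) (Function.update (parFrame X ν s q) i (dS ν q (stdDir i)))) +
      (hyperVol (ν q) (Function.update (parFrame X ν s q) i
        (dS (parVel X ν s) q (stdDir i))) +
      ∑ j ∈ Finset.univ.erase i, hyperVol (ν q) (Function.update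
        (Function.update (parFrame X ν s q) i (parVel X ν s q)) j
          (dS (fun x => parFrame X ν s x j) q (stdDir i)))) := by
    intro i
    obtain ⟨D, hD, hD'⟩ := hasFDerivAt_volForm (hd hν)
      (v := fun x => Function.update (parFrame X ν s x) i (parVel X ν s x))
      (v' := fun j => if j = i then fderiv ℝ (parVel X ν s) q else
        fderiv ℝ (fun x => parFrame X ν s x j) q) (fun j => by
        rcases eq_or_ne j i with rfl | hj
        · simpa using hd hW
        · simpa [hj] using hd (hr j))
    have hfl : HasFDerivAt (fun x => parFlux X ν s x i) D q := hD
    rw [HasFDerivAt.dS_eq hfl, ContinuousLinearMap.comp_apply, hD',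
      ← Finset.add_sum_erase _ _ (Finset.mem_univ i)]
    congr 1
    · rw [← hyperVol_tangent hν1 (hνt _) hrt, dS_eqOn hO hν hq]; rfl
    · congr 1
      · rw [if_pos rfl, Function.update_idem, dS_eqOn hO hW hq]; rfl
      · refine Finset.sum_congr rfl fun j hj => ?_
        rw [if_neg (Finset.ne_of_mem_erase hj), dS_eqOn hO (hr j) hq]; rfl
  have e4 : ∑ i, ∑ j ∈ Finset.univ.erase i, hyperVol (ν q) (Function.update
        (Function.update (parFrame X ν s q) i (parVel X ν s q)) j
          (dS (fun x => parFrame X ν s x j) q (stdDir i))) = 0 := by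
    refine sum_hyperVol_antisymm _ _ _ (fun i j => dS (fun x => parFrame X ν s x j) q (stdDir i))
      fun i j => ?_
    have h1 : ∀ i j, dS (fun x => parFrame X ν s x j) q (stdDir i) =
        dS (fun x => dS X x (stdDir j)) q (stdDir i) +
          s • dS (fun x => dS ν x (stdDir j)) q (stdDir i) := by
      intro i j
      have a := hd (contDiffOn_dS hO hX (stdDir j))
      have b := hd (contDiffOn_dS hO hν (stdDir j))
      have c : HasFDerivAt (fun x => parFrame X ν s x j) _ q := a.add (b.const_smul s)
      rw [HasFDerivAt.dS_eq a, HasFDerivAt.dS_eq b, HasFDerivAt.dS_eq c]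
      simp
    rw [h1, h1, dS_dS_comm hO hX hq, dS_dS_comm hO hν hq]
  -- Since `∂ₜν` is tangential, all parallel hypersurfaces have the same normal speed.
  have e5 : inner ℝ (parVel X ν s q) (ν q) = inner ℝ (dT X q + X q) (ν q) := by
    rw [parVel, inner_add_left, inner_smul_left, hνT]; simp
  have e6 : ∀ i, hyperVol (ν q) (Function.update (parFrame X ν s q) i
      (dT (fun x => parFrame X ν s x i) q)) =
      hyperVol (ν q) (Function.update (parFrame X ν s q) i
        (dS (parVel X ν s) q (stdDir i))) - parJac X ν s q +
      s * hyperVol (ν q) (Function.update (parFrame X ν s q) i (dS ν q (stdDir i))) := by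
    intro i
    rw [e2, AlternatingMap.map_update_add, AlternatingMap.map_update_sub,
      AlternatingMap.map_update_smul, Function.update_eq_self, smul_eq_mul, parJac]
  rw [e1, Finset.sum_congr rfl fun i _ => e6 i, Finset.sum_congr rfl fun i _ => e3 i]
  simp only [Finset.sum_add_distrib, Finset.sum_sub_distrib, Finset.sum_neg_distrib,
    ← Finset.mul_sum, e4, e5, Finset.sum_const, Finset.card_univ, Fintype.card_fin, nsmul_eq_mul]
  ring

end LocalCalculus

/-! ### Evolution of `p_l^ι dμ` up to a divergence -/

section Transport

variable {n : ℕ} {O : Set (Par n × ℝ)}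

theorem succ_mul_esymm_succ {s : Multiset ℝ} (hs : Multiset.card s = n) {l : ℕ} (hl : l ≤ n) :
    ((l : ℝ) + 1) * s.esymm (l + 1) = ((n : ℝ) - l) * (n.choose l * normEsymm s (l + 1)) := by
  rw [esymm_eq_choose_mul_normEsymm, hs]
  have h := Nat.choose_succ_right_eq n l
  have h' : (n.choose (l + 1) : ℝ) * (l + 1) = n.choose l * (n - l) := by
    rw [← Nat.cast_sub hl]; exact_mod_cast h
  linear_combination normEsymm s (l + 1) * h'

/-- The principal curvatures computed from the differentials of the immersion and its normal. -/
def curvatureRoots (A B : Par n →L[ℝ] Amb n) : Multiset ℝ :=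
  ((gramMat A A)⁻¹ * gramMat B A).charpoly.roots

theorem IsHypersurfacePoint.card_curvatureRoots {A B : Par n →L[ℝ] Amb n} {ν : Amb n}
    (h : IsHypersurfacePoint A B ν) : Multiset.card (curvatureRoots A B) = n := by
  obtain ⟨L, κ, hF⟩ := h.exists_frame
  rw [curvatureRoots, hF.roots_charpoly]; simp

theorem IsHypersurfacePoint.coefAt_jac {A B : Par n →L[ℝ] Amb n} {ν : Amb n}
    (h : IsHypersurfacePoint A B ν) {l : ℕ} (hl : l ≤ n) :
    coefAt n l (fun s => jac (A + s • B) ν) = jac A ν * (curvatureRoots A B).esymm l := by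
  obtain ⟨L, κ, hF⟩ := h.exists_frame
  rw [curvatureRoots, hF.roots_charpoly, hF.coefAt_jac hl]

/-- The individual roots need not be smooth, but this formula involves only determinants of first
derivatives; smoothness and continuity of `p_l` are read off from it. -/
theorem IsHypersurfacePoint.normEsymm_eq {A B : Par n →L[ℝ] Amb n} {ν : Amb n}
    (h : IsHypersurfacePoint A B ν) {l : ℕ} (hl : l ≤ n) :
    normEsymm (curvatureRoots A B) l =
      coefAt n l (fun s => jac (A + s • B) ν) / jac A ν / n.choose l := by
  rw [h.coefAt_jac hl, normEsymm, h.card_curvatureRoots, mul_div_cancel_left₀ _ h.jac_ne_zero]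

/-- The normalized coefficients of the flux. -/
def fluxCoef (A B : Par n →L[ℝ] Amb n) (ν w₀ w₁ : Amb n) (η : Par n →L[ℝ] ℝ) (l : ℕ) : ℝ :=
  coefAt n l (fun s => fluxForm (A + s • B) ν (w₀ + s • w₁) η) / jac A ν

/-- Flux and area element acquire the same determinant under a change of coordinates, so the
quotient is a function on the manifold. -/
theorem fluxCoef_comp (A B : Par n →L[ℝ] Amb n) (ν w₀ w₁ : Amb n) (η : Par n →L[ℝ] ℝ) (l : ℕ)
    (L : Par n →L[ℝ] Par n) (hL : LinearMap.det (L : Par n →ₗ[ℝ] Par n) ≠ 0) :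
    fluxCoef (A ∘L L) (B ∘L L) ν w₀ w₁ (η ∘L L) l = fluxCoef A B ν w₀ w₁ η l := by
  have e : ∀ s : ℝ, A ∘L L + s • B ∘L L = (A + s • B) ∘L L := fun s => by
    ext v; simp
  simp only [fluxCoef, e, fluxForm_comp, jac_comp, coefAt_const_mul]
  rw [mul_div_mul_left _ _ hL]

theorem fluxCoef_sum {ι : Type*} (t : Finset ι) (A B : Par n →L[ℝ] Amb n) (ν w₀ w₁ : Amb n)
    (η : ι → Par n →L[ℝ] ℝ) (l : ℕ) :
    fluxCoef A B ν w₀ w₁ (∑ i ∈ t, η i) l = ∑ i ∈ t, fluxCoef A B ν w₀ w₁ (η i) l := by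
  simp only [fluxCoef, ← Finset.sum_div, ← coefAt_sum]
  congr 2
  ext s
  simp only [fluxForm]
  rw [Finset.sum_comm]
  refine Finset.sum_congr rfl fun j _ => ?_
  rw [sum_apply, Finset.sum_mul]

theorem contDiffOn_coefAt {V : Type*} [NormedAddCommGroup V] [NormedSpace ℝ V] {s : Set V}
    (n l : ℕ) {f : ℝ → V → ℝ} (hf : ∀ a, ContDiffOn ℝ ∞ (f a) s) :
    ContDiffOn ℝ ∞ (fun x => coefAt n l fun a => f a x) s :=
  ContDiffOn.sum fun _ _ => contDiffOn_const.mul (hf _)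

theorem hasFDerivAt_coefAt {V : Type*} [NormedAddCommGroup V] [NormedSpace ℝ V] {q : V}
    (n l : ℕ) {f : ℝ → V → ℝ} (hf : ∀ a, DifferentiableAt ℝ (f a) q) :
    ∃ D : V →L[ℝ] ℝ, HasFDerivAt (fun x => coefAt n l fun a => f a x) D q ∧
      ∀ v, D v = coefAt n l fun a => fderiv ℝ (f a) q v := by
  refine ⟨_, HasFDerivAt.fun_sum fun m _ => ((hf m).hasFDerivAt.const_mul _), fun v => ?_⟩
  rw [sum_apply]
  rfl

variable {X ν : Par n × ℝ → Amb n}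

/-- A smooth family of immersed hypersurfaces with unit normals over an open set of space-time. -/
structure IsLocalFamily (O : Set (Par n × ℝ)) (X ν : Par n × ℝ → Amb n) : Prop where
  isOpen : IsOpen O
  smooth_X : ContDiffOn ℝ ∞ X O
  smooth_ν : ContDiffOn ℝ ∞ ν O
  norm_eq_one : ∀ q ∈ O, ‖ν q‖ = 1
  injective : ∀ q ∈ O, Function.Injective (dS X q)
  orthogonal : ∀ q ∈ O, ∀ v, inner ℝ (dS X q v) (ν q) = 0

namespace IsLocalFamily

theorem differentiableAt {H : Type*} [NormedAddCommGroup H] [NormedSpace ℝ H]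
    (h : IsLocalFamily O X ν) {f : Par n × ℝ → H}
    (hf : ContDiffOn ℝ ∞ f O) {q : Par n × ℝ} (hq : q ∈ O) : DifferentiableAt ℝ f q :=
  (hf.contDiffAt (h.isOpen.mem_nhds hq)).differentiableAt (by simp)

theorem inner_fderiv_normal (h : IsLocalFamily O X ν) {q : Par n × ℝ} (hq : q ∈ O)
    (v : Par n × ℝ) : inner ℝ (fderiv ℝ ν q v) (ν q) = 0 := by
  have hd := (h.differentiableAt h.smooth_ν hq).hasFDerivAt
  have h1 := hd.inner ℝ hd
  have h2 : (fun x => inner ℝ (ν x) (ν x)) =ᶠ[nhds q] fun _ => (1 : ℝ) :=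
    Filter.eventuallyEq_of_mem (h.isOpen.mem_nhds hq) fun x hx => by
      simp [h.norm_eq_one x hx]
  have h3 := (h1.unique ((hasFDerivAt_const (1 : ℝ) q).congr_of_eventuallyEq h2))
  have h4 := congrArg (fun D => D v) h3
  simp [fderivInnerCLM_apply] at h4
  rw [real_inner_comm] at h4
  linarith [real_inner_comm (ν q) (fderiv ℝ ν q v)]

theorem inner_dS_normal (h : IsLocalFamily O X ν) {q : Par n × ℝ} (hq : q ∈ O) (v : Par n) :
    inner ℝ (dS ν q v) (ν q) = 0 := by
  rw [dS_eqOn h.isOpen h.smooth_ν hq]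
  exact h.inner_fderiv_normal hq _

theorem inner_dT_normal (h : IsLocalFamily O X ν) {q : Par n × ℝ} (hq : q ∈ O) :
    inner ℝ (dT ν q) (ν q) = 0 := by
  rw [dT_eqOn h.isOpen h.smooth_ν hq]
  exact h.inner_fderiv_normal hq _

/-- Differentiating `⟨∂ᵥX, ν⟩ = 0` in space gives the symmetry of the second fundamental form; in
time it gives the evolution of the normal. -/
theorem inner_fderiv_add (h : IsLocalFamily O X ν) {q : Par n × ℝ} (hq : q ∈ O) (v : Par n)
    (w : Par n × ℝ) : inner ℝ (dS X q v) (fderiv ℝ ν q w) +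
      inner ℝ (fderiv ℝ (fun x => dS X x v) q w) (ν q) = 0 := by
  have hd := (h.differentiableAt h.smooth_ν hq).hasFDerivAt
  have hd' := (h.differentiableAt (contDiffOn_dS h.isOpen h.smooth_X v) hq).hasFDerivAt
  have h1 := hd'.inner ℝ hd
  have h2 : (fun x => inner ℝ (dS X x v) (ν x)) =ᶠ[nhds q] fun _ => (0 : ℝ) :=
    Filter.eventuallyEq_of_mem (h.isOpen.mem_nhds hq) fun x hx => h.orthogonal x hx v
  have h3 := (h1.unique ((hasFDerivAt_const (0 : ℝ) q).congr_of_eventuallyEq h2))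
  have h4 := congrArg (fun D => D w) h3
  simpa [fderivInnerCLM_apply] using h4

theorem isHypersurfacePoint (h : IsLocalFamily O X ν) {q : Par n × ℝ} (hq : q ∈ O) :
    IsHypersurfacePoint (dS X q) (dS ν q) (ν q) where
  norm_eq_one := h.norm_eq_one q hq
  injective := h.injective q hq
  inner_left := h.orthogonal q hq
  inner_right := h.inner_dS_normal hq
  symm v w := by
    have h1 := h.inner_fderiv_add hq w (v, 0)
    have h2 := h.inner_fderiv_add hq v (w, 0)
    have e1 : fderiv ℝ ν q (v, 0) = dS ν q v := by
      rw [dS_eqOn h.isOpen h.smooth_ν hq]; rfl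
    have e2 : fderiv ℝ ν q (w, 0) = dS ν q w := by
      rw [dS_eqOn h.isOpen h.smooth_ν hq]; rfl
    have e3 := dS_dS_comm h.isOpen h.smooth_X hq v w
    rw [dS_eqOn h.isOpen (contDiffOn_dS h.isOpen h.smooth_X v) hq,
      dS_eqOn h.isOpen (contDiffOn_dS h.isOpen h.smooth_X w) hq] at e3
    simp only [ContinuousLinearMap.comp_apply, ContinuousLinearMap.inl_apply] at e3
    rw [e1] at h1
    rw [e2, e3] at h2
    rw [real_inner_comm]
    linarith

/-- The normal speed `⟨∂ₜX + X, ν⟩`. -/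
theorem inner_dT_normal_dS (h : IsLocalFamily O X ν) {q : Par n × ℝ} (hq : q ∈ O) (v : Par n) :
    inner ℝ (dT ν q) (dS X q v) = - dS (fun x => inner ℝ (dT X x + X x) (ν x)) q v +
      inner ℝ (dS ν q v) (dT X q + X q) := by
  have hXd := contDiffOn_dT h.isOpen h.smooth_X
  have d1 := (h.differentiableAt hXd hq).hasFDerivAt
  have d2 := (h.differentiableAt h.smooth_X hq).hasFDerivAt
  have d3 := (h.differentiableAt h.smooth_ν hq).hasFDerivAt
  have d4 : HasFDerivAt (fun x => inner ℝ (dT X x + X x) (ν x)) _ q := (d1.add d2).inner ℝ d3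
  have e0 := h.inner_fderiv_add hq v (0, 1)
  have e1 : dS (fun x => inner ℝ (dT X x + X x) (ν x)) q v =
      inner ℝ (dT X q + X q) (dS ν q v) + inner ℝ (dS (dT X) q v + dS X q v) (ν q) := by
    rw [HasFDerivAt.dS_eq d4, dS_eqOn h.isOpen h.smooth_ν hq, dS_eqOn h.isOpen h.smooth_X hq,
      dS_eqOn h.isOpen hXd hq]
    simp [fderivInnerCLM_apply]
  rw [e1, inner_add_left (dS (dT X) q v), h.orthogonal q hq,
    dS_dT_comm h.isOpen h.smooth_X hq,
    dT_eqOn h.isOpen (contDiffOn_dS h.isOpen h.smooth_X v) hq, dT_eqOn h.isOpen h.smooth_ν hq,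
    real_inner_comm (dS X q v), real_inner_comm (dS ν q v)]
  linarith

/-- The normalized elementary symmetric function of the principal curvatures. -/
def normCurv (X ν : Par n × ℝ → Amb n) (l : ℕ) (q : Par n × ℝ) : ℝ :=
  normEsymm (curvatureRoots (dS X q) (dS ν q)) l

theorem normCurv_eq (h : IsLocalFamily O X ν) {q : Par n × ℝ} (hq : q ∈ O) {l : ℕ} (hl : l ≤ n) :
    normCurv X ν l q = coefAt n l (fun s => parJac X ν s q) / parJac X ν 0 q / n.choose l := by
  have := (h.isHypersurfacePoint hq).normEsymm_eq hl
  rw [normCurv, this, parJac_eq_jac X ν 0]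
  simp only [zero_smul, add_zero]
  rfl

theorem parJac_zero_eq (X ν : Par n × ℝ → Amb n) (q : Par n × ℝ) :
    parJac X ν 0 q = jac (dS X q) (ν q) := by
  rw [parJac_eq_jac]; simp

theorem parJac_zero_ne_zero (h : IsLocalFamily O X ν) {q : Par n × ℝ} (hq : q ∈ O) :
    parJac X ν 0 q ≠ 0 := by
  rw [parJac_zero_eq]
  exact (h.isHypersurfacePoint hq).jac_ne_zero

theorem contDiffOn_normCurv (h : IsLocalFamily O X ν) {l : ℕ} (hl : l ≤ n) :
    ContDiffOn ℝ ∞ (normCurv X ν l) O := by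
  have hJ := contDiffOn_parJac h.isOpen h.smooth_X h.smooth_ν
  refine (((contDiffOn_coefAt n l hJ).div (hJ 0) fun q hq => h.parJac_zero_ne_zero hq).div_const
    (n.choose l : ℝ)).congr fun q hq => h.normCurv_eq hq hl

/-- The vector field whose divergence occurs in the evolution of `p_l^ι dμ`. -/
def transportField (X ν : Par n × ℝ → Amb n) (ι : ℝ) (l : ℕ) (q : Par n × ℝ) (i : Fin n) : ℝ :=
  |parJac X ν 0 q| / parJac X ν 0 q *
    (ι * normCurv X ν l q ^ (ι - 1) *
        (coefAt n l (fun s => parFlux X ν s q i) / n.choose l) +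
      (1 - ι) * normCurv X ν l q ^ ι * coefAt n 0 (fun s => parFlux X ν s q i))

/-- The pairing of the transport field with a covector, divided by the area density. -/
def transportPairing (A B : Par n →L[ℝ] Amb n) (ν w₀ w₁ : Amb n) (u ι : ℝ) (l : ℕ)
    (η : Par n →L[ℝ] ℝ) : ℝ :=
  ι * u ^ (ι - 1) * (fluxCoef A B ν w₀ w₁ η l / n.choose l) +
      (1 - ι) * u ^ ι * fluxCoef A B ν w₀ w₁ η 0

theorem coefAt_fluxForm (X ν : Par n × ℝ → Amb n) (q : Par n × ℝ) (η : Par n →L[ℝ] ℝ) (l : ℕ) :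
    coefAt n l (fun s => fluxForm (dS X q + s • dS ν q) (ν q)
      (dT X q + X q + s • dT ν q) η) =
      ∑ i, η (stdDir i) * coefAt n l (fun s => parFlux X ν s q i) := by
  simp only [fluxForm_eq_sum_parFlux, coefAt_sum, coefAt_const_mul]

/-- The right side is a density times a chart-independent quantity. After integration by parts
against a cut-off `ρ`, with `η = dρ`, the boundary-type terms of different charts can therefore be
compared. -/
theorem sum_transportField (h : IsLocalFamily O X ν) {q : Par n × ℝ} (hq : q ∈ O) (ι : ℝ) (l : ℕ)
    (η : Par n →L[ℝ] ℝ) :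
    ∑ i, η (stdDir i) * transportField X ν ι l q i = |parJac X ν 0 q| *
      transportPairing (dS X q) (dS ν q) (ν q) (dT X q + X q) (dT ν q) (normCurv X ν l q) ι l η := by
  have hJ := h.parJac_zero_ne_zero hq
  simp only [transportPairing, fluxCoef, coefAt_fluxForm, ← parJac_zero_eq, transportField]
  simp only [Finset.sum_div, mul_add, Finset.mul_sum, ← Finset.sum_add_distrib]
  refine Finset.sum_congr rfl fun i _ => ?_
  ring

theorem contDiffOn_transportField (h : IsLocalFamily O X ν) (ι : ℝ) {l : ℕ} (hl : l ≤ n)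
    (hu : ∀ q ∈ O, 0 < normCurv X ν l q) (i : Fin n) :
    ContDiffOn ℝ ∞ (fun q => transportField X ν ι l q i) O := by
  have hJ := contDiffOn_parJac h.isOpen h.smooth_X h.smooth_ν
  have hZ := fun s => contDiffOn_parFlux h.isOpen h.smooth_X h.smooth_ν s i
  have hc := h.contDiffOn_normCurv hl
  have hr : ∀ a : ℝ, ContDiffOn ℝ ∞ (fun q => normCurv X ν l q ^ a) O := fun a =>
    hc.rpow_const_of_ne fun q hq => (hu q hq).ne'
  have habs : ContDiffOn ℝ ∞ (fun q => |parJac X ν 0 q| / parJac X ν 0 q) O :=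
    ((hJ 0).abs fun q hq => h.parJac_zero_ne_zero hq).div (hJ 0)
      fun q hq => h.parJac_zero_ne_zero hq
  exact habs.mul (((contDiffOn_const.mul (hr _)).mul ((contDiffOn_coefAt n l hZ).div_const _)).add
    ((contDiffOn_const.mul (hr _)).mul (contDiffOn_coefAt n 0 hZ)))

/-- The zeroth order terms in the evolution of `p_l^ι dμ`. -/
def transportSource (A B : Par n →L[ℝ] Amb n) (ν w₀ w₁ : Amb n) (u ι F : ℝ) (l : ℕ)
    (η : Par n →L[ℝ] ℝ) : ℝ :=
  ι * u ^ (ι - 1) * ((n - l) * (F * normEsymm (curvatureRoots A B) (l + 1) - u)) +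
    (1 - ι) * u ^ ι * (n * (F * normEsymm (curvatureRoots A B) 1 - 1)) -
    ι * (ι - 1) * u ^ (ι - 2) *
      (fluxCoef A B ν w₀ w₁ η l / n.choose l - u * fluxCoef A B ν w₀ w₁ η 0)

/-- This is the `s^l` coefficient of `dT_parJac`, with `(l + 1) C(n, l + 1) = (n - l) C(n, l)`
absorbing the normalizations. -/
theorem dT_coefAt_parJac (h : IsLocalFamily O X ν) {q : Par n × ℝ} (hq : q ∈ O) {l : ℕ}
    (hl : l ≤ n) :
    dT (fun x => coefAt n l (fun s => parJac X ν s x)) q =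
      ∑ i, dS (fun x => coefAt n l (fun s => parFlux X ν s x i)) q (stdDir i) +
      parJac X ν 0 q * ((n - l) * (n.choose l * (inner ℝ (dT X q + X q) (ν q) *
        normEsymm (curvatureRoots (dS X q) (dS ν q)) (l + 1) - normCurv X ν l q))) := by
  have hP := h.isHypersurfacePoint hq
  obtain ⟨L, κ, hF⟩ := hP.exists_frame
  have hroots : curvatureRoots (dS X q) (dS ν q) = Finset.univ.val.map κ := hF.roots_charpoly
  have hJ := contDiffOn_parJac h.isOpen h.smooth_X h.smooth_ν
  have hZ := contDiffOn_parFlux h.isOpen h.smooth_X h.smooth_ν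
  obtain ⟨D, hD, hD'⟩ := hasFDerivAt_coefAt n l fun s => h.differentiableAt (hJ s) hq
  have e1 : dT (fun x => coefAt n l (fun s => parJac X ν s x)) q =
      coefAt n l fun s => dT (parJac X ν s) q := by
    rw [HasFDerivAt.dT_eq hD, hD']
    congr 1; ext s
    rw [dT_eqOn h.isOpen (hJ s) hq]
  have e2 : ∀ i, dS (fun x => coefAt n l (fun s => parFlux X ν s x i)) q (stdDir i) =
      coefAt n l fun s => dS (fun x => parFlux X ν s x i) q (stdDir i) := by
    intro i
    obtain ⟨D, hD, hD'⟩ := hasFDerivAt_coefAt n l fun s => h.differentiableAt (hZ s i) hq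
    rw [HasFDerivAt.dS_eq hD, ContinuousLinearMap.comp_apply, hD']
    congr 1; ext s
    rw [dS_eqOn h.isOpen (hZ s i) hq]; rfl
  have e3 : ∀ s, HasDerivAt (fun s => jac (dS X q + s • dS ν q) (ν q))
      (∑ i, hyperVol (ν q) (Function.update (parFrame X ν s q) i (dS ν q (stdDir i)))) s := by
    intro s
    refine hasDerivAt_hyperVol (ν q) (v := fun s i => (dS X q + s • dS ν q) (stdDir i)) fun i => ?_
    have := ((hasDerivAt_id s).smul_const (dS ν q (stdDir i))).const_add (dS X q (stdDir i))
    simpa using! this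
  have e4 := hF.coefAt_deriv hl (inner ℝ (dT X q + X q) (ν q)) e3
  rw [e1]
  simp only [e2]
  rw [← coefAt_sum]
  have e5 : (fun s => dT (parJac X ν s) q) = fun s =>
      (∑ i, dS (fun x => parFlux X ν s x i) q (stdDir i)) +
      ((inner ℝ (dT X q + X q) (ν q) + s) *
        (∑ i, hyperVol (ν q) (Function.update (parFrame X ν s q) i (dS ν q (stdDir i)))) -
        n * jac (dS X q + s • dS ν q) (ν q)) := by
    ext s
    exact dT_parJac h.isOpen h.smooth_X h.smooth_ν hq (h.norm_eq_one q hq) (h.orthogonal q hq)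
      (h.inner_dS_normal hq) (h.inner_dT_normal hq) s
  rw [e5, coefAt_add, e4, ← hroots, succ_mul_esymm_succ hP.card_curvatureRoots hl,
    esymm_eq_choose_mul_normEsymm _ l, hP.card_curvatureRoots, ← parJac_zero_eq, normCurv]
  ring

/-- Evolution of `p_l^ι dμ`, up to a divergence. -/
theorem dT_density (h : IsLocalFamily O X ν) (ι : ℝ) {l : ℕ} (hl : l ≤ n)
    (hu : ∀ q ∈ O, 0 < normCurv X ν l q) {q : Par n × ℝ} (hq : q ∈ O) :
    dT (fun x => |parJac X ν 0 x| * normCurv X ν l x ^ ι) q =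
      ∑ i, dS (fun x => transportField X ν ι l x i) q (stdDir i) +
      |parJac X ν 0 q| * transportSource (dS X q) (dS ν q) (ν q) (dT X q + X q) (dT ν q)
        (normCurv X ν l q) ι (inner ℝ (dT X q + X q) (ν q)) l (dS (normCurv X ν l) q) := by
  have hJ := contDiffOn_parJac h.isOpen h.smooth_X h.smooth_ν
  have hZ := contDiffOn_parFlux h.isOpen h.smooth_X h.smooth_ν
  have hJ0 := h.parJac_zero_ne_zero hq
  have huq := hu q hq
  have hc : (n.choose l : ℝ) ≠ 0 := by exact_mod_cast (Nat.choose_pos hl).ne'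
  -- The nonvanishing Jacobian has locally constant sign `ε`, so the absolute value can be
  -- differentiated.
  obtain ⟨ε, hε, hεev⟩ : ∃ ε : ℝ, |parJac X ν 0 q| = ε * parJac X ν 0 q ∧
      ∀ᶠ x in nhds q, |parJac X ν 0 x| = ε * parJac X ν 0 x := by
    have hcont := (h.differentiableAt (hJ 0) hq).continuousAt
    rcases lt_or_gt_of_ne hJ0 with hlt | hgt
    · refine ⟨-1, by rw [abs_of_neg hlt]; ring, ?_⟩
      filter_upwards [hcont.eventually_lt continuousAt_const hlt] with x hx
      rw [abs_of_neg hx]; ring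
    · refine ⟨1, by rw [abs_of_pos hgt]; ring, ?_⟩
      filter_upwards [continuousAt_const.eventually_lt hcont hgt] with x hx
      rw [abs_of_pos hx]; ring
  have hO := h.isOpen.mem_nhds hq
  set N : Par n × ℝ → ℝ := fun x => coefAt n l fun s => parJac X ν s x with hN
  set D₀ : Par n × ℝ → ℝ := parJac X ν 0 with hD₀
  set u := normCurv X ν l with hudef
  have hue : ∀ x ∈ O, u x = N x / D₀ x / n.choose l := fun x hx => h.normCurv_eq hx hl
  have dN := (h.differentiableAt (contDiffOn_coefAt n l hJ) hq).hasFDerivAt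
  have dD := (h.differentiableAt (hJ 0) hq).hasFDerivAt
  have du := (h.differentiableAt (h.contDiffOn_normCurv hl) hq).hasFDerivAt
  have dpow : ∀ a : ℝ, HasFDerivAt (fun x => u x ^ a) ((a * u q ^ (a - 1)) • fderiv ℝ u q) q :=
    fun a => du.rpow_const (Or.inl huq.ne')
  -- the product rule for `N = C(n,l) u D₀`
  have eN : N =ᶠ[nhds q] fun x => n.choose l * (u x * D₀ x) :=
    Filter.eventuallyEq_of_mem hO fun x hx => by
      have : D₀ x ≠ 0 := h.parJac_zero_ne_zero hx
      rw [hue x hx]; field_simp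
  have dN' := (dN.unique (((du.mul dD).const_mul (n.choose l : ℝ)).congr_of_eventuallyEq eN))
  have tN : fderiv ℝ N q (0, 1) =
      n.choose l * (u q * fderiv ℝ D₀ q (0, 1) + D₀ q * fderiv ℝ u q (0, 1)) := by
    rw [dN']; simp [hudef, hD₀]; ring
  have lN := h.dT_coefAt_parJac hq hl
  have lD := h.dT_coefAt_parJac hq (Nat.zero_le n)
  have c0 : ∀ x ∈ O, coefAt n 0 (fun s => parJac X ν s x) = D₀ x := by
    intro x hx
    have := (h.isHypersurfacePoint hx).coefAt_jac (Nat.zero_le n)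
    rw [esymm_zero', mul_one, ← parJac_zero_eq] at this
    exact this
  have eD : (fun x => coefAt n 0 fun s => parJac X ν s x) =ᶠ[nhds q] D₀ :=
    Filter.eventuallyEq_of_mem hO c0
  rw [HasFDerivAt.dT_eq dN, tN] at lN
  rw [HasFDerivAt.dT_eq (dD.congr_of_eventuallyEq eD)] at lD
  have n0 : normCurv X ν 0 q = 1 := normEsymm_zero _
  rw [n0] at lD
  simp only [Nat.choose_zero_right, Nat.cast_one, Nat.cast_zero, sub_zero, one_mul, zero_add] at lD
  -- the left hand side
  have eL : (fun x => |D₀ x| * u x ^ ι) =ᶠ[nhds q] fun x => ε * (D₀ x * u x ^ ι) := by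
    filter_upwards [hεev] with x hx
    rw [hx]; ring
  have dL := ((dD.mul (dpow ι)).const_mul ε).congr_of_eventuallyEq eL
  have tL : dT (fun x => |D₀ x| * u x ^ ι) q = ε * (D₀ q * (ι * u q ^ (ι - 1) *
      fderiv ℝ u q (0, 1)) + u q ^ ι * fderiv ℝ D₀ q (0, 1)) := by
    rw [HasFDerivAt.dT_eq dL]; simp [hudef, hD₀]; ring
  -- the divergence
  have hZc : ∀ (j : ℕ) (i : Fin n), HasFDerivAt (fun x => coefAt n j fun s => parFlux X ν s x i)
      (fderiv ℝ (fun x => coefAt n j fun s => parFlux X ν s x i) q) q := fun j i =>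
    (h.differentiableAt (contDiffOn_coefAt n j fun s => hZ s i) hq).hasFDerivAt
  -- Besides the weighted divergences there remain derivatives of the weights. As `d(ι u^{ι-1}) =
  -- ι(ι-1) u^{ι-2} du` and `d((1-ι) u^ι) = -ι(ι-1) u^{ι-1} du`, they combine into one term paired
  -- with `du`.
  have tF : ∀ i, dS (fun x => transportField X ν ι l x i) q (stdDir i) =
      ε * (ι * u q ^ (ι - 1) *
        (dS (fun x => coefAt n l fun s => parFlux X ν s x i) q (stdDir i) / n.choose l) +
        (1 - ι) * u q ^ ι * dS (fun x => coefAt n 0 fun s => parFlux X ν s x i) q (stdDir i) +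
        ι * (ι - 1) * u q ^ (ι - 2) * (dS u q (stdDir i) *
          (coefAt n l (fun s => parFlux X ν s q i) / n.choose l -
            u q * coefAt n 0 (fun s => parFlux X ν s q i)))) := by
    intro i
    have eF : (fun x => transportField X ν ι l x i) =ᶠ[nhds q] fun x => ε *
        (ι * u x ^ (ι - 1) * ((n.choose l : ℝ)⁻¹ * coefAt n l (fun s => parFlux X ν s x i)) +
          (1 - ι) * u x ^ ι * coefAt n 0 (fun s => parFlux X ν s x i)) := by
      filter_upwards [hεev, hO] with x hx hxO
      have hx0 := h.parJac_zero_ne_zero hxO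
      rw [transportField, hx, mul_div_assoc, div_self hx0]
      ring
    have dF := (((((dpow (ι - 1)).const_mul ι).mul ((hZc l i).const_mul (n.choose l : ℝ)⁻¹)).add
      (((dpow ι).const_mul (1 - ι)).mul (hZc 0 i))).const_mul ε).congr_of_eventuallyEq eF
    rw [HasFDerivAt.dS_eq dF, HasFDerivAt.dS_eq (hZc l i), HasFDerivAt.dS_eq (hZc 0 i),
      HasFDerivAt.dS_eq du]
    have r1 : u q ^ (ι - 1) = u q ^ (ι - 2) * u q := by
      rw [show ι - 1 = (ι - 2) + 1 by ring, Real.rpow_add_one huq.ne']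
    simp only [ContinuousLinearMap.comp_apply, ContinuousLinearMap.inl_apply, smul_apply,
      add_apply, smul_eq_mul]
    rw [show ι - 1 - 1 = ι - 2 by ring, r1]
    ring
  rw [tL, Finset.sum_congr rfl fun i _ => tF i, ← Finset.mul_sum]
  simp only [Finset.sum_add_distrib, ← Finset.mul_sum, ← Finset.sum_div]
  have sF : ∑ i, dS u q (stdDir i) * (coefAt n l (fun s => parFlux X ν s q i) / n.choose l -
            u q * coefAt n 0 (fun s => parFlux X ν s q i)) =
      D₀ q * (fluxCoef (dS X q) (dS ν q) (ν q) (dT X q + X q) (dT ν q) (dS u q) l / n.choose l -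
        u q * fluxCoef (dS X q) (dS ν q) (ν q) (dT X q + X q) (dT ν q) (dS u q) 0) := by
    simp only [fluxCoef, coefAt_fluxForm, ← parJac_zero_eq, Finset.sum_div, Finset.mul_sum,
      ← Finset.sum_sub_distrib, mul_sub]
    refine Finset.sum_congr rfl fun i _ => ?_
    have : parJac X ν 0 q ≠ 0 := hJ0
    rw [← hD₀]
    field_simp
  rw [sF, hε, transportSource]
  set S₁ := ∑ i, dS (fun x => coefAt n l fun s => parFlux X ν s x i) q (stdDir i)
  set S₀ := ∑ i, dS (fun x => coefAt n 0 fun s => parFlux X ν s x i) q (stdDir i)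
  set F := inner ℝ (dT X q + X q) (ν q)
  set p₁ := normEsymm (curvatureRoots (dS X q) (dS ν q)) 1
  set pl := normEsymm (curvatureRoots (dS X q) (dS ν q)) (l + 1)
  have r2 : u q ^ ι = u q ^ (ι - 1) * u q := by
    rw [← Real.rpow_add_one huq.ne']; ring_nf
  -- The evolution of `u` is obtained from those of `N = C(n,l) u D₀` and `D₀`; multiplied by `ι
  -- u^{ι-1}` it gives the claim.
  have lN' : D₀ q * fderiv ℝ u q (0, 1) = S₁ / n.choose l +
      D₀ q * ((n - l) * (F * pl - u q)) - u q * fderiv ℝ D₀ q (0, 1) := by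
    field_simp
    linear_combination lN
  rw [lD] at lN' ⊢
  rw [r2]
  linear_combination (ε * ι * u q ^ (ι - 1)) * lN'

end IsLocalFamily

end Transport

/-! ### Topology of the time interval -/

section TimeInterval

variable {Tmax : EReal}

/-- The interior of the time interval. -/
def openTime (Tmax : EReal) : Set ℝ := {t | 0 < t ∧ (t : EReal) < Tmax}

theorem isOpen_openTime (Tmax : EReal) : IsOpen (openTime Tmax) :=
  (isOpen_lt continuous_const continuous_id).inter
    (isOpen_lt continuous_coe_real_ereal continuous_const)

theorem openTime_subset : openTime Tmax ⊆ timeInterval Tmax := fun _ h => ⟨h.1.le, h.2⟩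

theorem ordConnected_timeInterval (Tmax : EReal) : (timeInterval Tmax).OrdConnected := by
  refine ⟨fun x hx y hy z hz => ⟨hx.1.trans hz.1, lt_of_le_of_lt ?_ hy.2⟩⟩
  exact_mod_cast hz.2

theorem convex_timeInterval (Tmax : EReal) : Convex ℝ (timeInterval Tmax) :=
  (ordConnected_timeInterval Tmax).convex

theorem zero_mem_timeInterval (hT : 0 < Tmax) : (0 : ℝ) ∈ timeInterval Tmax :=
  ⟨le_rfl, by exact_mod_cast hT⟩

theorem interior_timeInterval (Tmax : EReal) : interior (timeInterval Tmax) = openTime Tmax := by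
  refine Subset.antisymm (fun t ht => ⟨?_, (interior_subset ht).2⟩)
    (interior_maximal openTime_subset (isOpen_openTime _))
  have h : timeInterval Tmax ⊆ Ici 0 := fun _ h => h.1
  have := interior_mono h ht
  rwa [interior_Ici] at this

theorem exists_openTime (hT : 0 < Tmax) : ∃ t, t ∈ openTime Tmax := by
  obtain ⟨r, hr0, hr1⟩ := EReal.lt_iff_exists_real_btwn.1 hT
  exact ⟨r, by exact_mod_cast hr0, hr1⟩

theorem uniqueDiffOn_timeInterval (hT : 0 < Tmax) : UniqueDiffOn ℝ (timeInterval Tmax) :=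
  uniqueDiffOn_convex (convex_timeInterval _) (by
    rw [interior_timeInterval]; exact exists_openTime hT)

theorem timeInterval_subset_closure (hT : 0 < Tmax) :
    timeInterval Tmax ⊆ closure (openTime Tmax) := by
  have h := (convex_timeInterval Tmax).closure_interior_eq_closure_of_nonempty_interior
    (by rw [interior_timeInterval]; exact exists_openTime hT)
  rw [interior_timeInterval] at h
  rw [h]
  exact subset_closure

theorem mem_nhds_of_openTime {t : ℝ} (ht : t ∈ openTime Tmax) : timeInterval Tmax ∈ nhds t :=
  Filter.mem_of_superset ((isOpen_openTime _).mem_nhds ht) openTime_subset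

end TimeInterval

/-! ### Change of charts -/

section Charts

variable {n : ℕ} {M : Type*} [TopologicalSpace M] [ChartedSpace (EuclideanSpace ℝ (Fin n)) M]
  {G : Type*} [NormedAddCommGroup G] [NormedSpace ℝ G]

/-- A time-dependent function on `M` in the chart around `c`. -/
def loc (c : M) (Y : ℝ → M → G) (q : Par n × ℝ) : G := Y q.2 ((chartAt (Par n) c).symm q.1)

/-- The transition map from the chart around `c` to the chart around `d`. -/
def chartTrans (n : ℕ) {M : Type*} [TopologicalSpace M]
    [ChartedSpace (EuclideanSpace ℝ (Fin n)) M] (c d : M) (y : Par n) : Par n :=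
  chartAt (Par n) d ((chartAt (Par n) c).symm y)

/-- The domain of the transition map. -/
def transDom (n : ℕ) {M : Type*} [TopologicalSpace M]
    [ChartedSpace (EuclideanSpace ℝ (Fin n)) M] (c d : M) : Set (Par n) :=
  (chartAt (Par n) c).target ∩ (chartAt (Par n) c).symm ⁻¹' (chartAt (Par n) d).source

theorem isOpen_transDom (c d : M) : IsOpen (transDom n c d) :=
  (chartAt (Par n) c).isOpen_inter_preimage_symm (chartAt (Par n) d).open_source

theorem chartTrans_mem (c d : M) {y : Par n} (hy : y ∈ transDom n c d) :
    chartTrans n c d y ∈ transDom n d c := by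
  refine ⟨(chartAt (Par n) d).map_source hy.2, ?_⟩
  show (chartAt (Par n) d).symm (chartAt (Par n) d ((chartAt (Par n) c).symm y)) ∈
    (chartAt (Par n) c).source
  rw [(chartAt (Par n) d).left_inv hy.2]
  exact (chartAt (Par n) c).map_target hy.1

theorem symm_chartTrans (c d : M) {y : Par n} (hy : y ∈ transDom n c d) :
    (chartAt (Par n) d).symm (chartTrans n c d y) = (chartAt (Par n) c).symm y :=
  (chartAt (Par n) d).left_inv hy.2

theorem chartTrans_chartTrans (c d : M) {y : Par n} (hy : y ∈ transDom n c d) :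
    chartTrans n d c (chartTrans n c d y) = y := by
  rw [chartTrans, symm_chartTrans c d hy, (chartAt (Par n) c).right_inv hy.1]

theorem mem_transDom_self (c : M) {y : Par n} (hy : y ∈ (chartAt (Par n) c).target) :
    y ∈ transDom n c ((chartAt (Par n) c).symm y) := ⟨hy, mem_chart_source _ _⟩

section Smooth

variable [IsManifold (𝓡 n) ∞ M]

theorem contDiffOn_chartTrans (c d : M) : ContDiffOn ℝ ∞ (chartTrans n c d) (transDom n c d) := by
  have h := contDiffOn_ext_coord_change (I := 𝓡 n) (n := ∞) d c
  refine h.congr_mono (fun y _ => rfl) fun y hy => ?_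
  simpa [transDom, PartialEquiv.trans_source] using hy

theorem hasFDerivAt_chartTrans (c d : M) {y : Par n} (hy : y ∈ transDom n c d) :
    HasFDerivAt (chartTrans n c d) (fderiv ℝ (chartTrans n c d) y) y :=
  (((contDiffOn_chartTrans c d).contDiffAt ((isOpen_transDom c d).mem_nhds hy)).differentiableAt
    (by simp)).hasFDerivAt

theorem fderiv_chartTrans_comp (c d : M) {y : Par n} (hy : y ∈ transDom n c d) :
    (fderiv ℝ (chartTrans n d c) (chartTrans n c d y)) ∘L (fderiv ℝ (chartTrans n c d) y) =
      ContinuousLinearMap.id ℝ (Par n) := by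
  have h1 := (hasFDerivAt_chartTrans d c (chartTrans_mem c d hy)).comp y
    (hasFDerivAt_chartTrans c d hy)
  refine h1.unique ((hasFDerivAt_id y).congr_of_eventuallyEq ?_)
  exact Filter.eventuallyEq_of_mem ((isOpen_transDom c d).mem_nhds hy) fun z hz =>
    chartTrans_chartTrans c d hz

/-- The derivative of a transition map as an equivalence. -/
def transEquiv (c d : M) {y : Par n} (hy : y ∈ transDom n c d) : Par n ≃L[ℝ] Par n :=
  ContinuousLinearEquiv.equivOfInverse (fderiv ℝ (chartTrans n c d) y)
    (fderiv ℝ (chartTrans n d c) (chartTrans n c d y))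
    (fun v => congrArg (fun D => D v) (fderiv_chartTrans_comp c d hy))
    (fun v => by
      have h := fderiv_chartTrans_comp d c (chartTrans_mem c d hy)
      rw [chartTrans_chartTrans c d hy] at h
      exact congrArg (fun D => D v) h)

theorem coe_transEquiv (c d : M) {y : Par n} (hy : y ∈ transDom n c d) :
    ((transEquiv c d hy : Par n ≃L[ℝ] Par n) : Par n →L[ℝ] Par n) =
      fderiv ℝ (chartTrans n c d) y := rfl

/-- Chain rule for the change of charts. -/
theorem fderiv_comp_chart (c d : M) {y : Par n} (hy : y ∈ transDom n c d) {f : M → G}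
    (hf : DifferentiableAt ℝ (f ∘ (chartAt (Par n) d).symm) (chartTrans n c d y)) :
    HasFDerivAt (f ∘ (chartAt (Par n) c).symm)
      ((fderiv ℝ (f ∘ (chartAt (Par n) d).symm) (chartTrans n c d y)) ∘L
        (transEquiv c d hy : Par n →L[ℝ] Par n)) y := by
  have h1 := hf.hasFDerivAt.comp y (hasFDerivAt_chartTrans c d hy)
  refine h1.congr_of_eventuallyEq ?_
  exact Filter.eventuallyEq_of_mem ((isOpen_transDom c d).mem_nhds hy) fun z hz => by
    simp only [Function.comp_apply, symm_chartTrans c d hz]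

theorem dS_loc_trans (c d : M) {y : Par n} (hy : y ∈ transDom n c d) {Y : ℝ → M → G} {t : ℝ}
    (hf : DifferentiableAt ℝ (Y t ∘ (chartAt (Par n) d).symm) (chartTrans n c d y)) :
    dS (loc c Y) (y, t) = dS (loc d Y) (chartTrans n c d y, t) ∘L
      (transEquiv c d hy : Par n →L[ℝ] Par n) :=
  (fderiv_comp_chart c d hy hf).fderiv

theorem contMDiffOn_loc {Y : ℝ → M → G} {I : Set ℝ}
    (hY : ContMDiffOn ((𝓡 n).prod 𝓘(ℝ, ℝ)) 𝓘(ℝ, G) ∞ (fun q : M × ℝ => Y q.2 q.1) (univ ×ˢ I))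
    (c : M) : ContDiffOn ℝ ∞ (loc c Y) ((chartAt (Par n) c).target ×ˢ I) := by
  have h1 : ContMDiffOn (𝓘(ℝ, Par n).prod 𝓘(ℝ, ℝ)) (𝓡 n) ∞
      (fun q : Par n × ℝ => (chartAt (Par n) c).symm q.1) ((chartAt (Par n) c).target ×ˢ I) :=
    (contMDiffOn_chart_symm (I := 𝓡 n)).comp contMDiffOn_fst fun q hq => hq.1
  have h2 : ContMDiffOn (𝓘(ℝ, Par n).prod 𝓘(ℝ, ℝ)) 𝓘(ℝ, ℝ) ∞
      (fun q : Par n × ℝ => q.2) ((chartAt (Par n) c).target ×ˢ I) := contMDiffOn_snd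
  have h3 := hY.comp (h1.prodMk h2) fun q hq => ⟨trivial, hq.2⟩
  rw [← contMDiffOn_iff_contDiffOn, modelWithCornersSelf_prod, ← chartedSpaceSelf_prod]
  exact h3

set_option linter.unusedSectionVars false in
theorem contMDiff_slice {Y : ℝ → M → G} {I : Set ℝ}
    (hY : ContMDiffOn ((𝓡 n).prod 𝓘(ℝ, ℝ)) 𝓘(ℝ, G) ∞ (fun q : M × ℝ => Y q.2 q.1) (univ ×ˢ I))
    {t : ℝ} (ht : t ∈ I) : ContMDiff (𝓡 n) 𝓘(ℝ, G) ∞ (Y t) := by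
  rw [← contMDiffOn_univ]
  exact hY.comp (contMDiffOn_id.prodMk contMDiffOn_const) fun q hq => ⟨trivial, ht⟩

theorem contDiffOn_comp_chart {f : M → G} (hf : ContMDiff (𝓡 n) 𝓘(ℝ, G) ∞ f) (c : M) :
    ContDiffOn ℝ ∞ (f ∘ (chartAt (Par n) c).symm) (chartAt (Par n) c).target := by
  rw [← contMDiffOn_iff_contDiffOn]
  exact hf.comp_contMDiffOn (contMDiffOn_chart_symm (I := 𝓡 n))

theorem differentiableAt_comp_chart {f : M → G} (hf : ContMDiff (𝓡 n) 𝓘(ℝ, G) ∞ f) (c : M)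
    {y : Par n} (hy : y ∈ (chartAt (Par n) c).target) :
    DifferentiableAt ℝ (f ∘ (chartAt (Par n) c).symm) y :=
  ((contDiffOn_comp_chart hf c).contDiffAt
    ((chartAt (Par n) c).open_target.mem_nhds hy)).differentiableAt (by simp)

set_option linter.unusedSectionVars false in
theorem mvfderiv_eq_fderiv_chart {f : M → G} (hf : ContMDiff (𝓡 n) 𝓘(ℝ, G) ∞ f) (x : M) :
    (mvfderiv (𝓡 n) f x : Par n →L[ℝ] G) =
      fderiv ℝ (f ∘ (chartAt (Par n) x).symm) (chartAt (Par n) x x) := by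
  have h := (hf.mdifferentiable (by simp) x).mfderiv
  have h2 : (mvfderiv (𝓡 n) f x : Par n →L[ℝ] G) = (mfderiv (𝓡 n) 𝓘(ℝ, G) f x) := rfl
  rw [h2, h]
  simp only [writtenInExtChartAt, mfld_simps, fderivWithin_univ]
  rfl

end Smooth

/-- Continuity of the spatial derivative up to the boundary of the time interval. -/
theorem continuousOn_dS {f : Par n × ℝ → G} {U : Set (Par n)} {I : Set ℝ} (hU : IsOpen U)
    (hI : UniqueDiffOn ℝ I) (hf : ContDiffOn ℝ ∞ f (U ×ˢ I)) (v : Par n) :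
    ContinuousOn (fun q => dS f q v) (U ×ˢ I) := by
  -- At the initial time only one-sided time derivatives exist, but the spatial derivative is a
  -- restriction of the derivative within `U ×ˢ I`, which is continuous there.
  have h1 : ContDiffOn ℝ ∞ (fderivWithin ℝ f (U ×ˢ I)) (U ×ˢ I) :=
    hf.fderivWithin (hU.uniqueDiffOn.prod hI) (by simp)
  have h2 : ∀ q ∈ U ×ˢ I, dS f q v = fderivWithin ℝ f (U ×ˢ I) q (v, 0) := by
    rintro ⟨y, t⟩ ⟨hy, ht⟩
    have hd := ((hf.differentiableOn (by simp)) (y, t) ⟨hy, ht⟩).hasFDerivWithinAt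
    have hi : HasFDerivWithinAt (fun z : Par n => (z, t)) (ContinuousLinearMap.inl ℝ (Par n) ℝ) U y :=
      (hasFDerivAt_prodMk_left y t).hasFDerivWithinAt
    have hm : MapsTo (fun z : Par n => (z, t)) U (U ×ˢ I) := fun z hz => ⟨hz, ht⟩
    have hc := (hd.comp y hi hm).hasFDerivAt (hU.mem_nhds hy)
    have : dS f (y, t) = _ := hc.fderiv
    rw [this]; rfl
  exact (h1.continuousOn.clm_apply continuousOn_const).congr h2

end Charts

/-! ### The smooth family in charts, and its chart-independent curvatures -/

section Family

variable {n : ℕ} {M : Type*} [TopologicalSpace M] [ChartedSpace (EuclideanSpace ℝ (Fin n)) M]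
  [IsManifold (𝓡 n) ∞ M] {Tmax : EReal} {X ν : ℝ → M → Amb n}

namespace IsSmoothFamily

set_option linter.unusedSectionVars false in
theorem contMDiff_X (h : IsSmoothFamily Tmax X ν) {t : ℝ} (ht : t ∈ timeInterval Tmax) :
    ContMDiff (𝓡 n) 𝓘(ℝ, Amb n) ∞ (X t) := contMDiff_slice h.smooth_X ht

set_option linter.unusedSectionVars false in
theorem contMDiff_ν (h : IsSmoothFamily Tmax X ν) {t : ℝ} (ht : t ∈ timeInterval Tmax) :
    ContMDiff (𝓡 n) 𝓘(ℝ, Amb n) ∞ (ν t) := contMDiff_slice h.smooth_ν ht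

/-- The manifold derivative at a point is taken in the chart preferred there, so a fixed chart `c`
differs from it by the transition map. -/
theorem dS_loc_eq {Y : ℝ → M → Amb n} {t : ℝ} (hY : ContMDiff (𝓡 n) 𝓘(ℝ, Amb n) ∞ (Y t)) (c : M)
    {y : Par n} (hy : y ∈ (chartAt (Par n) c).target) :
    dS (loc c Y) (y, t) = (mvfderiv (𝓡 n) (Y t) ((chartAt (Par n) c).symm y) : Par n →L[ℝ] Amb n) ∘L
      (transEquiv c _ (mem_transDom_self c hy) : Par n →L[ℝ] Par n) := by
  rw [mvfderiv_eq_fderiv_chart hY]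
  exact dS_loc_trans c _ (mem_transDom_self c hy)
    (differentiableAt_comp_chart hY _ (chartTrans_mem c _ (mem_transDom_self c hy)).1)

theorem dS_orthogonal (h : IsSmoothFamily Tmax X ν) {t : ℝ} (ht : t ∈ timeInterval Tmax) (c : M)
    {y : Par n} (hy : y ∈ (chartAt (Par n) c).target) (v : Par n) :
    inner ℝ (dS (loc c X) (y, t) v) (loc c ν (y, t)) = 0 := by
  rw [dS_loc_eq (h.contMDiff_X ht) c hy]
  exact (h.normal t ht).orthogonal _ _

theorem dS_injective (h : IsSmoothFamily Tmax X ν) {t : ℝ} (ht : t ∈ timeInterval Tmax) (c : M)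
    {y : Par n} (hy : y ∈ (chartAt (Par n) c).target) :
    Function.Injective (dS (loc c X) (y, t)) := by
  rw [dS_loc_eq (h.contMDiff_X ht) c hy]
  exact ((h.embedded t ht).deriv_injective _).comp
    (transEquiv c _ (mem_transDom_self c hy)).injective

/-- In the interior of the time interval, a smooth family is a local family in every chart. -/
theorem isLocalFamily (h : IsSmoothFamily Tmax X ν) (c : M) :
    IsLocalFamily ((chartAt (Par n) c).target ×ˢ openTime Tmax) (loc c X) (loc c ν) where
  isOpen := (chartAt (Par n) c).open_target.prod (isOpen_openTime _)
  smooth_X := (contMDiffOn_loc h.smooth_X c).mono (prod_mono le_rfl openTime_subset)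
  smooth_ν := (contMDiffOn_loc h.smooth_ν c).mono (prod_mono le_rfl openTime_subset)
  norm_eq_one q hq := (h.normal q.2 (openTime_subset hq.2)).norm_eq_one _
  injective _ hq := h.dS_injective (openTime_subset hq.2) c hq.1
  orthogonal _ hq := h.dS_orthogonal (openTime_subset hq.2) c hq.1

/-- The family which is constant in time. -/
theorem isLocalFamily_frozen (h : IsSmoothFamily Tmax X ν) {t : ℝ} (ht : t ∈ timeInterval Tmax)
    (c : M) : IsLocalFamily ((chartAt (Par n) c).target ×ˢ univ)
      (fun q => loc c X (q.1, t)) (fun q => loc c ν (q.1, t)) where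
  isOpen := (chartAt (Par n) c).open_target.prod isOpen_univ
  smooth_X := (contDiffOn_comp_chart (h.contMDiff_X ht) c).comp contDiffOn_fst fun _ hq => hq.1
  smooth_ν := (contDiffOn_comp_chart (h.contMDiff_ν ht) c).comp contDiffOn_fst fun _ hq => hq.1
  norm_eq_one _ _ := (h.normal t ht).norm_eq_one _
  injective _ hq := h.dS_injective ht c hq.1
  orthogonal _ hq := h.dS_orthogonal ht c hq.1

/-- Freezing the time makes spatial statements available at `t = 0`, where the moving family is not
defined on an open set of space-time. -/
theorem isHypersurfacePoint (h : IsSmoothFamily Tmax X ν) {t : ℝ} (ht : t ∈ timeInterval Tmax)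
    (c : M) {y : Par n} (hy : y ∈ (chartAt (Par n) c).target) :
    IsHypersurfacePoint (dS (loc c X) (y, t)) (dS (loc c ν) (y, t)) (loc c ν (y, t)) :=
  (h.isLocalFamily_frozen ht c).isHypersurfacePoint (q := (y, t)) ⟨hy, trivial⟩

end IsSmoothFamily

theorem IsPrincipalFrame.comp {A B : Par n →L[ℝ] Amb n} {L : Par n ≃L[ℝ] Par n} {κ : Fin n → ℝ}
    (hF : IsPrincipalFrame A B L κ) (K : Par n ≃L[ℝ] Par n) :
    IsPrincipalFrame (A ∘L (K : Par n →L[ℝ] Par n)) (B ∘L (K : Par n →L[ℝ] Par n))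
      (L.trans K.symm) κ where
  orthonormal := by simpa using hF.orthonormal
  principal := by simpa using hF.principal

theorem curvatureRoots_comp {A B : Par n →L[ℝ] Amb n} {ν : Amb n} (h : IsHypersurfacePoint A B ν)
    (K : Par n ≃L[ℝ] Par n) : curvatureRoots (A ∘L (K : Par n →L[ℝ] Par n))
      (B ∘L (K : Par n →L[ℝ] Par n)) = curvatureRoots A B := by
  obtain ⟨L, κ, hF⟩ := h.exists_frame
  rw [curvatureRoots, curvatureRoots, hF.roots_charpoly, (hF.comp K).roots_charpoly]

theorem IsSmoothFamily.principalCurvatures_eq (h : IsSmoothFamily Tmax X ν) {t : ℝ}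
    (ht : t ∈ timeInterval Tmax) (x : M) : principalCurvatures (X t) (ν t) x =
      curvatureRoots (dS (loc x X) (chartAt (Par n) x x, t))
        (dS (loc x ν) (chartAt (Par n) x x, t)) := by
  have e1 : dS (loc x X) (chartAt (Par n) x x, t) = (mvfderiv (𝓡 n) (X t) x : Par n →L[ℝ] Amb n) :=
    (mvfderiv_eq_fderiv_chart (h.contMDiff_X ht) x).symm
  have e2 : dS (loc x ν) (chartAt (Par n) x x, t) = (mvfderiv (𝓡 n) (ν t) x : Par n →L[ℝ] Amb n) :=
    (mvfderiv_eq_fderiv_chart (h.contMDiff_ν ht) x).symm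
  rw [e1, e2]
  rfl

theorem IsSmoothFamily.dS_loc_trans_X (h : IsSmoothFamily Tmax X ν) {t : ℝ}
    (ht : t ∈ timeInterval Tmax) (c d : M) {y : Par n} (hy : y ∈ transDom n c d) :
    dS (loc c X) (y, t) = dS (loc d X) (chartTrans n c d y, t) ∘L
      (transEquiv c d hy : Par n →L[ℝ] Par n) :=
  dS_loc_trans c d hy (differentiableAt_comp_chart (h.contMDiff_X ht) _ (chartTrans_mem c d hy).1)

theorem IsSmoothFamily.dS_loc_trans_ν (h : IsSmoothFamily Tmax X ν) {t : ℝ}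
    (ht : t ∈ timeInterval Tmax) (c d : M) {y : Par n} (hy : y ∈ transDom n c d) :
    dS (loc c ν) (y, t) = dS (loc d ν) (chartTrans n c d y, t) ∘L
      (transEquiv c d hy : Par n →L[ℝ] Par n) :=
  dS_loc_trans c d hy (differentiableAt_comp_chart (h.contMDiff_ν ht) _ (chartTrans_mem c d hy).1)

/-- The principal curvatures do not depend on the chart. -/
theorem IsSmoothFamily.curvatureRoots_loc (h : IsSmoothFamily Tmax X ν) {t : ℝ}
    (ht : t ∈ timeInterval Tmax) (c : M) {y : Par n} (hy : y ∈ (chartAt (Par n) c).target) :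
    curvatureRoots (dS (loc c X) (y, t)) (dS (loc c ν) (y, t)) =
      principalCurvatures (X t) (ν t) ((chartAt (Par n) c).symm y) := by
  have hm := mem_transDom_self c hy
  rw [h.principalCurvatures_eq ht, h.dS_loc_trans_X ht c _ hm, h.dS_loc_trans_ν ht c _ hm,
    curvatureRoots_comp (h.isHypersurfacePoint ht _ (chartTrans_mem c _ hm).1)]
  rfl

theorem IsSmoothFamily.card_principalCurvatures (h : IsSmoothFamily Tmax X ν) {t : ℝ}
    (ht : t ∈ timeInterval Tmax) (x : M) :
    Multiset.card (principalCurvatures (X t) (ν t) x) = n := by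
  rw [h.principalCurvatures_eq ht]
  exact (h.isHypersurfacePoint ht x (mem_chart_target _ _)).card_curvatureRoots

theorem IsSmoothFamily.p_eq (h : IsSmoothFamily Tmax X ν) {t : ℝ}
    (ht : t ∈ timeInterval Tmax) (l : ℕ) (x : M) :
    p l (X t) (ν t) x = normEsymm (principalCurvatures (X t) (ν t) x) l := by
  rw [p, normEsymm, h.card_principalCurvatures ht]

theorem IsSmoothFamily.normCurv_loc (h : IsSmoothFamily Tmax X ν) {t : ℝ}
    (ht : t ∈ timeInterval Tmax) (c : M) {y : Par n} (hy : y ∈ (chartAt (Par n) c).target) (l : ℕ) :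
    IsLocalFamily.normCurv (loc c X) (loc c ν) l (y, t) =
      p l (X t) (ν t) ((chartAt (Par n) c).symm y) := by
  rw [h.p_eq ht, ← h.curvatureRoots_loc ht c hy]
  rfl

theorem IsSmoothFamily.areaDensity_eq (h : IsSmoothFamily Tmax X ν) {t : ℝ}
    (ht : t ∈ timeInterval Tmax) (c : M) {y : Par n} (hy : y ∈ (chartAt (Par n) c).target) :
    areaDensity (X t) c y = |parJac (loc c X) (loc c ν) 0 (y, t)| := by
  rw [IsLocalFamily.parJac_zero_eq, ← (h.isHypersurfacePoint ht c hy).sqrt_det_gram]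
  rfl

theorem IsSmoothFamily.parJac_ne_zero (h : IsSmoothFamily Tmax X ν) {t : ℝ}
    (ht : t ∈ timeInterval Tmax) (c : M) {y : Par n} (hy : y ∈ (chartAt (Par n) c).target) :
    parJac (loc c X) (loc c ν) 0 (y, t) ≠ 0 := by
  rw [IsLocalFamily.parJac_zero_eq]
  exact (h.isHypersurfacePoint ht c hy).jac_ne_zero

theorem continuous_hyperVol {V : Type*} [TopologicalSpace V] {s : Set V}
    {ν : V → Amb n} {v : Fin n → V → Amb n} (hν : ContinuousOn ν s)
    (hv : ∀ i, ContinuousOn (v i) s) :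
    ContinuousOn (fun x => hyperVol (ν x) fun i => v i x) s := by
  have hc : ContinuousOn (fun x => (Fin.cons (ν x) (fun i => v i x) : Fin (n + 1) → Amb n)) s := by
    rw [continuousOn_pi]
    intro i
    refine Fin.cases ?_ (fun i => ?_) i
    · simpa using! hν
    · simpa using! hv i
  exact (continuous_volForm n).comp_continuousOn hc

theorem IsSmoothFamily.continuousOn_parJac (h : IsSmoothFamily Tmax X ν) (hT : 0 < Tmax) (c : M)
    (s : ℝ) : ContinuousOn (parJac (loc c X) (loc c ν) s)
      ((chartAt (Par n) c).target ×ˢ timeInterval Tmax) := by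
  have hX := contMDiffOn_loc h.smooth_X c
  have hν := contMDiffOn_loc h.smooth_ν c
  have hU := (chartAt (Par n) c).open_target
  have hI := uniqueDiffOn_timeInterval hT
  exact continuous_hyperVol hν.continuousOn fun i =>
    (continuousOn_dS hU hI hX _).add ((continuousOn_dS hU hI hν _).const_smul s)

/-- Joint continuity up to `t = 0` is what carries `k`-convexity, monotonicity and roundness across
the initial time. -/
theorem IsSmoothFamily.continuousOn_p (h : IsSmoothFamily Tmax X ν) (hT : 0 < Tmax) (c : M)
    {l : ℕ} (hl : l ≤ n) : ContinuousOn (loc c fun t => p l (X t) (ν t))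
      ((chartAt (Par n) c).target ×ˢ timeInterval Tmax) := by
  have hJ := h.continuousOn_parJac hT c
  have h1 : ContinuousOn (fun q => coefAt n l (fun s => parJac (loc c X) (loc c ν) s q) /
      parJac (loc c X) (loc c ν) 0 q / n.choose l)
      ((chartAt (Par n) c).target ×ˢ timeInterval Tmax) := by
    refine ((ContinuousOn.div ?_ (hJ 0) fun q hq => h.parJac_ne_zero hq.2 c hq.1).div_const _)
    exact continuousOn_finsetSum _ fun m _ => continuousOn_const.mul (hJ m)
  refine h1.congr fun q hq => ?_
  have e := h.normCurv_loc hq.2 c hq.1 l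
  have e2 := (h.isLocalFamily_frozen hq.2 c).normCurv_eq (q := (q.1, q.2)) ⟨hq.1, trivial⟩ hl
  exact e.symm.trans e2

theorem IsSmoothFamily.contDiffOn_p (h : IsSmoothFamily Tmax X ν) {t : ℝ}
    (ht : t ∈ timeInterval Tmax) (c : M) {l : ℕ} (hl : l ≤ n) :
    ContDiffOn ℝ ∞ (p l (X t) (ν t) ∘ (chartAt (Par n) c).symm) (chartAt (Par n) c).target := by
  have h1 := (h.isLocalFamily_frozen ht c).contDiffOn_normCurv hl
  have h2 := h1.comp (contDiffOn_id.prodMk (contDiffOn_const (c := t)))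
    (fun y (hy : y ∈ (chartAt (Par n) c).target) => (⟨hy, trivial⟩ : (y, t) ∈ _ ×ˢ univ))
  exact h2.congr fun y hy => (h.normCurv_loc ht c hy l).symm

end Family

/-! ### Integrals of functions vanishing off a compact set -/

section CompactSupport

open MeasureTheory

variable {n : ℕ} {U K : Set (Par n)}

theorem integrableOn_of_zero_off (hU : IsOpen U) (hK : IsCompact K) (hKU : K ⊆ U) {h : Par n → ℝ}
    (hc : ContinuousOn h U) (hz : ∀ y ∈ U, y ∉ K → h y = 0) : IntegrableOn h U :=
  ((hc.mono hKU).integrableOn_compact hK).of_forall_sdiff_eq_zero hU.measurableSet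
    fun y hy => hz y hy.1 hy.2

theorem setIntegral_eq_compact (hU : IsOpen U) (hKU : K ⊆ U) {h : Par n → ℝ}
    (hz : ∀ y ∈ U, y ∉ K → h y = 0) : ∫ y in U, h y = ∫ y in K, h y :=
  setIntegral_eq_of_subset_of_forall_sdiff_eq_zero hU.measurableSet hKU fun y hy => hz y hy.1 hy.2

/-- Extension by zero is smooth with compact support on the whole space; integrate by parts against
the constant `1`. -/
theorem integral_fderiv_eq_zero_of_zero_off (hU : IsOpen U) (hK : IsCompact K) (hKU : K ⊆ U)
    {h : Par n → ℝ} (hd : ContDiffOn ℝ ∞ h U) (hz : ∀ y ∈ U, y ∉ K → h y = 0) (v : Par n) :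
    ∫ y in U, fderiv ℝ h y v = 0 := by
  set H := U.indicator h with hH
  have hin : ∀ y ∈ U, H =ᶠ[nhds y] h := fun y hy =>
    Filter.eventuallyEq_of_mem (hU.mem_nhds hy) fun z hz => indicator_of_mem hz h
  have hout : ∀ y ∉ K, H =ᶠ[nhds y] fun _ => 0 := fun y hy =>
    Filter.eventuallyEq_of_mem (hK.isClosed.isOpen_compl.mem_nhds hy) fun z hzK => by
      by_cases hzU : z ∈ U
      · rw [hH, indicator_of_mem hzU, hz z hzU hzK]
      · rw [hH, indicator_of_notMem hzU]
  have hdiff : ContDiff ℝ ∞ H := by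
    rw [contDiff_iff_contDiffAt]
    intro y
    by_cases hy : y ∈ U
    · exact (hd.contDiffAt (hU.mem_nhds hy)).congr_of_eventuallyEq (hin y hy)
    · exact contDiffAt_const.congr_of_eventuallyEq (hout y fun hyK => hy (hKU hyK))
  have hsupp : HasCompactSupport H :=
    HasCompactSupport.intro hK fun y hy => (hout y hy).self_of_nhds
  have hfd : Continuous fun y => fderiv ℝ H y v :=
    (hdiff.continuous_fderiv (by simp)).clm_apply continuous_const
  have hi : Integrable fun y => fderiv ℝ H y v := by
    refine hfd.integrable_of_hasCompactSupport (HasCompactSupport.intro hK fun y hy => ?_)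
    rw [(hout y hy).fderiv_eq]; simp
  have hi2 : Integrable H := hdiff.continuous.integrable_of_hasCompactSupport hsupp
  have key := integral_mul_fderiv_eq_neg_fderiv_mul_of_integrable (μ := (volume : Measure (Par n)))
    (f := fun _ : Par n => (1 : ℝ)) (g := H) (v := v) (by simp) (by simpa using hi)
    (by simpa using hi2) (fun y _ => differentiableAt_const _)
    (fun y _ => hdiff.differentiable (by simp) y)
  simp only [one_mul, fderiv_fun_const, Pi.zero_apply, zero_apply,
    zero_mul, integral_zero, neg_zero] at key
  rw [← key, ← integral_indicator hU.measurableSet]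
  congr 1
  ext y
  by_cases hy : y ∈ U
  · rw [indicator_of_mem hy, (hin y hy).fderiv_eq]
  · rw [indicator_of_notMem hy, (hout y fun hyK => hy (hKU hyK)).fderiv_eq]; simp

theorem continuousOn_integral_of_zero_off (hU : IsOpen U) (hK : IsCompact K) (hKU : K ⊆ U)
    {I : Set ℝ} {h : Par n × ℝ → ℝ} (hc : ContinuousOn h (U ×ˢ I))
    (hz : ∀ t ∈ I, ∀ y ∈ U, y ∉ K → h (y, t) = 0) :
    ContinuousOn (fun t => ∫ y in U, h (y, t)) I := by
  have e : ∀ t ∈ I, ∫ y in U, h (y, t) = ∫ y, U.indicator (fun y => h (y, t)) y := fun t _ =>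
    (integral_indicator hU.measurableSet).symm
  refine ContinuousOn.congr ?_ e
  refine continuousOn_integral_of_compact_support hK ?_ ?_
  · rintro ⟨t, y⟩ ⟨ht, -⟩
    by_cases hy : y ∈ U
    · have h1 : ContinuousOn (fun q : ℝ × Par n => h (q.2, q.1)) (I ×ˢ U) :=
        hc.comp (continuous_snd.prodMk continuous_fst).continuousOn fun q hq => ⟨hq.2, hq.1⟩
      have h2 := h1 (t, y) ⟨ht, hy⟩
      have hn : I ×ˢ U ∈ nhdsWithin (t, y) (I ×ˢ univ) :=
        Filter.inter_mem_iff.1 (by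
          have : (univ ×ˢ U) ∩ (I ×ˢ (univ : Set (Par n))) ∈ nhdsWithin (t, y) (I ×ˢ univ) :=
            Filter.inter_mem (mem_nhdsWithin_of_mem_nhds
              ((isOpen_univ.prod hU).mem_nhds ⟨trivial, hy⟩)) self_mem_nhdsWithin
          have hh : (I ×ˢ U) ∩ (I ×ˢ U) ∈ nhdsWithin (t, y) (I ×ˢ univ) := by
            refine Filter.mem_of_superset this ?_
            rintro ⟨a, b⟩ ⟨⟨_, hb⟩, ⟨ha, _⟩⟩
            exact ⟨⟨ha, hb⟩, ⟨ha, hb⟩⟩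
          exact hh) |>.1
      refine (h2.mono_of_mem_nhdsWithin hn).congr_of_eventuallyEq ?_ ?_
      · refine Filter.mem_of_superset hn ?_
        rintro ⟨a, b⟩ ⟨_, hb⟩
        exact indicator_of_mem hb fun y => h (y, a)
      · exact indicator_of_mem hy fun y => h (y, t)
    · have hyK : y ∉ K := fun h' => hy (hKU h')
      have hz' : ∀ a ∈ I, ∀ b ∉ K, U.indicator (fun y => h (y, a)) b = 0 := by
        intro a ha b hb
        by_cases hbU : b ∈ U
        · rw [indicator_of_mem hbU]; exact hz a ha b hbU hb
        · rw [indicator_of_notMem hbU]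
      refine (continuousWithinAt_const (b := (0 : ℝ))).congr_of_eventuallyEq ?_ (hz' t ht y hyK)
      have : (univ ×ˢ Kᶜ) ∩ (I ×ˢ (univ : Set (Par n))) ∈ nhdsWithin (t, y) (I ×ˢ univ) :=
        Filter.inter_mem (mem_nhdsWithin_of_mem_nhds
          ((isOpen_univ.prod hK.isClosed.isOpen_compl).mem_nhds ⟨trivial, hyK⟩))
          self_mem_nhdsWithin
      refine Filter.mem_of_superset this ?_
      rintro ⟨a, b⟩ ⟨⟨_, hb⟩, ⟨ha, _⟩⟩
      exact hz' a ha b hb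
  · intro t y ht hy
    by_cases hyU : y ∈ U
    · rw [indicator_of_mem hyU]; exact hz t ht y hyU hy
    · rw [indicator_of_notMem hyU]

/-- Over `K` times a closed ball of times the time derivative is bounded by compactness, and this
constant dominates it. -/
theorem hasDerivAt_integral_of_zero_off (hU : IsOpen U) (hK : IsCompact K) (hKU : K ⊆ U)
    {J : Set ℝ} (hJ : IsOpen J) {h h' : Par n × ℝ → ℝ} (hc : ContinuousOn h (U ×ˢ J))
    (hc' : ContinuousOn h' (U ×ˢ J))
    (hd : ∀ y ∈ U, ∀ t ∈ J, HasDerivAt (fun t => h (y, t)) (h' (y, t)) t)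
    (hz : ∀ t ∈ J, ∀ y ∈ U, y ∉ K → h (y, t) = 0) (hz' : ∀ t ∈ J, ∀ y ∈ U, y ∉ K → h' (y, t) = 0)
    {t : ℝ} (ht : t ∈ J) :
    HasDerivAt (fun t => ∫ y in U, h (y, t)) (∫ y in U, h' (y, t)) t := by
  obtain ⟨δ, hδ, hδJ⟩ := Metric.nhds_basis_closedBall.mem_iff.1 (hJ.mem_nhds ht)
  have hcomp : IsCompact (K ×ˢ Metric.closedBall t δ) := hK.prod (isCompact_closedBall t δ)
  obtain ⟨C, hC⟩ := hcomp.exists_bound_of_continuousOn (hc'.mono (prod_mono hKU hδJ))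
  have hball : Metric.ball t δ ∈ nhds t := Metric.ball_mem_nhds t hδ
  have hsub : Metric.ball t δ ⊆ J := Metric.ball_subset_closedBall.trans hδJ
  have slice : ∀ {g : Par n × ℝ → ℝ}, ContinuousOn g (U ×ˢ J) → ∀ s ∈ J,
      ContinuousOn (fun y => g (y, s)) K := fun hg s hs =>
    hg.comp (Continuous.prodMk_left s).continuousOn fun y hy => ⟨hKU hy, hs⟩
  have key := hasDerivAt_integral_of_dominated_loc_of_deriv_le
    (μ := (volume : Measure (Par n)).restrict K) (F := fun s y => h (y, s))
    (F' := fun s y => h' (y, s)) (x₀ := t) (s := Metric.ball t δ) (bound := fun _ => C) hball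
    (Filter.eventually_of_mem hball fun s hs =>
      (slice hc s (hsub hs)).aestronglyMeasurable hK.measurableSet)
    ((slice hc t ht).integrableOn_compact hK)
    ((slice hc' t ht).aestronglyMeasurable hK.measurableSet)
    ((ae_restrict_iff' hK.measurableSet).2 (Filter.Eventually.of_forall fun y hy s hs =>
      hC (y, s) ⟨hy, Metric.ball_subset_closedBall hs⟩))
    (integrableOn_const hK.measure_lt_top.ne)
    ((ae_restrict_iff' hK.measurableSet).2 (Filter.Eventually.of_forall fun y hy s hs =>
      hd y (hKU hy) s (hsub hs)))
  have h2 := key.2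
  rw [setIntegral_eq_compact hU hKU (hz' t ht)]
  refine h2.congr_of_eventuallyEq ?_
  exact Filter.eventuallyEq_of_mem (hJ.mem_nhds ht) fun s hs =>
    setIntegral_eq_compact hU hKU (hz s hs)

theorem eq_zero_of_integral_eq_zero (hU : IsOpen U) {h : Par n → ℝ} (hc : ContinuousOn h U)
    (hi : IntegrableOn h U) (h0 : ∀ y ∈ U, 0 ≤ h y) (hint : ∫ y in U, h y = 0) :
    ∀ y ∈ U, h y = 0 := by
  have h1 := (setIntegral_eq_zero_iff_of_nonneg_ae
    ((ae_restrict_iff' hU.measurableSet).2 (Filter.Eventually.of_forall h0)) hi).1 hint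
  have := Measure.eqOn_open_of_ae_eq h1 hU hc continuousOn_const
  exact this

end CompactSupport

/-! ### The area density -/

section Density

variable {n : ℕ} {M : Type*} [TopologicalSpace M] [ChartedSpace (EuclideanSpace ℝ (Fin n)) M]
  [IsManifold (𝓡 n) ∞ M] {Tmax : EReal} {X ν : ℝ → M → Amb n}

namespace IsSmoothFamily

theorem continuousOn_areaDensity (h : IsSmoothFamily Tmax X ν) {t : ℝ}
    (ht : t ∈ timeInterval Tmax) (c : M) :
    ContinuousOn (areaDensity (X t) c) (chartAt (Par n) c).target := by
  have h1 := h.isLocalFamily_frozen ht c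
  have h2 := contDiffOn_parJac h1.isOpen h1.smooth_X h1.smooth_ν 0
  have h3 := h2.continuousOn.abs.comp (Continuous.prodMk_left t).continuousOn
    (fun y (hy : y ∈ (chartAt (Par n) c).target) => (⟨hy, trivial⟩ : (y, t) ∈ _ ×ˢ univ))
  exact h3.congr fun y hy => h.areaDensity_eq ht c hy

theorem areaDensity_pos (h : IsSmoothFamily Tmax X ν) {t : ℝ}
    (ht : t ∈ timeInterval Tmax) (c : M) {y : Par n} (hy : y ∈ (chartAt (Par n) c).target) :
    0 < areaDensity (X t) c y := by
  rw [h.areaDensity_eq ht c hy]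
  exact abs_pos.2 (h.parJac_ne_zero ht c hy)

theorem areaDensity_trans (h : IsSmoothFamily Tmax X ν) {t : ℝ}
    (ht : t ∈ timeInterval Tmax) (c d : M) {y : Par n} (hy : y ∈ transDom n c d) :
    areaDensity (X t) c y = |(fderiv ℝ (chartTrans n c d) y).det| *
      areaDensity (X t) d (chartTrans n c d y) := by
  rw [h.areaDensity_eq ht c hy.1, h.areaDensity_eq ht d (chartTrans_mem c d hy).1,
    IsLocalFamily.parJac_zero_eq, IsLocalFamily.parJac_zero_eq, h.dS_loc_trans_X ht c d hy,
    jac_comp, abs_mul, coe_transEquiv]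
  have e : loc c ν (y, t) = loc d ν (chartTrans n c d y, t) := by
    simp only [loc, symm_chartTrans c d hy]
  rw [e]

end IsSmoothFamily

end Density

/-! ### Integration over the hypersurface by a partition of unity -/

section SurfaceIntegral

open MeasureTheory

variable {n : ℕ} {M : Type*} [TopologicalSpace M] [ChartedSpace (EuclideanSpace ℝ (Fin n)) M]
  [IsManifold (𝓡 n) ∞ M] [CompactSpace M] [T2Space M]

/-- The integral of a function over the domain of the chart around `c`. -/
def chartIntegral (X : M → Amb n) (c : M) (f : M → ℝ) : ℝ :=
  ∫ y in (chartAt (Par n) c).target, f ((chartAt (Par n) c).symm y) * areaDensity X c y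

theorem exists_finset_chartPartition (n : ℕ) (M : Type*) [TopologicalSpace M]
    [ChartedSpace (EuclideanSpace ℝ (Fin n)) M]
    [IsManifold (𝓡 n) ∞ M] [CompactSpace M] [T2Space M] :
    ∃ S : Finset M, ∀ c ∉ S, ∀ x, chartPartition n M c x = 0 := by
  have hfin := (chartPartition n M).locallyFinite.finite_nonempty_of_compact
  refine ⟨hfin.toFinset, fun c hc x => ?_⟩
  by_contra hne
  exact hc (hfin.mem_toFinset.2 ⟨x, hne⟩)

/-- The finitely many charts used by the partition of unity. -/
def chartFinset (n : ℕ) (M : Type*) [TopologicalSpace M]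
    [ChartedSpace (EuclideanSpace ℝ (Fin n)) M]
    [IsManifold (𝓡 n) ∞ M] [CompactSpace M] [T2Space M] : Finset M :=
  (exists_finset_chartPartition n M).choose

theorem chartPartition_eq_zero {c : M} (hc : c ∉ chartFinset n M) (x : M) :
    chartPartition n M c x = 0 := (exists_finset_chartPartition n M).choose_spec c hc x

theorem sum_chartPartition (x : M) : ∑ c ∈ chartFinset n M, chartPartition n M c x = 1 := by
  rw [← (chartPartition n M).sum_eq_one (mem_univ x)]
  refine (finsum_eq_sum_of_support_subset _ fun c hc => ?_).symm
  by_contra hn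
  exact hc (chartPartition_eq_zero hn x)

theorem surfaceIntegral_eq_sum (X : M → Amb n) (f : M → ℝ) :
    surfaceIntegral X f = ∑ c ∈ chartFinset n M,
      chartIntegral X c fun x => chartPartition n M c x * f x := by
  rw [surfaceIntegral]
  refine finsum_eq_sum_of_support_subset _ fun c hc => ?_
  by_contra hn
  refine hc ?_
  simp [chartPartition_eq_zero hn]

/-- The support of a function of the partition of unity, in the chart. -/
def chartSupport (n : ℕ) {M : Type*} [TopologicalSpace M]
    [ChartedSpace (EuclideanSpace ℝ (Fin n)) M]
    [IsManifold (𝓡 n) ∞ M] [CompactSpace M] [T2Space M] (c : M) : Set (Par n) :=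
  chartAt (Par n) c '' tsupport (chartPartition n M c)

theorem tsupport_subset (c : M) : tsupport (chartPartition n M c) ⊆ (chartAt (Par n) c).source :=
  chartPartition_isSubordinate c

theorem isCompact_chartSupport (c : M) : IsCompact (chartSupport n c) :=
  (isClosed_tsupport _).isCompact.image_of_continuousOn
    ((chartAt (Par n) c).continuousOn.mono (tsupport_subset c))

theorem chartSupport_subset (c : M) : chartSupport n c ⊆ (chartAt (Par n) c).target := by
  rintro _ ⟨x, hx, rfl⟩
  exact (chartAt (Par n) c).map_source (tsupport_subset c hx)

theorem symm_notMem_tsupport (c : M) {y : Par n} (hy : y ∈ (chartAt (Par n) c).target)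
    (hK : y ∉ chartSupport n c) :
    (chartAt (Par n) c).symm y ∉ tsupport (chartPartition n M c) := fun h =>
  hK ⟨_, h, (chartAt (Par n) c).right_inv hy⟩

theorem contDiffOn_chartPartition (c d : M) :
    ContDiffOn ℝ ∞ (chartPartition n M c ∘ (chartAt (Par n) d).symm) (chartAt (Par n) d).target :=
  contDiffOn_comp_chart (chartPartition n M c).contMDiff d

variable {Tmax : EReal} {X ν : ℝ → M → Amb n}

namespace IsSmoothFamily

set_option linter.unusedSectionVars false in
/-- Integrals of functions supported in two charts may be computed in either of them. -/
theorem chartIntegral_eq (h : IsSmoothFamily Tmax X ν) {t : ℝ}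
    (ht : t ∈ timeInterval Tmax) (c d : M) {f : M → ℝ}
    (hc : ∀ x, x ∉ (chartAt (Par n) c).source → f x = 0)
    (hd : ∀ x, x ∉ (chartAt (Par n) d).source → f x = 0) :
    chartIntegral (X t) c f = chartIntegral (X t) d f := by
  have red : ∀ a b : M, (∀ x, x ∉ (chartAt (Par n) b).source → f x = 0) →
      chartIntegral (X t) a f = ∫ y in transDom n a b,
        f ((chartAt (Par n) a).symm y) * areaDensity (X t) a y := fun a b hb =>
    setIntegral_eq_of_subset_of_forall_sdiff_eq_zero (chartAt (Par n) a).open_target.measurableSet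
      inter_subset_left fun y hy => by
        rw [hb _ fun hs => hy.2 ⟨hy.1, hs⟩, zero_mul]
  have himg : chartTrans n c d '' transDom n c d = transDom n d c := by
    refine Subset.antisymm ?_ fun z hz => ⟨chartTrans n d c z, chartTrans_mem d c hz,
      chartTrans_chartTrans d c hz⟩
    rintro _ ⟨y, hy, rfl⟩
    exact chartTrans_mem c d hy
  have hinj : InjOn (chartTrans n c d) (transDom n c d) := fun y hy z hz hyz => by
    rw [← chartTrans_chartTrans c d hy, hyz, chartTrans_chartTrans c d hz]
  rw [red c d hd, red d c hc, ← himg,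
    integral_image_eq_integral_abs_det_fderiv_smul volume (isOpen_transDom c d).measurableSet
      (fun y hy => (hasFDerivAt_chartTrans c d hy).hasFDerivWithinAt) hinj]
  refine setIntegral_congr_fun (isOpen_transDom c d).measurableSet fun y hy => ?_
  simp only [symm_chartTrans c d hy, h.areaDensity_trans ht c d hy, smul_eq_mul]
  ring

theorem integrableOn_chart (h : IsSmoothFamily Tmax X ν) {t : ℝ}
    (ht : t ∈ timeInterval Tmax) (c : M) {f : M → ℝ}
    (hf : ContinuousOn (f ∘ (chartAt (Par n) c).symm) (chartAt (Par n) c).target)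
    (hz : ∀ x, x ∉ tsupport (chartPartition n M c) → f x = 0) :
    IntegrableOn (fun y => f ((chartAt (Par n) c).symm y) * areaDensity (X t) c y)
      (chartAt (Par n) c).target :=
  integrableOn_of_zero_off (chartAt (Par n) c).open_target (isCompact_chartSupport c)
    (chartSupport_subset c) (hf.mul (h.continuousOn_areaDensity ht c)) fun y hy hyK => by
      rw [hz _ (symm_notMem_tsupport c hy hyK), zero_mul]

theorem chartIntegral_sum (h : IsSmoothFamily Tmax X ν) {t : ℝ}
    (ht : t ∈ timeInterval Tmax) (c : M) {ι : Type*} (S : Finset ι) {f : ι → M → ℝ}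
    (hf : ∀ i ∈ S, ContinuousOn (f i ∘ (chartAt (Par n) c).symm) (chartAt (Par n) c).target)
    (hz : ∀ i ∈ S, ∀ x, x ∉ tsupport (chartPartition n M c) → f i x = 0) :
    chartIntegral (X t) c (fun x => ∑ i ∈ S, f i x) = ∑ i ∈ S, chartIntegral (X t) c (f i) := by
  simp only [chartIntegral, Finset.sum_mul]
  exact integral_finsetSum S fun i hi => h.integrableOn_chart ht c (hf i hi) (hz i hi)

/-- A family of functions subordinate to the charts whose sum vanishes has vanishing total
integral. -/
theorem sum_chartIntegral_eq_zero (h : IsSmoothFamily Tmax X ν) {t : ℝ}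
    (ht : t ∈ timeInterval Tmax) {Θ : M → M → ℝ}
    (hz : ∀ c x, x ∉ tsupport (chartPartition n M c) → Θ c x = 0)
    (hcont : ∀ c d, ContinuousOn (Θ c ∘ (chartAt (Par n) d).symm) (chartAt (Par n) d).target)
    (hsum : ∀ x, ∑ c ∈ chartFinset n M, Θ c x = 0) :
    ∑ c ∈ chartFinset n M, chartIntegral (X t) c (Θ c) = 0 := by
  have hρ := fun c d : M => (contDiffOn_chartPartition (n := n) c d).continuousOn
  -- Insert `∑ ρ_d = 1` and move each piece `ρ_d Θ_c`, supported in both charts, to the chart `d`;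
  -- there the sum over `c` can be taken under the integral.
  have h1 : ∀ c, chartIntegral (X t) c (Θ c) = ∑ d ∈ chartFinset n M,
      chartIntegral (X t) d fun x => chartPartition n M d x * Θ c x := by
    intro c
    have e : Θ c = fun x => ∑ d ∈ chartFinset n M, chartPartition n M d x * Θ c x := by
      ext x; rw [← Finset.sum_mul, sum_chartPartition, one_mul]
    conv_lhs => rw [e]
    rw [h.chartIntegral_sum ht c _ (f := fun d x => chartPartition n M d x * Θ c x)
      (fun d _ => (hρ d c).mul (hcont c c))
      fun d _ x hx => by rw [hz c x hx, mul_zero]]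
    refine Finset.sum_congr rfl fun d _ => h.chartIntegral_eq ht c d (fun x hx => ?_) fun x hx => ?_
    · rw [hz c x fun hx' => hx (tsupport_subset c hx'), mul_zero]
    · rw [image_eq_zero_of_notMem_tsupport fun hx' => hx (tsupport_subset d hx'), zero_mul]
  rw [Finset.sum_congr rfl fun c _ => h1 c, Finset.sum_comm]
  refine Finset.sum_eq_zero fun d _ => ?_
  rw [← h.chartIntegral_sum ht d _ (f := fun c x => chartPartition n M d x * Θ c x)
    (fun c _ => (hρ d d).mul (hcont c d)) fun c _ x hx => by
    rw [image_eq_zero_of_notMem_tsupport hx, zero_mul]]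
  have e : (fun x => ∑ c ∈ chartFinset n M, chartPartition n M d x * Θ c x) = fun _ => 0 := by
    ext x; rw [← Finset.mul_sum, hsum, mul_zero]
  rw [e]
  simp [chartIntegral]

theorem surfaceIntegral_nonneg (h : IsSmoothFamily Tmax X ν) {t : ℝ}
    (ht : t ∈ timeInterval Tmax) {f : M → ℝ} (hf : ∀ x, 0 ≤ f x) :
    0 ≤ surfaceIntegral (X t) f := by
  rw [surfaceIntegral_eq_sum]
  refine Finset.sum_nonneg fun c _ => setIntegral_nonneg
    (chartAt (Par n) c).open_target.measurableSet fun y hy => ?_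
  exact mul_nonneg (mul_nonneg ((chartPartition n M).nonneg c _) (hf _))
    (h.areaDensity_pos ht c hy).le

/-- Each chart integral is nonnegative, hence zero, so `ρ_c f = 0` by continuity and positivity of
the density; sum over `c`. -/
theorem eq_zero_of_surfaceIntegral_eq_zero (h : IsSmoothFamily Tmax X ν) {t : ℝ}
    (ht : t ∈ timeInterval Tmax) {f : M → ℝ} (hf : ∀ x, 0 ≤ f x)
    (hcont : ∀ c, ContinuousOn (f ∘ (chartAt (Par n) c).symm) (chartAt (Par n) c).target)
    (hint : surfaceIntegral (X t) f = 0) (x : M) : f x = 0 := by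
  rw [surfaceIntegral_eq_sum] at hint
  have hnn : ∀ c, ∀ y ∈ (chartAt (Par n) c).target, 0 ≤
      (chartPartition n M c ((chartAt (Par n) c).symm y) * f ((chartAt (Par n) c).symm y)) *
        areaDensity (X t) c y := fun c y hy =>
    mul_nonneg (mul_nonneg ((chartPartition n M).nonneg c _) (hf _)) (h.areaDensity_pos ht c hy).le
  have h1 := (Finset.sum_eq_zero_iff_of_nonneg fun c _ => setIntegral_nonneg
    (chartAt (Par n) c).open_target.measurableSet (hnn c)).1 hint
  have h2 : ∀ c ∈ chartFinset n M, chartPartition n M c x * f x = 0 := by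
    intro c hc
    by_cases hx : x ∈ (chartAt (Par n) c).source
    · have hco : ContinuousOn (((fun x => chartPartition n M c x * f x)) ∘
          (chartAt (Par n) c).symm) (chartAt (Par n) c).target :=
        (contDiffOn_chartPartition (n := n) c c).continuousOn.mul (hcont c)
      have h3 := eq_zero_of_integral_eq_zero (chartAt (Par n) c).open_target
        (hco.mul (h.continuousOn_areaDensity ht c))
        (h.integrableOn_chart ht c hco fun z hz => by
          rw [image_eq_zero_of_notMem_tsupport hz, zero_mul]) (hnn c) (h1 c hc)
        (chartAt (Par n) c x) ((chartAt (Par n) c).map_source hx)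
      have h4 : chartPartition n M c ((chartAt (Par n) c).symm (chartAt (Par n) c x)) *
          f ((chartAt (Par n) c).symm (chartAt (Par n) c x)) *
            areaDensity (X t) c (chartAt (Par n) c x) = 0 := h3
      rw [(chartAt (Par n) c).left_inv hx] at h4
      exact (mul_eq_zero.1 h4).resolve_right
        (h.areaDensity_pos ht c ((chartAt (Par n) c).map_source hx)).ne'
    · rw [image_eq_zero_of_notMem_tsupport fun hx' => hx (tsupport_subset c hx'), zero_mul]
  have h3 := Finset.sum_eq_zero h2
  rwa [← Finset.sum_mul, sum_chartPartition, one_mul] at h3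

end IsSmoothFamily

end SurfaceIntegral

/-! ### Coordinate invariance of the transport terms -/

section Invariance

variable {n : ℕ}

theorem transportPairing_comp (A B : Par n →L[ℝ] Amb n) (ν w₀ w₁ : Amb n) (u ι : ℝ) (l : ℕ)
    (η : Par n →L[ℝ] ℝ) (L : Par n ≃L[ℝ] Par n) :
    IsLocalFamily.transportPairing (A ∘L (L : Par n →L[ℝ] Par n)) (B ∘L (L : Par n →L[ℝ] Par n)) ν w₀ w₁ u ι l
      (η ∘L (L : Par n →L[ℝ] Par n)) = IsLocalFamily.transportPairing A B ν w₀ w₁ u ι l η := by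
  simp only [IsLocalFamily.transportPairing, fluxCoef_comp _ _ _ _ _ _ _ _ (det_ne_zero_of_equiv L)]

theorem transportPairing_sum {σ : Type*} (S : Finset σ) (A B : Par n →L[ℝ] Amb n)
    (ν w₀ w₁ : Amb n) (u ι : ℝ) (l : ℕ) (η : σ → Par n →L[ℝ] ℝ) :
    ∑ i ∈ S, IsLocalFamily.transportPairing A B ν w₀ w₁ u ι l (η i) =
      IsLocalFamily.transportPairing A B ν w₀ w₁ u ι l (∑ i ∈ S, η i) := by
  simp only [IsLocalFamily.transportPairing, fluxCoef_sum, Finset.sum_add_distrib, ← Finset.mul_sum,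
    ← Finset.sum_div]

theorem transportPairing_zero (A B : Par n →L[ℝ] Amb n)
    (ν w₀ w₁ : Amb n) (u ι : ℝ) (l : ℕ) : IsLocalFamily.transportPairing A B ν w₀ w₁ u ι l 0 = 0 := by
  simpa using (transportPairing_sum (∅ : Finset ℕ) A B ν w₀ w₁ u ι l fun _ => 0).symm

theorem transportSource_comp {A B : Par n →L[ℝ] Amb n} {ν : Amb n} (h : IsHypersurfacePoint A B ν)
    (w₀ w₁ : Amb n) (u ι F : ℝ) (l : ℕ) (η : Par n →L[ℝ] ℝ) (L : Par n ≃L[ℝ] Par n) :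
    IsLocalFamily.transportSource (A ∘L (L : Par n →L[ℝ] Par n)) (B ∘L (L : Par n →L[ℝ] Par n)) ν w₀ w₁ u ι F l
      (η ∘L (L : Par n →L[ℝ] Par n)) = IsLocalFamily.transportSource A B ν w₀ w₁ u ι F l η := by
  simp only [IsLocalFamily.transportSource, fluxCoef_comp _ _ _ _ _ _ _ _ (det_ne_zero_of_equiv L),
    curvatureRoots_comp h]

end Invariance

/-! ### The time derivative of `T_{ι,l}` -/

section Evolution

variable {n : ℕ} {M : Type*} [TopologicalSpace M] [ChartedSpace (EuclideanSpace ℝ (Fin n)) M]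

/-- The derivative at `x` in the preferred chart at `x`. -/
def chartDeriv {G : Type*} [NormedAddCommGroup G] [NormedSpace ℝ G] (f : M → G) (x : M) :
    Par n →L[ℝ] G := fderiv ℝ (f ∘ (chartAt (Par n) x).symm) (chartAt (Par n) x x)

/-- The normal speed of the cone-like motion `∂ₜX + X`. -/
def normalSpeed (X ν : ℝ → M → Amb n) (t : ℝ) (x : M) : ℝ :=
  inner ℝ (deriv (fun s => X s x) t + X t x) (ν t x)

/-- The transport pairing with the differential of `ρ`. -/
def pairingAt (X ν : ℝ → M → Amb n) (ι : ℝ) (l : ℕ) (t : ℝ) (ρ : M → ℝ) (x : M) : ℝ :=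
  IsLocalFamily.transportPairing (chartDeriv (X t) x) (chartDeriv (ν t) x) (ν t x)
    (deriv (fun s => X s x) t + X t x) (deriv (fun s => ν s x) t) (p l (X t) (ν t) x) ι l
    (chartDeriv ρ x)

/-- The source term in the evolution of `p_l^ι dμ`. -/
def sourceAt (X ν : ℝ → M → Amb n) (ι : ℝ) (l : ℕ) (t : ℝ) (x : M) : ℝ :=
  IsLocalFamily.transportSource (chartDeriv (X t) x) (chartDeriv (ν t) x) (ν t x)
    (deriv (fun s => X s x) t + X t x) (deriv (fun s => ν s x) t) (p l (X t) (ν t) x) ι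
    (normalSpeed X ν t x) l (chartDeriv (p l (X t) (ν t)) x)

variable [IsManifold (𝓡 n) ∞ M] {Tmax : EReal} {X ν : ℝ → M → Amb n}

theorem fderiv_eq_chartDeriv {G : Type*} [NormedAddCommGroup G] [NormedSpace ℝ G] {f : M → G}
    (hf : ∀ c, ContDiffOn ℝ ∞ (f ∘ (chartAt (Par n) c).symm) (chartAt (Par n) c).target)
    (c : M) {y : Par n} (hy : y ∈ (chartAt (Par n) c).target) :
    fderiv ℝ (f ∘ (chartAt (Par n) c).symm) y = chartDeriv f ((chartAt (Par n) c).symm y) ∘L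
      (transEquiv c _ (mem_transDom_self c hy) : Par n →L[ℝ] Par n) :=
  (fderiv_comp_chart c _ (mem_transDom_self c hy) (((hf _).contDiffAt
    ((chartAt (Par n) _).open_target.mem_nhds (mem_chart_target _ _))).differentiableAt
      (by simp))).fderiv

namespace IsSmoothFamily

theorem isHypersurfacePoint_chartDeriv (h : IsSmoothFamily Tmax X ν) {t : ℝ}
    (ht : t ∈ timeInterval Tmax) (x : M) :
    IsHypersurfacePoint (chartDeriv (X t) x) (chartDeriv (ν t) x) (ν t x) := by
  have h1 := h.isHypersurfacePoint ht x (mem_chart_target (Par n) x)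
  have e : loc x ν (chartAt (Par n) x x, t) = ν t x := by
    simp [loc]
  rw [e] at h1
  exact h1

theorem principalCurvatures_eq' (h : IsSmoothFamily Tmax X ν) {t : ℝ}
    (ht : t ∈ timeInterval Tmax) (x : M) : principalCurvatures (X t) (ν t) x =
      curvatureRoots (chartDeriv (X t) x) (chartDeriv (ν t) x) := h.principalCurvatures_eq ht x

theorem pairingAt_eq (h : IsSmoothFamily Tmax X ν) (ι : ℝ) (l : ℕ) {t : ℝ}
    (ht : t ∈ timeInterval Tmax) {ρ : M → ℝ} (hρ : ContMDiff (𝓡 n) 𝓘(ℝ, ℝ) ∞ ρ) (c : M) {y : Par n}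
    (hy : y ∈ (chartAt (Par n) c).target) :
    IsLocalFamily.transportPairing (dS (loc c X) (y, t)) (dS (loc c ν) (y, t)) (loc c ν (y, t))
      (dT (loc c X) (y, t) + loc c X (y, t)) (dT (loc c ν) (y, t))
      (IsLocalFamily.normCurv (loc c X) (loc c ν) l (y, t)) ι l
      (fderiv ℝ (ρ ∘ (chartAt (Par n) c).symm) y) =
      pairingAt X ν ι l t ρ ((chartAt (Par n) c).symm y) := by
  have e1 := fderiv_eq_chartDeriv (contDiffOn_comp_chart (h.contMDiff_X ht)) c hy
  have e2 := fderiv_eq_chartDeriv (contDiffOn_comp_chart (h.contMDiff_ν ht)) c hy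
  have e3 := fderiv_eq_chartDeriv (contDiffOn_comp_chart hρ) c hy
  have e1' : dS (loc c X) (y, t) = _ := e1
  have e2' : dS (loc c ν) (y, t) = _ := e2
  rw [h.normCurv_loc ht c hy, e1', e2', e3, transportPairing_comp]
  rfl

theorem sourceAt_eq (h : IsSmoothFamily Tmax X ν) (ι : ℝ) {l : ℕ} (hl : l ≤ n) {t : ℝ}
    (ht : t ∈ timeInterval Tmax) (c : M) {y : Par n} (hy : y ∈ (chartAt (Par n) c).target) :
    IsLocalFamily.transportSource (dS (loc c X) (y, t)) (dS (loc c ν) (y, t)) (loc c ν (y, t))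
      (dT (loc c X) (y, t) + loc c X (y, t)) (dT (loc c ν) (y, t))
      (IsLocalFamily.normCurv (loc c X) (loc c ν) l (y, t)) ι
      (inner ℝ (dT (loc c X) (y, t) + loc c X (y, t)) (loc c ν (y, t))) l
      (dS (IsLocalFamily.normCurv (loc c X) (loc c ν) l) (y, t)) =
      sourceAt X ν ι l t ((chartAt (Par n) c).symm y) := by
  have e1 := fderiv_eq_chartDeriv (contDiffOn_comp_chart (h.contMDiff_X ht)) c hy
  have e2 := fderiv_eq_chartDeriv (contDiffOn_comp_chart (h.contMDiff_ν ht)) c hy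
  have e3 := fderiv_eq_chartDeriv (fun c => h.contDiffOn_p ht c hl) c hy
  have e1' : dS (loc c X) (y, t) = _ := e1
  have e2' : dS (loc c ν) (y, t) = _ := e2
  have e3' : dS (IsLocalFamily.normCurv (loc c X) (loc c ν) l) (y, t) =
      fderiv ℝ (p l (X t) (ν t) ∘ (chartAt (Par n) c).symm) y :=
    Filter.EventuallyEq.fderiv_eq (Filter.eventuallyEq_of_mem
      ((chartAt (Par n) c).open_target.mem_nhds hy) fun z hz => h.normCurv_loc ht c hz l)
  rw [h.normCurv_loc ht c hy, e3', e3, e1', e2']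
  exact transportSource_comp (h.isHypersurfacePoint_chartDeriv ht _) _ _ _ _ _ _ _ _

theorem normCurv_pos (h : IsSmoothFamily Tmax X ν) {l : ℕ}
    (hpos : ∀ t ∈ timeInterval Tmax, ∀ x, 0 < p l (X t) (ν t) x) (c : M) :
    ∀ q ∈ (chartAt (Par n) c).target ×ˢ openTime Tmax,
      0 < IsLocalFamily.normCurv (loc c X) (loc c ν) l q := by
  rintro ⟨y, t⟩ ⟨hy, ht⟩
  rw [h.normCurv_loc (openTime_subset ht) c hy]
  exact hpos t (openTime_subset ht) _

theorem sum_transportField_loc (h : IsSmoothFamily Tmax X ν) (ι : ℝ) (l : ℕ)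
    {t : ℝ} (ht : t ∈ openTime Tmax) {ρ : M → ℝ}
    (hρ : ContMDiff (𝓡 n) 𝓘(ℝ, ℝ) ∞ ρ) (c : M) {y : Par n} (hy : y ∈ (chartAt (Par n) c).target) :
    ∑ i, fderiv ℝ (ρ ∘ (chartAt (Par n) c).symm) y (stdDir i) *
        IsLocalFamily.transportField (loc c X) (loc c ν) ι l (y, t) i =
      areaDensity (X t) c y * pairingAt X ν ι l t ρ ((chartAt (Par n) c).symm y) := by
  rw [(h.isLocalFamily c).sum_transportField (q := (y, t)) ⟨hy, ht⟩,
    h.areaDensity_eq (openTime_subset ht) c hy, ← h.pairingAt_eq ι l (openTime_subset ht) hρ c hy]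

theorem dT_density_loc (h : IsSmoothFamily Tmax X ν) (ι : ℝ) {l : ℕ} (hl : l ≤ n)
    (hpos : ∀ t ∈ timeInterval Tmax, ∀ x, 0 < p l (X t) (ν t) x)
    {t : ℝ} (ht : t ∈ openTime Tmax) (c : M) {y : Par n} (hy : y ∈ (chartAt (Par n) c).target) :
    dT (fun x => |parJac (loc c X) (loc c ν) 0 x| *
        IsLocalFamily.normCurv (loc c X) (loc c ν) l x ^ ι) (y, t) =
      ∑ i, dS (fun x => IsLocalFamily.transportField (loc c X) (loc c ν) ι l x i) (y, t)
        (stdDir i) + areaDensity (X t) c y * sourceAt X ν ι l t ((chartAt (Par n) c).symm y) := by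
  rw [(h.isLocalFamily c).dT_density ι hl (h.normCurv_pos hpos c) (q := (y, t)) ⟨hy, ht⟩,
    h.areaDensity_eq (openTime_subset ht) c hy, ← h.sourceAt_eq ι hl (openTime_subset ht) c hy]

theorem contDiffOn_slice {f : Par n × ℝ → ℝ} {U : Set (Par n)} {J : Set ℝ}
    (hf : ContDiffOn ℝ ∞ f (U ×ˢ J)) {t : ℝ} (ht : t ∈ J) :
    ContDiffOn ℝ ∞ (fun y => f (y, t)) U :=
  hf.comp (contDiffOn_id.prodMk contDiffOn_const) fun _ hy => ⟨hy, ht⟩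

theorem contDiffOn_density (h : IsSmoothFamily Tmax X ν) (ι : ℝ) {l : ℕ} (hl : l ≤ n)
    (hpos : ∀ t ∈ timeInterval Tmax, ∀ x, 0 < p l (X t) (ν t) x) (c : M) :
    ContDiffOn ℝ ∞ (fun x => |parJac (loc c X) (loc c ν) 0 x| *
        IsLocalFamily.normCurv (loc c X) (loc c ν) l x ^ ι)
      ((chartAt (Par n) c).target ×ˢ openTime Tmax) := by
  have hF := h.isLocalFamily c
  exact ((contDiffOn_parJac hF.isOpen hF.smooth_X hF.smooth_ν 0).abs
    fun q hq => hF.parJac_zero_ne_zero hq).mul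
    ((hF.contDiffOn_normCurv hl).rpow_const_of_ne fun q hq => (h.normCurv_pos hpos c q hq).ne')

/-- The definition uses the preferred chart at each point, which may jump; continuity is visible
only from the expression in one fixed chart. -/
theorem continuousOn_pairingAt (h : IsSmoothFamily Tmax X ν) (ι : ℝ) {l : ℕ} (hl : l ≤ n)
    (hpos : ∀ t ∈ timeInterval Tmax, ∀ x, 0 < p l (X t) (ν t) x)
    {t : ℝ} (ht : t ∈ openTime Tmax) {ρ : M → ℝ} (hρ : ContMDiff (𝓡 n) 𝓘(ℝ, ℝ) ∞ ρ) (c : M) :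
    ContinuousOn (pairingAt X ν ι l t ρ ∘ (chartAt (Par n) c).symm) (chartAt (Par n) c).target := by
  have hF := h.isLocalFamily c
  have hU := (chartAt (Par n) c).open_target
  have h1 : ContinuousOn (fun y => (∑ i, fderiv ℝ (ρ ∘ (chartAt (Par n) c).symm) y (stdDir i) *
        IsLocalFamily.transportField (loc c X) (loc c ν) ι l (y, t) i) / areaDensity (X t) c y)
      (chartAt (Par n) c).target := by
    refine ContinuousOn.div (continuousOn_finsetSum _ fun i _ => ?_)
      (h.continuousOn_areaDensity (openTime_subset ht) c)
      fun y hy => (h.areaDensity_pos (openTime_subset ht) c hy).ne'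
    exact ((((contDiffOn_comp_chart hρ c).continuousOn_fderiv_of_isOpen hU (by simp))).clm_apply
      continuousOn_const).mul (contDiffOn_slice
        (hF.contDiffOn_transportField ι hl (h.normCurv_pos hpos c) i) ht).continuousOn
  refine h1.congr fun y hy => ?_
  beta_reduce
  rw [h.sum_transportField_loc ι l ht hρ c hy, mul_div_cancel_left₀ _
    (h.areaDensity_pos (openTime_subset ht) c hy).ne']
  rfl

/-- The evolution equation itself is solved for the source: time derivative minus divergence,
divided by the density, is continuous in a fixed chart. -/
theorem continuousOn_sourceAt (h : IsSmoothFamily Tmax X ν) (ι : ℝ) {l : ℕ} (hl : l ≤ n)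
    (hpos : ∀ t ∈ timeInterval Tmax, ∀ x, 0 < p l (X t) (ν t) x)
    {t : ℝ} (ht : t ∈ openTime Tmax) (c : M) :
    ContinuousOn (sourceAt X ν ι l t ∘ (chartAt (Par n) c).symm) (chartAt (Par n) c).target := by
  have hF := h.isLocalFamily c
  have hdiv : ∀ i, ContDiffOn ℝ ∞ (fun q => dS (fun x =>
      IsLocalFamily.transportField (loc c X) (loc c ν) ι l x i) q (stdDir i))
      ((chartAt (Par n) c).target ×ˢ openTime Tmax) := fun i =>
    contDiffOn_dS hF.isOpen (hF.contDiffOn_transportField ι hl (h.normCurv_pos hpos c) i) _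
  have h1 : ContinuousOn (fun y => (dT (fun x => |parJac (loc c X) (loc c ν) 0 x| *
        IsLocalFamily.normCurv (loc c X) (loc c ν) l x ^ ι) (y, t) -
      ∑ i, dS (fun x => IsLocalFamily.transportField (loc c X) (loc c ν) ι l x i) (y, t)
        (stdDir i)) / areaDensity (X t) c y) (chartAt (Par n) c).target := by
    refine ContinuousOn.div (ContinuousOn.sub ?_ (continuousOn_finsetSum _ fun i _ => ?_))
      (h.continuousOn_areaDensity (openTime_subset ht) c)
      fun y hy => (h.areaDensity_pos (openTime_subset ht) c hy).ne'
    · exact (contDiffOn_slice (contDiffOn_dT hF.isOpen (h.contDiffOn_density ι hl hpos c))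
        ht).continuousOn
    · exact (contDiffOn_slice (hdiv i) ht).continuousOn
  refine h1.congr fun y hy => ?_
  beta_reduce
  rw [h.dT_density_loc ι hl hpos ht c hy, add_sub_cancel_left, mul_div_cancel_left₀ _
    (h.areaDensity_pos (openTime_subset ht) c hy).ne']
  rfl

section Global

variable [CompactSpace M] [T2Space M]

set_option linter.unusedSectionVars false in
theorem chartDeriv_eq_zero {ρ : M → ℝ} {x : M} (hx : x ∉ tsupport ρ) : chartDeriv (n := n) ρ x = 0 := by
  have h1 : ρ =ᶠ[nhds x] fun _ => 0 := notMem_tsupport_iff_eventuallyEq.1 hx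
  have h2 : Filter.Tendsto (chartAt (Par n) x).symm (nhds (chartAt (Par n) x x)) (nhds x) := by
    have := (chartAt (Par n) x).continuousAt_symm (mem_chart_target (Par n) x)
    rwa [ContinuousAt, (chartAt (Par n) x).left_inv (mem_chart_source _ x)] at this
  have h3 : (ρ ∘ (chartAt (Par n) x).symm) =ᶠ[nhds (chartAt (Par n) x x)] fun _ => (0 : ℝ) :=
    h2.eventually h1
  rw [chartDeriv, h3.fderiv_eq]
  simp

/-- The pairing is additive in the covector, and `∑ dρ_c = d 1 = 0`. This is how the divergence
theorem on a closed manifold enters. -/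
theorem sum_pairingAt (X ν : ℝ → M → Amb n) (ι : ℝ) (l : ℕ) (t : ℝ) (x : M) :
    ∑ c ∈ chartFinset n M, pairingAt X ν ι l t (chartPartition n M c) x = 0 := by
  simp only [pairingAt]
  rw [transportPairing_sum]
  have e : ∑ c ∈ chartFinset n M, chartDeriv (n := n) (chartPartition n M c) x = 0 := by
    have h1 : ∀ c ∈ chartFinset n M, DifferentiableAt ℝ
        (fun y => (chartPartition n M c ∘ (chartAt (Par n) x).symm) y) (chartAt (Par n) x x) :=
      fun c _ => differentiableAt_comp_chart (chartPartition n M c).contMDiff x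
        (mem_chart_target _ x)
    have h2 := fderiv_fun_sum h1
    have h3 : (fun y => ∑ c ∈ chartFinset n M,
        (chartPartition n M c ∘ (chartAt (Par n) x).symm) y) = fun _ => (1 : ℝ) := by
      ext y; exact sum_chartPartition _
    rw [h3] at h2
    simpa [chartDeriv] using! h2.symm
  rw [e, transportPairing_zero]

theorem sum_chartIntegral_pairingAt (h : IsSmoothFamily Tmax X ν) (ι : ℝ) {l : ℕ} (hl : l ≤ n)
    (hpos : ∀ t ∈ timeInterval Tmax, ∀ x, 0 < p l (X t) (ν t) x)
    {t : ℝ} (ht : t ∈ openTime Tmax) :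
    ∑ c ∈ chartFinset n M,
      chartIntegral (X t) c (pairingAt X ν ι l t (chartPartition n M c)) = 0 := by
  refine h.sum_chartIntegral_eq_zero (openTime_subset ht)
    (Θ := fun c => pairingAt X ν ι l t (chartPartition n M c)) (fun c x hx => ?_)
    (fun c d => h.continuousOn_pairingAt ι hl hpos ht (chartPartition n M c).contMDiff d)
    (sum_pairingAt X ν ι l t)
  simp only [pairingAt, chartDeriv_eq_zero hx, transportPairing_zero]

/-- The divergence term integrates to minus the pairing with the differential of the cut-off. -/
theorem integral_divergence (h : IsSmoothFamily Tmax X ν) (ι : ℝ) {l : ℕ} (hl : l ≤ n)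
    (hpos : ∀ t ∈ timeInterval Tmax, ∀ x, 0 < p l (X t) (ν t) x)
    {t : ℝ} (ht : t ∈ openTime Tmax) (c : M) :
    ∫ y in (chartAt (Par n) c).target, chartPartition n M c ((chartAt (Par n) c).symm y) *
      ∑ i, dS (fun x => IsLocalFamily.transportField (loc c X) (loc c ν) ι l x i) (y, t)
        (stdDir i) = - chartIntegral (X t) c (pairingAt X ν ι l t (chartPartition n M c)) := by
  have hF := h.isLocalFamily c
  have hU := (chartAt (Par n) c).open_target
  have hρ := contDiffOn_chartPartition (n := n) c c
  have hζ := fun i => contDiffOn_slice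
    (hF.contDiffOn_transportField ι hl (h.normCurv_pos hpos c) i) ht
  set ρ := chartPartition n M c ∘ (chartAt (Par n) c).symm with hρdef
  set ζ : Fin n → Par n → ℝ := fun i y =>
    IsLocalFamily.transportField (loc c X) (loc c ν) ι l (y, t) i with hζdef
  have hz : ∀ y ∈ (chartAt (Par n) c).target, y ∉ chartSupport n c → ρ y = 0 := fun y hy hyK =>
    image_eq_zero_of_notMem_tsupport (f := chartPartition n M c) (symm_notMem_tsupport c hy hyK)
  have hprod : ∀ i, ContDiffOn ℝ ∞ (fun y => ρ y * ζ i y) (chartAt (Par n) c).target :=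
    fun i => hρ.mul (hζ i)
  -- The integral of `∂ᵢ(ρ ζᵢ)` vanishes, so `∫ ρ div ζ = -∫ dρ(ζ)`, whose integrand is density
  -- times pairing.
  have hzero : ∀ i, ∫ y in (chartAt (Par n) c).target,
      fderiv ℝ (fun y => ρ y * ζ i y) y (stdDir i) = 0 := fun i =>
    integral_fderiv_eq_zero_of_zero_off hU (isCompact_chartSupport c) (chartSupport_subset c)
      (hprod i) (fun y hy hyK => by rw [hz y hy hyK, zero_mul]) _
  have hderiv : ∀ i, ∀ y ∈ (chartAt (Par n) c).target,
      fderiv ℝ (fun y => ρ y * ζ i y) y (stdDir i) =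
        fderiv ℝ ρ y (stdDir i) * ζ i y + ρ y * fderiv ℝ (ζ i) y (stdDir i) := by
    intro i y hy
    have d1 := (hρ.contDiffAt (hU.mem_nhds hy)).differentiableAt (by simp)
    have d2 := ((hζ i).contDiffAt (hU.mem_nhds hy)).differentiableAt (by simp)
    rw [fderiv_fun_mul d1 d2]
    simp only [add_apply, smul_apply, smul_eq_mul]
    ring
  have hint : ∀ i, MeasureTheory.IntegrableOn
      (fun y => fderiv ℝ (fun y => ρ y * ζ i y) y (stdDir i)) (chartAt (Par n) c).target := by
    intro i
    refine integrableOn_of_zero_off hU (isCompact_chartSupport c) (chartSupport_subset c)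
      (((hprod i).continuousOn_fderiv_of_isOpen hU (by simp)).clm_apply continuousOn_const)
      fun y hy hyK => ?_
    have hev : (fun y => ρ y * ζ i y) =ᶠ[nhds y] fun _ => 0 := by
      refine Filter.eventuallyEq_of_mem (Filter.inter_mem (hU.mem_nhds hy)
        ((isCompact_chartSupport c).isClosed.isOpen_compl.mem_nhds hyK)) fun z hz' => ?_
      simp only [hz z hz'.1 hz'.2, zero_mul]
    rw [hev.fderiv_eq]; simp
  have hsum : ∫ y in (chartAt (Par n) c).target,
      ∑ i, fderiv ℝ (fun y => ρ y * ζ i y) y (stdDir i) = 0 := by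
    rw [MeasureTheory.integral_finsetSum _ fun i _ => hint i]
    exact Finset.sum_eq_zero fun i _ => hzero i
  have hpair : ContinuousOn (pairingAt X ν ι l t (chartPartition n M c) ∘
      (chartAt (Par n) c).symm) (chartAt (Par n) c).target :=
    h.continuousOn_pairingAt ι hl hpos ht (chartPartition n M c).contMDiff c
  have hpint := h.integrableOn_chart (openTime_subset ht) c hpair fun x hx => by
    simp only [pairingAt, chartDeriv_eq_zero hx, transportPairing_zero]
  have hsint : MeasureTheory.IntegrableOn (fun y =>
      ∑ i, fderiv ℝ (fun y => ρ y * ζ i y) y (stdDir i)) (chartAt (Par n) c).target :=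
    MeasureTheory.integrable_finsetSum _ fun i _ => hint i
  have hfin := MeasureTheory.integral_sub hsint hpint
  rw [hsum, zero_sub] at hfin
  rw [chartIntegral, ← hfin]
  refine MeasureTheory.setIntegral_congr_fun hU.measurableSet fun y hy => ?_
  have e1 := h.sum_transportField_loc ι l ht (chartPartition n M c).contMDiff c hy
  have e2 : ∑ i, fderiv ℝ (fun y => ρ y * ζ i y) y (stdDir i) =
      ∑ i, fderiv ℝ ρ y (stdDir i) * ζ i y + ρ y * ∑ i, fderiv ℝ (ζ i) y (stdDir i) := by
    rw [Finset.mul_sum, ← Finset.sum_add_distrib]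
    exact Finset.sum_congr rfl fun i _ => hderiv i y hy
  rw [e2, mul_comm (pairingAt _ _ _ _ _ _ _), ← e1]
  simp only [hρdef, hζdef, Function.comp_apply, dS]
  ring

/-- The evolution of `T_{ι,l}` in the interior of the time interval. -/
theorem hasDerivAt_T (h : IsSmoothFamily Tmax X ν) (ι : ℝ) {l : ℕ} (hl : l ≤ n)
    (hpos : ∀ t ∈ timeInterval Tmax, ∀ x, 0 < p l (X t) (ν t) x)
    {t : ℝ} (ht : t ∈ openTime Tmax) :
    HasDerivAt (fun t => T ι l (X t) (ν t)) (surfaceIntegral (X t) (sourceAt X ν ι l t)) t := by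
  set dens : M → Par n × ℝ → ℝ := fun c x => |parJac (loc c X) (loc c ν) 0 x| *
    IsLocalFamily.normCurv (loc c X) (loc c ν) l x ^ ι with hdens
  have hρc : ∀ c : M, ContinuousOn (fun q : Par n × ℝ => chartPartition n M c
      ((chartAt (Par n) c).symm q.1)) ((chartAt (Par n) c).target ×ˢ openTime Tmax) := fun c =>
    (contDiffOn_chartPartition (n := n) c c).continuousOn.comp continuousOn_fst fun q hq => hq.1
  have hz : ∀ c : M, ∀ y ∈ (chartAt (Par n) c).target, y ∉ chartSupport n c →
      chartPartition n M c ((chartAt (Par n) c).symm y) = 0 := fun c y hy hyK =>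
    image_eq_zero_of_notMem_tsupport (f := chartPartition n M c) (symm_notMem_tsupport c hy hyK)
  have hO := fun c : M => (h.isLocalFamily c).isOpen
  have hder : ∀ c : M, HasDerivAt (fun t => ∫ y in (chartAt (Par n) c).target,
      chartPartition n M c ((chartAt (Par n) c).symm y) * dens c (y, t))
      (∫ y in (chartAt (Par n) c).target,
        chartPartition n M c ((chartAt (Par n) c).symm y) * dT (dens c) (y, t)) t := fun c =>
    hasDerivAt_integral_of_zero_off (chartAt (Par n) c).open_target (isCompact_chartSupport c)
      (chartSupport_subset c) (isOpen_openTime Tmax)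
      (h := fun q => chartPartition n M c ((chartAt (Par n) c).symm q.1) * dens c q)
      (h' := fun q => chartPartition n M c ((chartAt (Par n) c).symm q.1) * dT (dens c) q)
      ((hρc c).mul (h.contDiffOn_density ι hl hpos c).continuousOn)
      ((hρc c).mul (contDiffOn_dT (hO c) (h.contDiffOn_density ι hl hpos c)).continuousOn)
      (fun y hy s hs => by
        have hd := ((h.contDiffOn_density ι hl hpos c).contDiffAt
          ((hO c).mem_nhds (⟨hy, hs⟩ : (y, s) ∈ _ ×ˢ _))).differentiableAt (by simp)
        have hd2 : DifferentiableAt ℝ (fun s => dens c (y, s)) s :=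
          hd.comp s ((differentiableAt_const y).prodMk differentiableAt_id)
        exact hd2.hasDerivAt.const_mul (chartPartition n M c ((chartAt (Par n) c).symm y)))
      (fun s _ y hy hyK => by simp only [hz c y hy hyK, zero_mul])
      (fun s _ y hy hyK => by simp only [hz c y hy hyK, zero_mul]) ht
  have hT : (fun t => T ι l (X t) (ν t)) =ᶠ[nhds t] fun t => ∑ c ∈ chartFinset n M,
      ∫ y in (chartAt (Par n) c).target,
        chartPartition n M c ((chartAt (Par n) c).symm y) * dens c (y, t) := by
    refine Filter.eventuallyEq_of_mem ((isOpen_openTime Tmax).mem_nhds ht) fun s hs => ?_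
    simp only [T, surfaceIntegral_eq_sum, chartIntegral]
    refine Finset.sum_congr rfl fun c _ => MeasureTheory.setIntegral_congr_fun
      (chartAt (Par n) c).open_target.measurableSet fun y hy => ?_
    simp only [hdens]
    rw [h.normCurv_loc (openTime_subset hs) c hy, ← h.areaDensity_eq (openTime_subset hs) c hy]
    ring
  refine ((HasDerivAt.fun_sum fun c _ => hder c).congr_of_eventuallyEq hT).congr_deriv ?_
  rw [surfaceIntegral_eq_sum]
  -- In one chart the cut-off leaves the error `∫ dρ_c(ζ)`; these errors cancel only after summation
  -- over the charts.
  have hsplit : ∀ c : M, ∫ y in (chartAt (Par n) c).target,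
        chartPartition n M c ((chartAt (Par n) c).symm y) * dT (dens c) (y, t) =
      chartIntegral (X t) c (fun x => chartPartition n M c x * sourceAt X ν ι l t x) -
        chartIntegral (X t) c (pairingAt X ν ι l t (chartPartition n M c)) := by
    intro c
    rw [sub_eq_add_neg, ← h.integral_divergence ι hl hpos ht c, add_comm, chartIntegral,
      ← MeasureTheory.integral_add]
    · refine MeasureTheory.setIntegral_congr_fun
        (chartAt (Par n) c).open_target.measurableSet fun y hy => ?_
      simp only [hdens]
      rw [h.dT_density_loc ι hl hpos ht c hy]
      ring
    · refine integrableOn_of_zero_off (chartAt (Par n) c).open_target (isCompact_chartSupport c)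
        (chartSupport_subset c) ((contDiffOn_chartPartition (n := n) c c).continuousOn.mul
          (continuousOn_finsetSum _ fun i _ => ?_)) fun y hy hyK => by
            rw [hz c y hy hyK, zero_mul]
      exact (contDiffOn_slice (contDiffOn_dS (hO c) ((h.isLocalFamily c).contDiffOn_transportField ι
        hl (h.normCurv_pos hpos c) i) _) ht).continuousOn
    · refine h.integrableOn_chart (openTime_subset ht) c
        (f := fun x => chartPartition n M c x * sourceAt X ν ι l t x)
        ((contDiffOn_chartPartition (n := n) c c).continuousOn.mul
          (h.continuousOn_sourceAt ι hl hpos ht c)) fun x hx => by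
            rw [image_eq_zero_of_notMem_tsupport hx, zero_mul]
  rw [Finset.sum_congr rfl fun c _ => hsplit c, Finset.sum_sub_distrib,
    h.sum_chartIntegral_pairingAt ι hl hpos ht, sub_zero]

theorem continuousOn_T (h : IsSmoothFamily Tmax X ν) (hT : 0 < Tmax) (ι : ℝ) {l : ℕ} (hl : l ≤ n)
    (hpos : ∀ t ∈ timeInterval Tmax, ∀ x, 0 < p l (X t) (ν t) x) :
    ContinuousOn (fun t => T ι l (X t) (ν t)) (timeInterval Tmax) := by
  have h1 : ContinuousOn (fun t => ∑ c ∈ chartFinset n M, ∫ y in (chartAt (Par n) c).target,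
      chartPartition n M c ((chartAt (Par n) c).symm y) *
        (loc c (fun t => p l (X t) (ν t)) (y, t) ^ ι * |parJac (loc c X) (loc c ν) 0 (y, t)|))
      (timeInterval Tmax) := by
    refine continuousOn_finsetSum _ fun c _ => continuousOn_integral_of_zero_off
      (chartAt (Par n) c).open_target (isCompact_chartSupport c) (chartSupport_subset c)
      (h := fun q => chartPartition n M c ((chartAt (Par n) c).symm q.1) *
        (loc c (fun t => p l (X t) (ν t)) q ^ ι * |parJac (loc c X) (loc c ν) 0 q|)) ?_ ?_
    · exact ((contDiffOn_chartPartition (n := n) c c).continuousOn.comp continuousOn_fst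
        fun q hq => hq.1).mul (((h.continuousOn_p hT c hl).rpow_const fun q hq =>
          Or.inl (hpos q.2 hq.2 _).ne').mul (h.continuousOn_parJac hT c 0).abs)
    · intro s _ y hy hyK
      simp only [image_eq_zero_of_notMem_tsupport (symm_notMem_tsupport c hy hyK), zero_mul]
  refine h1.congr fun s hs => ?_
  simp only [T, surfaceIntegral_eq_sum, chartIntegral]
  refine Finset.sum_congr rfl fun c _ => MeasureTheory.setIntegral_congr_fun
    (chartAt (Par n) c).open_target.measurableSet fun y hy => ?_
  simp only [loc]
  rw [h.areaDensity_eq hs c hy]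
  ring

end Global

end IsSmoothFamily

end Evolution

/-! ### Preservation of `k`-convexity and the sign of the gradient term -/

section Signs

variable {n : ℕ} {M : Type*} [TopologicalSpace M] [ChartedSpace (EuclideanSpace ℝ (Fin n)) M]

/-- The properties shared by both flows: the normal component of `∂ₜX + X` is `p_k^{-1/k}`. -/
structure IsInverseFlow (k : ℕ) (Tmax : EReal) (X ν : ℝ → M → Amb n) : Prop
    extends IsSmoothFamily Tmax X ν where
  p_pos : ∀ t ∈ timeInterval Tmax, ∀ x, 0 < p k (X t) (ν t) x
  normalSpeed_eq : ∀ t ∈ openTime Tmax, ∀ x,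
    normalSpeed X ν t x = p k (X t) (ν t) x ^ (-(1 / (k : ℝ)))

variable {k : ℕ} {Tmax : EReal} {X ν : ℝ → M → Amb n}

theorem SolvesRescaledFlow.isInverseFlow (h : SolvesRescaledFlow k Tmax X ν) :
    IsInverseFlow k Tmax X ν where
  toIsSmoothFamily := h.toIsSmoothFamily
  p_pos := h.p_pos
  normalSpeed_eq t ht x := by
    have h1 := (h.evolution t (openTime_subset ht) x).hasDerivAt (mem_nhds_of_openTime ht)
    have h2 := (h.normal t (openTime_subset ht)).norm_eq_one x
    rw [normalSpeed, h1.deriv, sub_add_cancel, real_inner_smul_left, real_inner_self_eq_norm_sq, h2]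
    ring

theorem SolvesNormalFlow.isInverseFlow (h : SolvesNormalFlow k Tmax X ν) :
    IsInverseFlow k Tmax X ν where
  toIsSmoothFamily := h.toIsSmoothFamily
  p_pos := h.p_pos
  normalSpeed_eq t ht x := by
    have h1 := (h.evolution t (openTime_subset ht) x).hasDerivAt (mem_nhds_of_openTime ht)
    have h2 := (h.normal t (openTime_subset ht)).norm_eq_one x
    rw [normalSpeed, h1.deriv, inner_add_left, real_inner_smul_left, real_inner_self_eq_norm_sq, h2,
      support]
    ring

theorem esymm_replicate (n : ℕ) (a : ℝ) (l : ℕ) :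
    (Multiset.replicate n a).esymm l = n.choose l * a ^ l := by
  induction n generalizing l with
  | zero =>
    cases l with
    | zero => simp [esymm_zero']
    | succ l => rw [esymm_eq_zero_of_card_lt (by simp)]; simp
  | succ n ih =>
    cases l with
    | zero => simp [esymm_zero']
    | succ l =>
      rw [Multiset.replicate_succ, esymm_cons_succ, ih, ih, Nat.choose_succ_succ]
      push_cast
      ring

theorem sum_sq_eq (s : Multiset ℝ) :
    (s.map fun a => a ^ 2).sum = s.esymm 1 ^ 2 - 2 * s.esymm 2 := by
  induction s using Multiset.induction with
  | empty => rw [esymm_eq_zero_of_card_lt (by simp), esymm_eq_zero_of_card_lt (by simp)]; simp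
  | cons a s ih =>
    have h1 := esymm_cons_succ a s 0
    have h2 := esymm_cons_succ a s 1
    rw [esymm_zero'] at h1
    simp only [zero_add, Nat.reduceAdd] at h1 h2
    rw [Multiset.map_cons, Multiset.sum_cons, ih, h1, h2]
    ring

theorem fluxCoef_zero (A B : Par n →L[ℝ] Amb n) (ν w₀ w₁ : Amb n) (l : ℕ) :
    fluxCoef A B ν w₀ w₁ 0 l = 0 := by
  simpa using fluxCoef_sum (∅ : Finset ℕ) A B ν w₀ w₁ (fun _ => 0) l

/-- The quadratic gradient term, for a normal speed whose differential is a negative multiple of the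
differential of the curvature function. -/
theorem IsHypersurfacePoint.gradient_term (hn : 0 < n) {A B : Par n →L[ℝ] Amb n} {ν : Amb n}
    (h : IsHypersurfacePoint A B ν) {w₀ w₁ : Amb n} {η : Par n →L[ℝ] ℝ} {a : ℝ} (ha : 0 < a)
    (hw : ∀ v, inner ℝ w₁ (A v) = a * η v + inner ℝ (B v) w₀) {k : ℕ} (hk : 0 < k) (hkn : k ≤ n)
    (hκ : ∀ i, 1 ≤ i → i ≤ k → 0 < normEsymm (curvatureRoots A B) i) :
    0 ≤ fluxCoef A B ν w₀ w₁ η k / n.choose k -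
        normEsymm (curvatureRoots A B) k * fluxCoef A B ν w₀ w₁ η 0 ∧
      (fluxCoef A B ν w₀ w₁ η k / n.choose k -
        normEsymm (curvatureRoots A B) k * fluxCoef A B ν w₀ w₁ η 0 = 0 → η = 0) := by
  obtain ⟨L, κ, hF⟩ := h.exists_frame
  have hroots : curvatureRoots A B = Finset.univ.val.map κ := hF.roots_charpoly
  have hes := esymm_eq_choose_mul_normEsymm (curvatureRoots A B)
  rw [h.card_curvatureRoots] at hes
  have hpos : ∀ i, i ≤ k → 0 < (Finset.univ.val.map κ).esymm i := by
    intro i hi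
    rw [← hroots, hes]
    refine mul_pos (by exact_mod_cast Nat.choose_pos (hi.trans hkn)) ?_
    rcases Nat.eq_zero_or_pos i with rfl | hi0
    · rw [normEsymm_zero]; exact one_pos
    · exact hκ i hi0 hi
  have hσ := esymm_erase_pos hpos hk
  have hC : (0 : ℝ) < n.choose k := by exact_mod_cast Nat.choose_pos hkn
  have hJ := h.jac_ne_zero
  -- Here `φ = -a η` plays the differential of the normal speed, so the Newton tensor is evaluated
  -- on `η` twice and the sum becomes one of squares.
  have key := hF.coefAt_flux_sub hn h w₀ w₁ (-(a • η)) η (fun v => by rw [hw]; simp) hkn hk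
  rw [← hroots, hes] at key
  have e : fluxCoef A B ν w₀ w₁ η k / n.choose k -
        normEsymm (curvatureRoots A B) k * fluxCoef A B ν w₀ w₁ η 0 =
      a / n.choose k * ∑ i, η (L (stdDir i)) ^ 2 *
        ((Finset.univ.erase i).val.map κ).esymm (k - 1) := by
    have e2 : ∑ i, η (L (stdDir i)) * (-(a • η)) (L (stdDir i)) *
            ((Finset.univ.erase i).val.map κ).esymm (k - 1) = - (a * ∑ i, η (L (stdDir i)) ^ 2 *
        ((Finset.univ.erase i).val.map κ).esymm (k - 1)) := by
      rw [Finset.mul_sum, ← Finset.sum_neg_distrib]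
      refine Finset.sum_congr rfl fun i _ => ?_
      simp only [neg_apply, smul_apply, smul_eq_mul]
      ring
    rw [e2] at key
    simp only [fluxCoef]
    field_simp
    linear_combination key
  rw [e]
  have hterm : ∀ i, 0 ≤ η (L (stdDir i)) ^ 2 * ((Finset.univ.erase i).val.map κ).esymm (k - 1) :=
    fun i => mul_nonneg (sq_nonneg _) (hσ i).le
  refine ⟨mul_nonneg (div_pos ha hC).le (Finset.sum_nonneg fun i _ => hterm i), fun h0 => ?_⟩
  have h1 := (mul_eq_zero.1 h0).resolve_left (div_pos ha hC).ne'
  have h2 := (Finset.sum_eq_zero_iff_of_nonneg fun i _ => hterm i).1 h1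
  have h3 : ∀ i, η (L (stdDir i)) = 0 := fun i => by
    have := (mul_eq_zero.1 (h2 i (Finset.mem_univ i))).resolve_right (hσ i).ne'
    exact pow_eq_zero_iff (two_ne_zero) |>.1 this
  ext v
  have h4 := map_eq_sum_stdDir (η ∘L (L : Par n →L[ℝ] Par n)) (L.symm v)
  simp only [ContinuousLinearMap.comp_apply, ContinuousLinearEquiv.coe_coe,
    ContinuousLinearEquiv.apply_symm_apply] at h4
  rw [h4]
  simp [h3]

variable [IsManifold (𝓡 n) ∞ M]

theorem p_zero (h : IsSmoothFamily Tmax X ν) {t : ℝ} (ht : t ∈ timeInterval Tmax) (x : M) :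
    p 0 (X t) (ν t) x = 1 := by
  rw [h.p_eq ht, normEsymm_zero]

theorem IsSmoothFamily.newton_p (h : IsSmoothFamily Tmax X ν) {t : ℝ}
    (ht : t ∈ timeInterval Tmax) (x : M) (i : ℕ) (hi : i + 2 ≤ n) :
    p i (X t) (ν t) x * p (i + 2) (X t) (ν t) x ≤ p (i + 1) (X t) (ν t) x ^ 2 := by
  simp only [h.p_eq ht]
  exact newton _ i (by rwa [h.card_principalCurvatures ht])

theorem IsSmoothFamily.continuousOn_p_time (h : IsSmoothFamily Tmax X ν) (hT : 0 < Tmax) {l : ℕ}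
    (hl : l ≤ n) (x : M) : ContinuousOn (fun t => p l (X t) (ν t) x) (timeInterval Tmax) := by
  have h1 := (h.continuousOn_p hT x hl).comp (Continuous.prodMk_right
    (chartAt (Par n) x x)).continuousOn fun t (ht : t ∈ timeInterval Tmax) =>
      (⟨mem_chart_target _ x, ht⟩ : (chartAt (Par n) x x, t) ∈ _ ×ˢ _)
  simpa [loc, Function.comp_def] using h1

/-- Positivity of `p₁, …, p_k` persists as long as `p_k > 0`. -/
theorem IsInverseFlow.kConvex (h : IsInverseFlow k Tmax X ν) (hT : 0 < Tmax) (hk : 0 < k)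
    (hkn : k ≤ n) (h0 : KConvex k (X 0) (ν 0)) {t : ℝ} (ht : t ∈ timeInterval Tmax) :
    KConvex k (X t) (ν t) := by
  intro x
  have hpre : PreconnectedSpace (timeInterval Tmax) :=
    isPreconnected_iff_preconnectedSpace.1 (convex_timeInterval Tmax).isPreconnected
  set f : ℕ → timeInterval Tmax → ℝ := fun i s => p i (X s) (ν s) x with hf
  have hc : ∀ i, i ≤ n → Continuous (f i) := fun i hi =>
    continuousOn_iff_continuous_domRestrict.1 (h.continuousOn_p_time hT hi x)
  set S : Set (timeInterval Tmax) := ⋂ i ∈ Finset.Icc 1 k, {s | 0 < f i s} with hS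
  have hmem : ∀ s, s ∈ S ↔ ∀ i, 1 ≤ i → i ≤ k → 0 < f i s := fun s => by
    simp [hS]
  have hopen : IsOpen S := isOpen_biInter_finset fun i hi =>
    isOpen_lt continuous_const (hc i ((Finset.mem_Icc.1 hi).2.trans hkn))
  -- Maclaurin replaces the open conditions by closed ones: `f i = 0` would contradict `0 < f k ^ i
  -- ≤ f i ^ k`. So `S` is open and closed in a connected interval, and it contains `0`.
  have hS' : S = ⋂ i ∈ Finset.Icc 1 k, {s | 0 ≤ f i s ∧ f k s ^ i ≤ f i s ^ k} := by
    ext s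
    rw [hmem]
    simp only [mem_iInter, Finset.mem_Icc, mem_ofPred_eq, and_imp]
    refine ⟨fun hs i hi1 hik => ⟨(hs i hi1 hik).le, ?_⟩, fun hs i hi1 hik => ?_⟩
    · exact maclaurin_pow_le (q := fun j => f j s) (k := k) (p_zero h.toIsSmoothFamily s.2 x) hs
        (fun j hj => h.newton_p s.2 x j (hj.trans hkn)) i hi1 k hik le_rfl
    · obtain ⟨h1, h2⟩ := hs i hi1 hik
      refine lt_of_le_of_ne h1 fun h3 => ?_
      rw [← h3, zero_pow hk.ne'] at h2
      exact absurd (pow_pos (h.p_pos s s.2 x) i) (not_lt.2 h2)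
  have hclosed : IsClosed S := by
    rw [hS']
    refine isClosed_biInter fun i hi => ?_
    have hi' := hc i ((Finset.mem_Icc.1 hi).2.trans hkn)
    exact (isClosed_le continuous_const hi').inter
      (isClosed_le ((hc k hkn).pow i) (hi'.pow k))
  have huniv : S = univ := IsClopen.eq_univ ⟨hclosed, hopen⟩
    ⟨⟨0, zero_mem_timeInterval hT⟩, (hmem _).2 (h0 x)⟩
  exact (hmem ⟨t, ht⟩).1 (huniv ▸ trivial)

theorem IsInverseFlow.chartDeriv_normalSpeed (h : IsInverseFlow k Tmax X ν) (hkn : k ≤ n) {t : ℝ}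
    (ht : t ∈ openTime Tmax) (x : M) :
    chartDeriv (n := n) (normalSpeed X ν t) x = (-(1 / (k : ℝ)) *
      p k (X t) (ν t) x ^ (-(1 / (k : ℝ)) - 1)) • chartDeriv (n := n) (p k (X t) (ν t)) x := by
  have ht' := openTime_subset ht
  have hd := (((h.contDiffOn_p ht' x hkn).contDiffAt ((chartAt (Par n) x).open_target.mem_nhds
    (mem_chart_target _ x))).differentiableAt (by simp)).hasFDerivAt
  have hp : (p k (X t) (ν t) ∘ (chartAt (Par n) x).symm) (chartAt (Par n) x x) =
      p k (X t) (ν t) x := by simp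
  have h1 := hd.rpow_const (p := -(1 / (k : ℝ))) (Or.inl (by
    rw [hp]; exact (h.p_pos t ht' x).ne'))
  rw [hp] at h1
  have e : normalSpeed X ν t ∘ (chartAt (Par n) x).symm = fun y =>
      (p k (X t) (ν t) ∘ (chartAt (Par n) x).symm) y ^ (-(1 / (k : ℝ))) := by
    ext y; exact h.normalSpeed_eq t ht _
  rw [chartDeriv, e, h1.fderiv]
  rfl

theorem IsSmoothFamily.inner_deriv_normal (h : IsSmoothFamily Tmax X ν) {t : ℝ}
    (ht : t ∈ openTime Tmax) (x : M) (v : Par n) :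
    inner ℝ (deriv (fun s => ν s x) t) (chartDeriv (X t) x v) =
      - chartDeriv (normalSpeed X ν t) x v +
        inner ℝ (chartDeriv (ν t) x v) (deriv (fun s => X s x) t + X t x) := by
  have h1 := (h.isLocalFamily x).inner_dT_normal_dS (q := (chartAt (Par n) x x, t))
    ⟨mem_chart_target _ x, ht⟩ v
  have e1 : dT (loc x X) (chartAt (Par n) x x, t) = deriv (fun s => X s x) t := by
    simp [dT, loc]
  have e2 : dT (loc x ν) (chartAt (Par n) x x, t) = deriv (fun s => ν s x) t := by
    simp [dT, loc]
  have e3 : loc x X (chartAt (Par n) x x, t) = X t x := by simp [loc]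
  rw [e1, e2, e3] at h1
  exact h1

/-- The gradient part of the source term. -/
def gradientPart (X ν : ℝ → M → Amb n) (l : ℕ) (t : ℝ) (x : M) : ℝ :=
  fluxCoef (chartDeriv (X t) x) (chartDeriv (ν t) x) (ν t x)
      (deriv (fun s => X s x) t + X t x) (deriv (fun s => ν s x) t)
      (chartDeriv (p l (X t) (ν t)) x) l / n.choose l -
    p l (X t) (ν t) x * fluxCoef (chartDeriv (X t) x) (chartDeriv (ν t) x) (ν t x)
      (deriv (fun s => X s x) t + X t x) (deriv (fun s => ν s x) t)
      (chartDeriv (p l (X t) (ν t)) x) 0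

/-- The speed `p_k^{-1/k}` decreases in `p_k`, so its differential is `-a dp_k` with `a > 0`, as
`gradient_term` requires. -/
theorem IsInverseFlow.gradientPart_nonneg (h : IsInverseFlow k Tmax X ν) (hk : 0 < k)
    (hkn : k ≤ n) {t : ℝ} (ht : t ∈ openTime Tmax) (hc : KConvex k (X t) (ν t)) (x : M) :
    0 ≤ gradientPart X ν k t x ∧
      (gradientPart X ν k t x = 0 → chartDeriv (n := n) (p k (X t) (ν t)) x = 0) := by
  have ht' := openTime_subset ht
  have hP := h.isHypersurfacePoint_chartDeriv ht' x
  have hcr := h.principalCurvatures_eq' ht' x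
  have hpe : ∀ l, p l (X t) (ν t) x =
      normEsymm (curvatureRoots (chartDeriv (X t) x) (chartDeriv (ν t) x)) l := fun l => by
    rw [h.p_eq ht', hcr]
  have ha : 0 < 1 / (k : ℝ) * p k (X t) (ν t) x ^ (-(1 / (k : ℝ)) - 1) :=
    mul_pos (by positivity) (Real.rpow_pos_of_pos (h.p_pos t ht' x) _)
  have := hP.gradient_term (hk.trans_le hkn) (w₀ := deriv (fun s => X s x) t + X t x)
    (w₁ := deriv (fun s => ν s x) t) (η := chartDeriv (p k (X t) (ν t)) x) ha
    (fun v => by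
      rw [h.inner_deriv_normal ht, h.chartDeriv_normalSpeed hkn ht]
      simp only [smul_apply, smul_eq_mul]
      ring) hk hkn (fun i hi hik => by rw [← hpe]; exact hc x i hi hik)
  rw [← hpe] at this
  exact this

theorem IsInverseFlow.sourceAt_eq_terms (h : IsInverseFlow k Tmax X ν) (ι : ℝ) (l : ℕ) {t : ℝ}
    (ht : t ∈ openTime Tmax) (x : M) :
    sourceAt X ν ι l t x =
      ι * p l (X t) (ν t) x ^ (ι - 1) * ((n - l) * (p k (X t) (ν t) x ^ (-(1 / (k : ℝ))) *
        p (l + 1) (X t) (ν t) x - p l (X t) (ν t) x)) +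
      (1 - ι) * p l (X t) (ν t) x ^ ι * (n * (p k (X t) (ν t) x ^ (-(1 / (k : ℝ))) *
        p 1 (X t) (ν t) x - 1)) -
      ι * (ι - 1) * p l (X t) (ν t) x ^ (ι - 2) * gradientPart X ν l t x := by
  have ht' := openTime_subset ht
  rw [sourceAt, IsLocalFamily.transportSource, h.normalSpeed_eq t ht, h.p_eq ht' 1,
    h.p_eq ht' (l + 1), h.principalCurvatures_eq' ht', gradientPart]

end Signs

/-! ### Sign of the integrand and umbilicity in the equality case -/

section Rigidity

variable {n : ℕ} {M : Type*} [TopologicalSpace M] [ChartedSpace (EuclideanSpace ℝ (Fin n)) M]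
  [IsManifold (𝓡 n) ∞ M] {k : ℕ} {Tmax : EReal} {X ν : ℝ → M → Amb n}

/-- The infinitesimal characterization of round spheres: totally umbilic, and, for curves, of
constant curvature. -/
def IsUmbilicAt (X ν : M → Amb n) (x : M) : Prop :=
  (2 ≤ n → p 2 X ν x = p 1 X ν x ^ 2) ∧ (n = 1 → chartDeriv (n := n) (p 1 X ν) x = 0)

namespace IsInverseFlow

variable {t : ℝ}

theorem next_le (h : IsInverseFlow k Tmax X ν) (hk : 0 < k)
    (hkn : k < n) (ht : t ∈ timeInterval Tmax) (hc : KConvex k (X t) (ν t)) (x : M) :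
    p k (X t) (ν t) x ^ (-(1 / (k : ℝ))) * p (k + 1) (X t) (ν t) x ≤ p k (X t) (ν t) x ∧
      (p k (X t) (ν t) x ^ (-(1 / (k : ℝ))) * p (k + 1) (X t) (ν t) x = p k (X t) (ν t) x →
        p 2 (X t) (ν t) x = p 1 (X t) (ν t) x ^ 2) :=
  maclaurin_next (q := fun j => p j (X t) (ν t) x) hk (p_zero h.toIsSmoothFamily ht x) (hc x)
    fun i hi => h.newton_p ht x i (by omega)

theorem prev_le (h : IsInverseFlow k Tmax X ν) (hk : 1 < k)
    (hkn : k ≤ n) (ht : t ∈ timeInterval Tmax) (hc : KConvex k (X t) (ν t)) (x : M) :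
    p k (X t) (ν t) x ^ (-(1 / (k : ℝ))) * p k (X t) (ν t) x ≤ p (k - 1) (X t) (ν t) x ∧
      (p k (X t) (ν t) x ^ (-(1 / (k : ℝ))) * p k (X t) (ν t) x = p (k - 1) (X t) (ν t) x →
        p 2 (X t) (ν t) x = p 1 (X t) (ν t) x ^ 2) :=
  maclaurin_prev (q := fun j => p j (X t) (ν t) x) hk (p_zero h.toIsSmoothFamily ht x) (hc x)
    fun i hi => h.newton_p ht x i (by omega)

theorem first_le (h : IsInverseFlow k Tmax X ν) (hk : 0 < k)
    (hkn : k ≤ n) (ht : t ∈ timeInterval Tmax) (hc : KConvex k (X t) (ν t)) (x : M) :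
    1 ≤ p k (X t) (ν t) x ^ (-(1 / (k : ℝ))) * p 1 (X t) (ν t) x ∧
      (1 < k → p k (X t) (ν t) x ^ (-(1 / (k : ℝ))) * p 1 (X t) (ν t) x = 1 →
        p 2 (X t) (ν t) x = p 1 (X t) (ν t) x ^ 2) :=
  maclaurin_first (q := fun j => p j (X t) (ν t) x) hk (p_zero h.toIsSmoothFamily ht x) (hc x)
    fun i hi => h.newton_p ht x i (by omega)

/-- The term of the source coming from `p_{k+1}`. -/
theorem next_term (h : IsInverseFlow k Tmax X ν) (hk : 0 < k)
    (hkn : k ≤ n) (ht : t ∈ timeInterval Tmax) (hc : KConvex k (X t) (ν t)) (x : M) :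
    ((n : ℝ) - k) * (p k (X t) (ν t) x ^ (-(1 / (k : ℝ))) * p (k + 1) (X t) (ν t) x -
        p k (X t) (ν t) x) ≤ 0 ∧
      (k < n → ((n : ℝ) - k) * (p k (X t) (ν t) x ^ (-(1 / (k : ℝ))) * p (k + 1) (X t) (ν t) x -
        p k (X t) (ν t) x) = 0 → p 2 (X t) (ν t) x = p 1 (X t) (ν t) x ^ 2) := by
  rcases hkn.eq_or_lt with rfl | hlt
  · simp
  · have h1 := h.next_le hk hlt ht hc x
    have h2 : (0 : ℝ) < (n : ℝ) - k := by
      have : (k : ℝ) < n := by exact_mod_cast hlt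
      linarith
    refine ⟨mul_nonpos_of_nonneg_of_nonpos h2.le (by linarith [h1.1]), fun _ h3 => h1.2 ?_⟩
    linarith [(mul_eq_zero.1 h3).resolve_left h2.ne']

/-- For `ι > 1` all three terms are nonpositive, so each vanishes with their sum. Umbilicity comes
from `F p_1 = 1` if `k > 1`, from `F p_2 = p_1` if `k = 1 < n`, and for curves the gradient term
gives constant curvature. -/
theorem sourceAt_nonpos (h : IsInverseFlow k Tmax X ν) (hk : 0 < k) (hkn : k ≤ n)
    (ht : t ∈ openTime Tmax) (hc : KConvex k (X t) (ν t)) {ι : ℝ} (hι : 1 < ι) (x : M) :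
    sourceAt X ν ι k t x ≤ 0 ∧ (sourceAt X ν ι k t x = 0 → IsUmbilicAt (X t) (ν t) x) := by
  have ht' := openTime_subset ht
  have hn : (0 : ℝ) < n := by exact_mod_cast hk.trans_le hkn
  have hu := h.p_pos t ht' x
  obtain ⟨g1, g2⟩ := h.gradientPart_nonneg hk hkn ht hc x
  obtain ⟨a1, a2⟩ := h.next_term hk hkn ht' hc x
  obtain ⟨b1, b2⟩ := h.first_le hk hkn ht' hc x
  rw [h.sourceAt_eq_terms ι k ht]
  have c1 : 0 < ι * p k (X t) (ν t) x ^ (ι - 1) :=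
    mul_pos (by linarith) (Real.rpow_pos_of_pos hu _)
  have c2 : 0 < (ι - 1) * p k (X t) (ν t) x ^ ι :=
    mul_pos (by linarith) (Real.rpow_pos_of_pos hu _)
  have c3 : 0 < ι * (ι - 1) * p k (X t) (ν t) x ^ (ι - 2) :=
    mul_pos (mul_pos (by linarith) (by linarith)) (Real.rpow_pos_of_pos hu _)
  have t1 := mul_nonpos_of_nonneg_of_nonpos c1.le a1
  have t2 := mul_nonneg c2.le (mul_nonneg hn.le (sub_nonneg.2 b1))
  have t3 := mul_nonneg c3.le g1
  refine ⟨by linarith, fun h0 => ⟨fun h2n => ?_, fun hn1 => ?_⟩⟩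
  · rcases Nat.lt_or_ge 1 k with hk1 | hk1
    · have e2 := (mul_eq_zero.1 (show _ * _ = (0 : ℝ) by linarith [t2] :
        (ι - 1) * p k (X t) (ν t) x ^ ι * (n * (p k (X t) (ν t) x ^ (-(1 / (k : ℝ))) *
          p 1 (X t) (ν t) x - 1)) = 0)).resolve_left c2.ne'
      exact b2 hk1 (by linarith [(mul_eq_zero.1 e2).resolve_left hn.ne'])
    · exact a2 (by omega) ((mul_eq_zero.1 (by linarith [t1] :
        ι * p k (X t) (ν t) x ^ (ι - 1) * (((n : ℝ) - k) * (p k (X t) (ν t) x ^ (-(1 / (k : ℝ))) *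
        p (k + 1) (X t) (ν t) x - p k (X t) (ν t) x)) = 0)).resolve_left c1.ne')
  · have e3 := (mul_eq_zero.1 (by linarith [t3] :
      ι * (ι - 1) * p k (X t) (ν t) x ^ (ι - 2) * gradientPart X ν k t x = 0)).resolve_left c3.ne'
    obtain rfl : k = 1 := by omega
    exact g2 e3

theorem sourceAt_one_nonpos (h : IsInverseFlow k Tmax X ν) (hk : 0 < k) (hkn : k ≤ n)
    (ht : t ∈ openTime Tmax) (hc : KConvex k (X t) (ν t)) (x : M) :
    sourceAt X ν 1 k t x ≤ 0 ∧
      (k < n → sourceAt X ν 1 k t x = 0 → IsUmbilicAt (X t) (ν t) x) := by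
  obtain ⟨a1, a2⟩ := h.next_term hk hkn (openTime_subset ht) hc x
  have e := h.sourceAt_eq_terms 1 k ht x
  simp only [sub_self, Real.rpow_zero, mul_one, one_mul, zero_mul, mul_zero, add_zero,
    sub_zero] at e
  rw [e]
  exact ⟨a1, fun hlt h0 => ⟨fun _ => a2 hlt h0, fun h1 => by omega⟩⟩

theorem sourceAt_one_top (h : IsInverseFlow n Tmax X ν) (ht : t ∈ openTime Tmax) (x : M) :
    sourceAt X ν 1 n t x = 0 := by
  rw [h.sourceAt_eq_terms 1 n ht x]
  simp

/-- At index `k - 1` the relevant comparison is `F p_k ≤ p_{k-1}`, and the factor `n - (k - 1)` is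
positive even for `k = n`. The exponent `1` removes the gradient term. -/
theorem sourceAt_pred_nonpos (h : IsInverseFlow k Tmax X ν) (hk : 1 < k) (hkn : k ≤ n)
    (ht : t ∈ openTime Tmax) (hc : KConvex k (X t) (ν t)) (x : M) :
    sourceAt X ν 1 (k - 1) t x ≤ 0 ∧
      (sourceAt X ν 1 (k - 1) t x = 0 → IsUmbilicAt (X t) (ν t) x) := by
  obtain ⟨a1, a2⟩ := h.prev_le hk hkn (openTime_subset ht) hc x
  have e := h.sourceAt_eq_terms 1 (k - 1) ht x
  simp only [sub_self, Real.rpow_zero, mul_one, one_mul, zero_mul, mul_zero, add_zero,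
    sub_zero, Nat.sub_add_cancel hk.le] at e
  have c : (0 : ℝ) < (n : ℝ) - (k - 1 : ℕ) := by
    have : ((k - 1 : ℕ) : ℝ) < n := by exact_mod_cast (by omega : k - 1 < n)
    linarith
  rw [e]
  refine ⟨mul_nonpos_of_nonneg_of_nonpos c.le (by linarith), fun h0 =>
    ⟨fun _ => a2 ?_, fun h1 => by omega⟩⟩
  linarith [(mul_eq_zero.1 h0).resolve_left c.ne']

/-- For `0 < ι < 1` the last two terms change sign but the one with `p_{k+1}` does not; `k = n`
makes its factor `n - k` vanish. -/
theorem sourceAt_top_nonneg (h : IsInverseFlow n Tmax X ν) (hn : 0 < n)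
    (ht : t ∈ openTime Tmax) (hc : KConvex n (X t) (ν t)) {ι : ℝ} (hι0 : 0 < ι) (hι : ι < 1)
    (x : M) :
    0 ≤ sourceAt X ν ι n t x ∧ (sourceAt X ν ι n t x = 0 → IsUmbilicAt (X t) (ν t) x) := by
  have ht' := openTime_subset ht
  have hn' : (0 : ℝ) < n := by exact_mod_cast hn
  have hu := h.p_pos t ht' x
  obtain ⟨g1, g2⟩ := h.gradientPart_nonneg hn le_rfl ht hc x
  obtain ⟨b1, b2⟩ := h.first_le hn le_rfl ht' hc x
  rw [h.sourceAt_eq_terms ι n ht]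
  rw [sub_self, zero_mul, mul_zero, zero_add]
  have c2 : 0 < (1 - ι) * p n (X t) (ν t) x ^ ι :=
    mul_pos (by linarith) (Real.rpow_pos_of_pos hu _)
  have c3 : 0 < ι * (1 - ι) * p n (X t) (ν t) x ^ (ι - 2) :=
    mul_pos (mul_pos (by linarith) (by linarith)) (Real.rpow_pos_of_pos hu _)
  have t2 := mul_nonneg c2.le (mul_nonneg hn'.le (sub_nonneg.2 b1))
  have t3 := mul_nonneg c3.le g1
  refine ⟨by linarith, fun h0 => ⟨fun h2n => ?_, fun hn1 => ?_⟩⟩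
  · have e2 := (mul_eq_zero.1 (by linarith [t2] :
      (1 - ι) * p n (X t) (ν t) x ^ ι * (n * (p n (X t) (ν t) x ^ (-(1 / (n : ℝ))) *
          p 1 (X t) (ν t) x - 1)) = 0)).resolve_left c2.ne'
    exact b2 h2n (by linarith [(mul_eq_zero.1 e2).resolve_left hn'.ne'])
  · have e3 := (mul_eq_zero.1 (by linarith [t3] :
      ι * (1 - ι) * p n (X t) (ν t) x ^ (ι - 2) * gradientPart X ν n t x = 0)).resolve_left c3.ne'
    have e4 := g2 e3
    have : ∀ m, m = 1 → chartDeriv (n := n) (p m (X t) (ν t)) x = 0 →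
        chartDeriv (n := n) (p 1 (X t) (ν t)) x = 0 :=
      fun m hm => by rw [hm]; exact id
    exact this n hn1 e4

theorem sourceAt_zero_nonneg (h : IsInverseFlow k Tmax X ν) (hk : 0 < k) (hkn : k ≤ n)
    (ht : t ∈ openTime Tmax) (hc : KConvex k (X t) (ν t)) (x : M) :
    0 ≤ sourceAt X ν 0 0 t x ∧
      (1 < k → sourceAt X ν 0 0 t x = 0 → IsUmbilicAt (X t) (ν t) x) := by
  obtain ⟨b1, b2⟩ := h.first_le hk hkn (openTime_subset ht) hc x
  have hn : (0 : ℝ) < n := by exact_mod_cast hk.trans_le hkn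
  have e := h.sourceAt_eq_terms 0 0 ht x
  simp only [zero_mul, Real.rpow_zero, mul_one, one_mul, zero_add, sub_zero] at e
  rw [e]
  refine ⟨mul_nonneg hn.le (by linarith), fun hk1 h0 => ⟨fun _ => b2 hk1 ?_, fun h1 => by omega⟩⟩
  linarith [(mul_eq_zero.1 h0).resolve_left hn.ne']

/-- For `k = 1` the speed is `F = p_1⁻¹`, so `F p_1 - 1` vanishes identically. -/
theorem sourceAt_zero_one (h : IsInverseFlow 1 Tmax X ν) (ht : t ∈ openTime Tmax) (x : M) :
    sourceAt X ν 0 0 t x = 0 := by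
  have e := h.sourceAt_eq_terms 0 0 ht x
  have hu := h.p_pos t (openTime_subset ht) x
  simp only [zero_mul, Real.rpow_zero, mul_one, zero_add, sub_zero, Nat.cast_one,
    div_one, Real.rpow_neg_one, inv_mul_cancel₀ hu.ne', sub_self, mul_zero] at e
  exact e

end IsInverseFlow

end Rigidity

/-! ### Umbilic points -/

section UmbilicPoint

variable {n : ℕ} {A B : Par n →L[ℝ] Amb n} {ν : Amb n}

theorem esymm_one (s : Multiset ℝ) : s.esymm 1 = s.sum := by
  induction s using Multiset.induction with
  | empty => rw [esymm_eq_zero_of_card_lt (by simp)]; simp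
  | cons a s ih =>
    have h := esymm_cons_succ a s 0
    rw [esymm_zero', zero_add, ih] at h
    rw [h, Multiset.sum_cons]; ring

theorem IsPrincipalFrame.eq_smul {L : Par n ≃L[ℝ] Par n} {κ : Fin n → ℝ}
    (hF : IsPrincipalFrame A B L κ) {a : ℝ} (hκ : ∀ i, κ i = a) : B = a • A := by
  ext1 v
  have h1 := map_eq_sum_stdDir (B ∘L (L : Par n →L[ℝ] Par n)) (L.symm v)
  have h2 := map_eq_sum_stdDir (A ∘L (L : Par n →L[ℝ] Par n)) (L.symm v)
  simp only [ContinuousLinearMap.comp_apply, ContinuousLinearEquiv.coe_coe,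
    ContinuousLinearEquiv.apply_symm_apply] at h1 h2
  rw [h1, smul_apply, h2, Finset.smul_sum]
  exact Finset.sum_congr rfl fun i _ => by rw [hF.principal, hκ, smul_comm]

/-- The equality `p₂ = p₁²` characterizes umbilic points. -/
theorem IsHypersurfacePoint.eq_smul_of_umbilic (hn : 0 < n) (h : IsHypersurfacePoint A B ν)
    (hu : 2 ≤ n → normEsymm (curvatureRoots A B) 2 = normEsymm (curvatureRoots A B) 1 ^ 2) :
    B = normEsymm (curvatureRoots A B) 1 • A := by
  obtain ⟨L, κ, hF⟩ := h.exists_frame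
  have hroots : curvatureRoots A B = Finset.univ.val.map κ := hF.roots_charpoly
  refine hF.eq_smul ?_
  have h1 := esymm_eq_choose_mul_normEsymm (curvatureRoots A B) 1
  have h2 := esymm_eq_choose_mul_normEsymm (curvatureRoots A B) 2
  have h3 := sum_sq_eq (curvatureRoots A B)
  rw [h.card_curvatureRoots, Nat.choose_one_right] at h1
  rw [h.card_curvatureRoots, Nat.cast_choose_two] at h2
  set a := normEsymm (curvatureRoots A B) 1 with ha
  have h2' : (curvatureRoots A B).esymm 2 = n * (n - 1) / 2 * a ^ 2 := by
    rcases Nat.lt_or_ge n 2 with hlt | hge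
    · obtain rfl : n = 1 := by omega
      rw [h2]; simp
    · rw [h2, hu hge]
  rw [h1, h2', hroots] at h3
  have h4 : ∑ i, κ i = n * a := by
    rw [← h1, esymm_one, hroots]; rfl
  have h5 : ∑ i, κ i ^ 2 = (n * a) ^ 2 - 2 * (n * (n - 1) / 2 * a ^ 2) := by
    rw [← h3, Multiset.map_map]; rfl
  -- The variance of the principal curvatures is `n (n - 1) (p_1² - p_2)`, which is zero here; for
  -- `n = 1` the factor `n - 1` vanishes instead.
  have h6 : ∑ i, (κ i - a) ^ 2 = 0 := by
    have e : ∀ i, (κ i - a) ^ 2 = κ i ^ 2 - 2 * a * κ i + a ^ 2 := fun i => by ring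
    simp only [e, Finset.sum_add_distrib, Finset.sum_sub_distrib, ← Finset.mul_sum, h4, h5,
      Finset.sum_const, Finset.card_univ, Fintype.card_fin, nsmul_eq_mul]
    ring
  have h7 := (Finset.sum_eq_zero_iff_of_nonneg fun i _ => sq_nonneg (κ i - a)).1 h6
  intro i
  exact sub_eq_zero.1 (pow_eq_zero_iff two_ne_zero |>.1 (h7 i (Finset.mem_univ i)))

theorem IsHypersurfacePoint.normEsymm_of_eq_smul (h : IsHypersurfacePoint A B ν) {a : ℝ}
    (hBA : B = a • A) {l : ℕ} (hl : l ≤ n) : normEsymm (curvatureRoots A B) l = a ^ l := by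
  obtain ⟨L, κ, hF⟩ := h.exists_frame
  have hroots : curvatureRoots A B = Finset.univ.val.map κ := hF.roots_charpoly
  have hκ : ∀ i, κ i = a := by
    intro i
    have h1 := hF.principal i
    have h2 : (κ i - a) • A (L (stdDir i)) = 0 := by
      rw [sub_smul, ← h1, hBA, smul_apply, sub_self]
    exact sub_eq_zero.1 ((smul_eq_zero.1 h2).resolve_right (hF.orthonormal.ne_zero i))
  have hrep : curvatureRoots A B = Multiset.replicate n a := by
    rw [hroots, Multiset.eq_replicate]
    refine ⟨by simp, fun b hb => ?_⟩
    obtain ⟨i, -, rfl⟩ := Multiset.mem_map.1 hb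
    exact hκ i
  rw [normEsymm, hrep, esymm_replicate, Multiset.card_replicate, mul_div_cancel_left₀]
  exact_mod_cast (Nat.choose_pos hl).ne'

theorem IsHypersurfacePoint.eq_smul_normal (h : IsHypersurfacePoint A B ν) {w : Amb n}
    (hw : ∀ v, inner ℝ (A v) w = 0) : w = inner ℝ ν w • ν := by
  obtain ⟨L, κ, hF⟩ := h.exists_frame
  obtain ⟨b, hb⟩ := exists_orthonormalBasis_cons ν h.norm_eq_one hF.orthonormal
    fun i => h.inner_left _
  have h1 := b.sum_repr' w
  rw [hb, Fin.sum_univ_succ] at h1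
  simp only [Fin.cons_zero, Fin.cons_succ, hw, zero_smul, Finset.sum_const_zero, add_zero] at h1
  exact h1.symm

/-- The principal curvature of an umbilic immersion is constant in dimension at least two. -/
theorem IsLocalFamily.dS_eq_zero_of_umbilic (hn : 2 ≤ n) {O : Set (Par n × ℝ)}
    {X ν : Par n × ℝ → Amb n} (hF : IsLocalFamily O X ν) {f : Par n × ℝ → ℝ}
    (hf : ContDiffOn ℝ ∞ f O) (hu : ∀ q ∈ O, dS ν q = f q • dS X q) {q : Par n × ℝ} (hq : q ∈ O) :
    dS f q = 0 := by
  have hderiv : ∀ v w, dS (fun x => dS ν x v) q w =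
      f q • dS (fun x => dS X x v) q w + dS f q w • dS X q v := by
    intro v w
    have e : (fun x => dS ν x v) =ᶠ[nhds q] fun x => f x • dS X x v :=
      Filter.eventuallyEq_of_mem (hF.isOpen.mem_nhds hq) fun x hx => by
        simp only [hu x hx, smul_apply]
    have d1 := (hF.differentiableAt hf hq).hasFDerivAt
    have d2 := (hF.differentiableAt (contDiffOn_dS hF.isOpen hF.smooth_X v) hq).hasFDerivAt
    rw [HasFDerivAt.dS_eq ((d1.smul d2).congr_of_eventuallyEq e), HasFDerivAt.dS_eq d1,
      HasFDerivAt.dS_eq d2]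
    simp
  -- The Codazzi argument: second derivatives of `ν` and of `X` are symmetric, so `df(w) ∂ᵥX = df(v)
  -- ∂_wX`, and two independent directions force `df = 0`.
  have hsym : ∀ v w, dS f q w • v = dS f q v • w := by
    intro v w
    refine hF.injective q hq ?_
    have h1 := dS_dS_comm hF.isOpen hF.smooth_ν hq v w
    rw [hderiv v w, hderiv w v, dS_dS_comm hF.isOpen hF.smooth_X hq v w] at h1
    rw [map_smul, map_smul]
    exact add_left_cancel h1
  have hzero : ∀ i, dS f q (stdDir i) = 0 := by
    intro i
    obtain ⟨j, hj⟩ : ∃ j : Fin n, j ≠ i := by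
      have : Nontrivial (Fin n) := Fin.nontrivial_iff_two_le.2 hn
      exact exists_ne i
    have h1 := congrArg (fun v : Par n => v j) (hsym (stdDir j) (stdDir i))
    simpa [stdDir, hj] using h1
  ext v
  rw [map_eq_sum_stdDir (dS f q) v]
  simp [hzero]

end UmbilicPoint

/-! ### Characterization of round spheres -/

section Spheres

variable {n : ℕ} {M : Type*} [TopologicalSpace M] [ChartedSpace (EuclideanSpace ℝ (Fin n)) M]

theorem eq_of_fderiv_chart_eq_zero [ConnectedSpace M] {G : Type*} [NormedAddCommGroup G]
    [NormedSpace ℝ G] {f : M → G}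
    (hd : ∀ c, DifferentiableOn ℝ (f ∘ (chartAt (Par n) c).symm) (chartAt (Par n) c).target)
    (h0 : ∀ c, ∀ y ∈ (chartAt (Par n) c).target,
      fderiv ℝ (f ∘ (chartAt (Par n) c).symm) y = 0) (x y : M) : f x = f y := by
  have hloc : IsLocallyConstant f := by
    rw [IsLocallyConstant.iff_eventually_eq]
    intro x
    have hU := (chartAt (Par n) x).open_target.mem_nhds (mem_chart_target (Par n) x)
    obtain ⟨ε, hε, hball⟩ := Metric.mem_nhds_iff.1 hU
    have hmem : (chartAt (Par n) x) ⁻¹' Metric.ball (chartAt (Par n) x x) ε ∈ nhds x :=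
      ((chartAt (Par n) x).continuousAt (mem_chart_source _ x)).preimage_mem_nhds
        (Metric.ball_mem_nhds _ hε)
    filter_upwards [hmem, (chartAt (Par n) x).open_source.mem_nhds (mem_chart_source _ x)]
      with z hz hzs
    have h1 := IsOpen.is_const_of_fderiv_eq_zero (𝕜 := ℝ) Metric.isOpen_ball
      (convex_ball (chartAt (Par n) x x) ε).isPreconnected ((hd x).mono hball)
      (fun y hy => h0 x y (hball hy)) hz (Metric.mem_ball_self hε)
    simpa [(chartAt (Par n) x).left_inv hzs] using h1
  exact hloc.apply_eq_of_preconnectedSpace x y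

variable [IsManifold (𝓡 n) ∞ M] {Tmax : EReal} {X ν : ℝ → M → Amb n}

namespace IsSmoothFamily

variable {t : ℝ}

/-- The relation between position and normal which characterizes round spheres. -/
def IsSpherical (X ν : M → Amb n) : Prop :=
  ∀ x y, p 1 X ν x = p 1 X ν y ∧ p 1 X ν x • (X x - X y) = ν x - ν y

/-- Umbilicity reads `dν = p_1 dX`. By Codazzi, or by assumption for curves, `p_1` is constant, so
`ν - p_1 X` has zero differential. -/
theorem isSpherical_of_umbilic [ConnectedSpace M] (h : IsSmoothFamily Tmax X ν) (hn : 0 < n)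
    (ht : t ∈ timeInterval Tmax) (hu : ∀ x, IsUmbilicAt (X t) (ν t) x) :
    IsSpherical (X t) (ν t) := by
  have hB : ∀ x, chartDeriv (n := n) (ν t) x =
      p 1 (X t) (ν t) x • chartDeriv (n := n) (X t) x := by
    intro x
    rw [h.p_eq ht, h.principalCurvatures_eq' ht]
    refine (h.isHypersurfacePoint_chartDeriv ht x).eq_smul_of_umbilic hn fun h2 => ?_
    have := (hu x).1 h2
    rwa [h.p_eq ht, h.p_eq ht, h.principalCurvatures_eq' ht] at this
  have hp1 := fun c => h.contDiffOn_p ht c (l := 1) hn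
  have hBc : ∀ c, ∀ y ∈ (chartAt (Par n) c).target,
      dS (loc c ν) (y, t) = p 1 (X t) (ν t) ((chartAt (Par n) c).symm y) • dS (loc c X) (y, t) := by
    intro c y hy
    have e1 : dS (loc c X) (y, t) = _ :=
      fderiv_eq_chartDeriv (contDiffOn_comp_chart (h.contMDiff_X ht)) c hy
    have e2 : dS (loc c ν) (y, t) = _ :=
      fderiv_eq_chartDeriv (contDiffOn_comp_chart (h.contMDiff_ν ht)) c hy
    rw [e1, e2, hB, ContinuousLinearMap.smul_comp]
  have hdp : ∀ c, ∀ y ∈ (chartAt (Par n) c).target,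
      fderiv ℝ (p 1 (X t) (ν t) ∘ (chartAt (Par n) c).symm) y = 0 := by
    intro c y hy
    rcases Nat.lt_or_ge n 2 with hlt | hge
    · rw [fderiv_eq_chartDeriv hp1 c hy, (hu _).2 (by omega), ContinuousLinearMap.zero_comp]
    · exact (h.isLocalFamily_frozen ht c).dS_eq_zero_of_umbilic hge
        (f := fun q => (p 1 (X t) (ν t) ∘ (chartAt (Par n) c).symm) q.1)
        ((hp1 c).comp contDiffOn_fst fun _ hq => hq.1) (fun q hq => hBc c q.1 hq.1)
        (q := (y, t)) ⟨hy, trivial⟩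
  have hconst : ∀ x y, p 1 (X t) (ν t) x = p 1 (X t) (ν t) y :=
    eq_of_fderiv_chart_eq_zero (fun c => (hp1 c).differentiableOn (by simp)) hdp
  intro x y
  refine ⟨hconst x y, ?_⟩
  have hXd := fun c => contDiffOn_comp_chart (h.contMDiff_X ht) c
  have hνd := fun c => contDiffOn_comp_chart (h.contMDiff_ν ht) c
  have key := eq_of_fderiv_chart_eq_zero (n := n)
    (f := fun z => ν t z - p 1 (X t) (ν t) x • X t z)
    (fun c => ((hνd c).sub ((hXd c).const_smul _)).differentiableOn (by simp))
    (fun c z hz => by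
      have d1 := differentiableAt_comp_chart (h.contMDiff_X ht) c hz
      have d2 := differentiableAt_comp_chart (h.contMDiff_ν ht) c hz
      have e := (d2.hasFDerivAt.sub (d1.hasFDerivAt.const_smul (p 1 (X t) (ν t) x))).fderiv
      refine e.trans ?_
      rw [sub_eq_zero, hconst x ((chartAt (Par n) c).symm z)]
      exact hBc c z hz) x y
  rw [smul_sub, sub_eq_sub_iff_add_eq_add, add_comm]
  rw [sub_eq_sub_iff_add_eq_add] at key
  rw [key]

set_option linter.unusedSectionVars false in
theorem continuousOn_time {Y : ℝ → M → Amb n} (hY : ContMDiffOn ((𝓡 n).prod 𝓘(ℝ, ℝ)) 𝓘(ℝ, Amb n) ∞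
    (fun q : M × ℝ => Y q.2 q.1) (univ ×ˢ timeInterval Tmax)) (x : M) :
    ContinuousOn (fun t => Y t x) (timeInterval Tmax) :=
  hY.continuousOn.comp (Continuous.prodMk_right x).continuousOn fun _ ht => ⟨trivial, ht⟩

/-- The evolution equation is available only for `t > 0`. Being spherical is an equality between
continuous functions of time, unlike the derivative conditions in `IsUmbilicAt`, and so passes to `t
= 0`. -/
theorem isSpherical_of_openTime (h : IsSmoothFamily Tmax X ν) (hn : 0 < n) (hT : 0 < Tmax)
    (ho : ∀ t ∈ openTime Tmax, IsSpherical (X t) (ν t)) :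
    ∀ t ∈ timeInterval Tmax, IsSpherical (X t) (ν t) := by
  intro t ht x y
  have hp := fun x => h.continuousOn_p_time hT (l := 1) hn x
  have hcX := fun x => continuousOn_time h.smooth_X x
  have hcν := fun x => continuousOn_time h.smooth_ν x
  exact ⟨EqOn.of_subset_closure (fun s hs => (ho s hs x y).1) (hp x) (hp y) openTime_subset
    (timeInterval_subset_closure hT) ht,
    EqOn.of_subset_closure (fun s hs => (ho s hs x y).2) ((hp x).smul ((hcX x).sub (hcX y)))
      ((hcν x).sub (hcν y)) openTime_subset (timeInterval_subset_closure hT) ht⟩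

/-- The image of a hypersurface which is contained in a sphere, is open in it. -/
theorem mem_nhds_range_union (h : IsSmoothFamily Tmax X ν) (ht : t ∈ timeInterval Tmax)
    {c : Amb n} {r : ℝ} (hr : 0 < r) (hν : ∀ x, X t x - c = r • ν t x) (x : M) :
    range (X t) ∪ (Metric.sphere c r)ᶜ ∈ nhds (X t x) := by
  set y₀ := chartAt (Par n) x x with hy₀
  have hy : y₀ ∈ (chartAt (Par n) x).target := mem_chart_target _ x
  set Y : Par n → Amb n := X t ∘ (chartAt (Par n) x).symm with hYdef
  have hY0 : Y y₀ = X t x := by simp [hYdef, hy₀]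
  have hYs : ContDiffAt ℝ ∞ Y y₀ := (contDiffOn_comp_chart (h.contMDiff_X ht) x).contDiffAt
    ((chartAt (Par n) x).open_target.mem_nhds hy)
  -- The cone map over the hypersurface with vertex `c`. At `s = 1` its differential is invertible,
  -- so it maps onto a neighbourhood; points with `s = 1` lie in the image of `X t`, and those with
  -- other `s > 0` lie off the sphere.
  set G : Par n × ℝ → Amb n := fun q => c + q.2 • (Y q.1 - c) with hG
  have hGs : ContDiffAt ℝ ∞ G (y₀, 1) := by
    have h1 : ContDiffAt ℝ ∞ (fun q : Par n × ℝ => Y q.1) (y₀, 1) :=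
      ContDiffAt.comp (y₀, (1 : ℝ)) (g := Y) (f := Prod.fst) hYs contDiffAt_fst
    exact contDiffAt_const.add (contDiffAt_snd.smul (h1.sub contDiffAt_const))
  have hGd : HasFDerivAt G ((1 : ℝ) • ((fderiv ℝ Y y₀) ∘L ContinuousLinearMap.fst ℝ (Par n) ℝ) +
      (ContinuousLinearMap.snd ℝ (Par n) ℝ).smulRight (Y y₀ - c)) (y₀, 1) := by
    have h1 : HasFDerivAt (fun q : Par n × ℝ => Y q.1 - c)
        ((fderiv ℝ Y y₀) ∘L ContinuousLinearMap.fst ℝ (Par n) ℝ) (y₀, 1) :=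
      (HasFDerivAt.comp (y₀, (1 : ℝ)) (g := Y) (f := Prod.fst)
        (hYs.differentiableAt (by simp)).hasFDerivAt hasFDerivAt_fst).sub_const c
    exact ((hasFDerivAt_snd (p := (y₀, (1 : ℝ)))).smul h1).const_add c
  have hP := h.isHypersurfacePoint_chartDeriv ht x
  have hinj : Function.Injective (fderiv ℝ G (y₀, 1)) := by
    rw [hGd.fderiv, injective_iff_map_eq_zero]
    rintro ⟨v, τ⟩ hv
    have hv' : chartDeriv (X t) x v + τ • (r • ν t x) = 0 := by
      rw [← hν, ← hY0]
      simpa using! hv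
    have h1 := congrArg (fun w => inner ℝ w (ν t x)) hv'
    simp only [inner_add_left, hP.inner_left, real_inner_smul_left, real_inner_self_eq_norm_sq,
      hP.norm_eq_one, inner_zero_left, zero_add, one_pow, mul_one] at h1
    have hτ : τ = 0 := (mul_eq_zero.1 h1).resolve_right hr.ne'
    rw [hτ, zero_smul, add_zero] at hv'
    have hv0 : v = 0 := hP.injective (by rw [hv', map_zero])
    rw [hv0, hτ]; rfl
  have hsurj : ((fderiv ℝ G (y₀, 1) : Par n × ℝ →L[ℝ] Amb n) : Par n × ℝ →ₗ[ℝ] Amb n).range = ⊤ := by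
    rw [LinearMap.range_eq_top]
    exact (LinearMap.injective_iff_surjective_of_finrank_eq_finrank (by simp)).1 hinj
  have hmap := (hGs.hasStrictFDerivAt (by simp)).map_nhds_eq_of_surj hsurj
  have hG0 : G (y₀, 1) = X t x := by simp [hG, hY0]
  rw [hG0] at hmap
  rw [← hmap, Filter.mem_map]
  have hN : (univ : Set (Par n)) ×ˢ Ioi (0 : ℝ) ∈ nhds (y₀, (1 : ℝ)) :=
    (isOpen_univ.prod isOpen_Ioi).mem_nhds ⟨trivial, by simp⟩
  refine Filter.mem_of_superset hN ?_
  rintro ⟨y, s⟩ ⟨-, hs⟩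
  by_cases hs1 : s = 1
  · left
    exact ⟨(chartAt (Par n) x).symm y, by simp [hG, hs1, hYdef]⟩
  · right
    intro hmem
    rw [mem_sphere_iff_norm] at hmem
    refine hs1 ?_
    have e : G (y, s) - c = (s * r) • ν t ((chartAt (Par n) x).symm y) := by
      rw [mul_smul, ← hν]
      simp [hG, hYdef]
    rw [e, norm_smul, (h.normal t ht).norm_eq_one, mul_one, Real.norm_eq_abs,
      abs_of_pos (mul_pos hs hr)] at hmem
    exact (mul_eq_right₀ hr.ne').1 hmem

/-- The image lies in the sphere of radius `p_1⁻¹` about `X - p_1⁻¹ ν`. It is closed by compactness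
and relatively open by `mem_nhds_range_union`, and the sphere is connected since the ambient
dimension exceeds one. -/
theorem isRoundSphere_of_isSpherical [CompactSpace M] [ConnectedSpace M]
    (h : IsSmoothFamily Tmax X ν) (hn : 0 < n) (ht : t ∈ timeInterval Tmax)
    (hS : IsSpherical (X t) (ν t)) (hpos : ∀ x, 0 < p 1 (X t) (ν t) x) : IsRoundSphere (X t) := by
  obtain ⟨x₀⟩ := (inferInstance : Nonempty M)
  set a := p 1 (X t) (ν t) x₀ with ha
  have ha0 : 0 < a := hpos x₀
  set c := X t x₀ - a⁻¹ • ν t x₀ with hc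
  have hν : ∀ x, X t x - c = a⁻¹ • ν t x := by
    intro x
    have h1 := (hS x x₀).2
    rw [(hS x x₀).1, ← ha] at h1
    have h2 : X t x - X t x₀ = a⁻¹ • (ν t x - ν t x₀) := by
      rw [← h1, smul_smul, inv_mul_cancel₀ ha0.ne', one_smul]
    rw [hc, sub_sub_eq_add_sub, add_sub_right_comm, h2, smul_sub, sub_add_cancel]
  have hr : 0 < a⁻¹ := inv_pos.2 ha0
  have hsub : range (X t) ⊆ Metric.sphere c a⁻¹ := by
    rintro _ ⟨x, rfl⟩
    rw [mem_sphere_iff_norm, hν, norm_smul, (h.normal t ht).norm_eq_one, mul_one,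
      Real.norm_eq_abs, abs_of_pos hr]
  refine ⟨c, a⁻¹, hr, hsub.antisymm ?_⟩
  have hpre : IsPreconnected (Metric.sphere c a⁻¹) := isPreconnected_sphere (by
    have : 1 < Module.finrank ℝ (Amb n) := by simpa using hn
    exact_mod_cast Module.lt_rank_of_lt_finrank this) c a⁻¹
  have hclosed : IsClosed (range (X t)) :=
    (isCompact_range (h.contMDiff_X ht).continuous).isClosed
  intro z hz
  by_contra hzr
  obtain ⟨w, hw, hw1, hw2⟩ := hpre (interior (range (X t) ∪ (Metric.sphere c a⁻¹)ᶜ)) (range (X t))ᶜ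
    isOpen_interior hclosed.isOpen_compl (fun w hw => by
      by_cases hwr : w ∈ range (X t)
      · obtain ⟨x, rfl⟩ := hwr
        exact Or.inl (mem_interior_iff_mem_nhds.2 (h.mem_nhds_range_union ht hr hν x))
      · exact Or.inr hwr)
    ⟨X t x₀, hsub ⟨x₀, rfl⟩, mem_interior_iff_mem_nhds.2 (h.mem_nhds_range_union ht hr hν x₀)⟩
    ⟨z, hz, hzr⟩
  exact (interior_subset hw1).elim hw2 fun h' => h' hw

/-- On a round sphere the curvature functions are powers of a constant. -/
theorem p_of_isRoundSphere (h : IsSmoothFamily Tmax X ν) (hn : 0 < n)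
    (ht : t ∈ timeInterval Tmax) (hS : IsRoundSphere (X t)) (hpos : ∀ x, 0 < p 1 (X t) (ν t) x) :
    ∃ a : ℝ, 0 < a ∧ ∀ x, ∀ l ≤ n, p l (X t) (ν t) x = a ^ l := by
  obtain ⟨c, r, hr, hrange⟩ := hS
  refine ⟨r⁻¹, inv_pos.2 hr, fun x => ?_⟩
  have hP := h.isHypersurfacePoint_chartDeriv ht x
  set y₀ := chartAt (Par n) x x with hy₀
  set Y : Par n → Amb n := X t ∘ (chartAt (Par n) x).symm with hYdef
  set N : Par n → Amb n := ν t ∘ (chartAt (Par n) x).symm with hNdef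
  have hU := (chartAt (Par n) x).open_target.mem_nhds (mem_chart_target (Par n) x)
  have dist_eq : ∀ z, inner ℝ (X t z - c) (X t z - c) = r ^ 2 := by
    intro z
    have : X t z ∈ Metric.sphere c r := hrange ▸ mem_range_self z
    rw [mem_sphere_iff_norm] at this
    rw [real_inner_self_eq_norm_sq, this]
  -- Differentiating `|X - c|² = r²` shows that `X - c` is normal.
  have horth : ∀ z, X t z - c = inner ℝ (ν t z) (X t z - c) • ν t z := by
    intro z
    refine (h.isHypersurfacePoint_chartDeriv ht z).eq_smul_normal fun v => ?_
    have d := (differentiableAt_comp_chart (h.contMDiff_X ht) z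
      (mem_chart_target (Par n) z)).hasFDerivAt.sub_const c
    have e : (fun y => inner ℝ ((X t ∘ (chartAt (Par n) z).symm) y - c)
        ((X t ∘ (chartAt (Par n) z).symm) y - c)) = fun _ => r ^ 2 := by
      ext y; exact dist_eq _
    have d2 := d.inner ℝ d
    rw [e] at d2
    have h2 := congrArg (fun D => D v) (d2.unique (hasFDerivAt_const (r ^ 2) _))
    simp only [ContinuousLinearMap.comp_apply, fderivInnerCLM_apply, Function.comp_apply,
      ContinuousLinearMap.prod_apply, zero_apply, (chartAt (Par n) z).left_inv
        (mem_chart_source _ z)] at h2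
    have h3 := real_inner_comm (X t z - c) (chartDeriv (X t) z v)
    have h4 : inner ℝ (X t z - c) (chartDeriv (X t) z v) +
      inner ℝ (chartDeriv (X t) z v) (X t z - c) = 0 := h2
    linarith
  set μ : Par n → ℝ := fun y => inner ℝ (N y) (Y y - c) with hμ
  have dY := (differentiableAt_comp_chart (h.contMDiff_X ht) x
    (mem_chart_target (Par n) x)).hasFDerivAt
  have dN := (differentiableAt_comp_chart (h.contMDiff_ν ht) x
    (mem_chart_target (Par n) x)).hasFDerivAt
  obtain ⟨D, dμ⟩ : ∃ D, HasFDerivAt μ D y₀ := ⟨_, dN.inner ℝ (dY.sub_const c)⟩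
  have hN0 : N y₀ = ν t x := by simp [hNdef, hy₀]
  have e : (fun y => Y y - c) = fun y => μ y • N y := by
    ext1 y; exact horth _
  have d1 := dY.sub_const c
  rw [show (fun y => (X t ∘ (chartAt (Par n) x).symm) y - c) = fun y => μ y • N y from e] at d1
  have d2 := HasFDerivAt.smul dμ dN
  -- In `dX = μ dν + dμ ν` the last term is the only normal one, so `dμ = 0`.
  have h3 : ∀ v, chartDeriv (n := n) (X t) x v = μ y₀ • chartDeriv (n := n) (ν t) x v := by
    intro v
    have h4 := congrArg (fun D => D v) (d1.unique d2)
    have hs : chartDeriv (n := n) (X t) x v =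
        μ y₀ • chartDeriv (n := n) (ν t) x v + D v • ν t x := by
      rw [← hN0]
      exact h4
    have h5 := congrArg (fun w => inner ℝ w (ν t x)) hs
    simp only [inner_add_left, hP.inner_left, hP.inner_right, real_inner_smul_left,
      real_inner_self_eq_norm_sq, hP.norm_eq_one, mul_zero, zero_add, one_pow, mul_one] at h5
    rw [hs, ← h5, zero_smul, add_zero]
  have hμsq : μ y₀ ^ 2 = r ^ 2 := by
    have h4 := dist_eq x
    have h5 : X t x - c = μ y₀ • ν t x := by
      have := congrFun e y₀
      simp only [hN0] at this
      rw [← this]; simp [hYdef, hy₀]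
    rw [h5, real_inner_smul_left, real_inner_smul_right, real_inner_self_eq_norm_sq,
      hP.norm_eq_one] at h4
    linarith
  have hμ0 : μ y₀ ≠ 0 := fun h0 => by
    rw [h0] at hμsq
    exact absurd hμsq.symm (by simp [hr.ne'])
  have hBA : chartDeriv (n := n) (ν t) x = (μ y₀)⁻¹ • chartDeriv (n := n) (X t) x := by
    ext1 v
    rw [smul_apply, h3, smul_smul, inv_mul_cancel₀ hμ0, one_smul]
  have hp : ∀ l ≤ n, p l (X t) (ν t) x = (μ y₀)⁻¹ ^ l := fun l hl => by
    rw [h.p_eq ht, h.principalCurvatures_eq' ht, hP.normEsymm_of_eq_smul hBA hl]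
  -- Only `μ = ±r` is known so far; `p_1 > 0` selects the sign.
  have hμpos : 0 < μ y₀ := by
    have h1 := hpos x
    rw [hp 1 hn, pow_one] at h1
    exact inv_pos.1 h1
  have hμr : μ y₀ = r := (sq_eq_sq₀ hμpos.le hr.le).1 hμsq
  intro l hl
  rw [hp l hl, hμr]

end IsSmoothFamily

end Spheres

/-! ### Monotonicity and rigidity of the functionals -/

section Monotonicity

variable {n : ℕ} {M : Type*} [TopologicalSpace M] [ChartedSpace (EuclideanSpace ℝ (Fin n)) M]
  [IsManifold (𝓡 n) ∞ M] [CompactSpace M] [T2Space M]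
  {k : ℕ} {Tmax : EReal} {X ν : ℝ → M → Amb n}

theorem surfaceIntegral_neg (X : M → Amb n) (f : M → ℝ) :
    surfaceIntegral X (fun x => -f x) = - surfaceIntegral X f := by
  simp only [surfaceIntegral_eq_sum, chartIntegral, mul_neg, neg_mul, MeasureTheory.integral_neg,
    Finset.sum_neg_distrib]

theorem ConstantInTime.congr {F G : ℝ → ℝ} (hF : ConstantInTime Tmax F)
    (h : ∀ t ∈ timeInterval Tmax, F t = G t) : ConstantInTime Tmax G := fun s hs t ht => by
  rw [← h s hs, ← h t ht]; exact hF s hs t ht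

namespace IsSmoothFamily

variable {ι : ℝ} {l : ℕ}

theorem monotoneOn_T (h : IsSmoothFamily Tmax X ν) (hT : 0 < Tmax) (hl : l ≤ n)
    (hpos : ∀ t ∈ timeInterval Tmax, ∀ x, 0 < p l (X t) (ν t) x)
    (hs : ∀ t ∈ openTime Tmax, ∀ x, 0 ≤ sourceAt X ν ι l t x) :
    MonotoneOn (fun t => T ι l (X t) (ν t)) (timeInterval Tmax) := by
  have hint := interior_timeInterval Tmax
  refine monotoneOn_of_deriv_nonneg (convex_timeInterval Tmax) (h.continuousOn_T hT ι hl hpos) ?_ ?_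
  · intro t ht
    rw [hint] at ht
    exact (h.hasDerivAt_T ι hl hpos ht).differentiableAt.differentiableWithinAt
  · intro t ht
    rw [hint] at ht
    rw [(h.hasDerivAt_T ι hl hpos ht).deriv]
    exact h.surfaceIntegral_nonneg (openTime_subset ht) (hs t ht)

theorem antitoneOn_T (h : IsSmoothFamily Tmax X ν) (hT : 0 < Tmax) (hl : l ≤ n)
    (hpos : ∀ t ∈ timeInterval Tmax, ∀ x, 0 < p l (X t) (ν t) x)
    (hs : ∀ t ∈ openTime Tmax, ∀ x, sourceAt X ν ι l t x ≤ 0) :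
    AntitoneOn (fun t => T ι l (X t) (ν t)) (timeInterval Tmax) := by
  have hint := interior_timeInterval Tmax
  refine antitoneOn_of_deriv_nonpos (convex_timeInterval Tmax) (h.continuousOn_T hT ι hl hpos) ?_ ?_
  · intro t ht
    rw [hint] at ht
    exact (h.hasDerivAt_T ι hl hpos ht).differentiableAt.differentiableWithinAt
  · intro t ht
    rw [hint] at ht
    rw [(h.hasDerivAt_T ι hl hpos ht).deriv]
    have := h.surfaceIntegral_nonneg (openTime_subset ht) fun x => neg_nonneg.2 (hs t ht x)
    rw [surfaceIntegral_neg] at this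
    linarith

theorem constantInTime_T (h : IsSmoothFamily Tmax X ν) (hT : 0 < Tmax) (hl : l ≤ n)
    (hpos : ∀ t ∈ timeInterval Tmax, ∀ x, 0 < p l (X t) (ν t) x)
    (hs : ∀ t ∈ openTime Tmax, ∀ x, sourceAt X ν ι l t x = 0) :
    ConstantInTime Tmax (fun t => T ι l (X t) (ν t)) := by
  have h1 := h.monotoneOn_T (ι := ι) hT hl hpos fun t ht x => (hs t ht x).ge
  have h2 := h.antitoneOn_T (ι := ι) hT hl hpos fun t ht x => (hs t ht x).le
  intro s hs t ht
  rcases le_total s t with hst | hst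
  · exact le_antisymm (h1 hs ht hst) (h2 hs ht hst)
  · exact le_antisymm (h2 ht hs hst) (h1 ht hs hst)

theorem surfaceIntegral_sourceAt_eq_zero (h : IsSmoothFamily Tmax X ν) (hl : l ≤ n)
    (hpos : ∀ t ∈ timeInterval Tmax, ∀ x, 0 < p l (X t) (ν t) x)
    (hC : ConstantInTime Tmax (fun t => T ι l (X t) (ν t))) {t : ℝ} (ht : t ∈ openTime Tmax) :
    surfaceIntegral (X t) (sourceAt X ν ι l t) = 0 := by
  refine (h.hasDerivAt_T ι hl hpos ht).unique
    ((hasDerivAt_const t (T ι l (X t) (ν t))).congr_of_eventuallyEq ?_)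
  filter_upwards [mem_nhds_of_openTime ht] with s hs
  exact hC s hs t (openTime_subset ht)

/-- A constant functional has zero derivative, and a continuous integrand of one sign with zero
integral vanishes. -/
theorem sourceAt_eq_zero_of_nonneg (h : IsSmoothFamily Tmax X ν) (hl : l ≤ n)
    (hpos : ∀ t ∈ timeInterval Tmax, ∀ x, 0 < p l (X t) (ν t) x)
    (hs : ∀ t ∈ openTime Tmax, ∀ x, 0 ≤ sourceAt X ν ι l t x)
    (hC : ConstantInTime Tmax (fun t => T ι l (X t) (ν t))) {t : ℝ} (ht : t ∈ openTime Tmax)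
    (x : M) : sourceAt X ν ι l t x = 0 :=
  h.eq_zero_of_surfaceIntegral_eq_zero (openTime_subset ht) (hs t ht)
    (fun c => h.continuousOn_sourceAt ι hl hpos ht c)
    (h.surfaceIntegral_sourceAt_eq_zero hl hpos hC ht) x

theorem sourceAt_eq_zero_of_nonpos (h : IsSmoothFamily Tmax X ν) (hl : l ≤ n)
    (hpos : ∀ t ∈ timeInterval Tmax, ∀ x, 0 < p l (X t) (ν t) x)
    (hs : ∀ t ∈ openTime Tmax, ∀ x, sourceAt X ν ι l t x ≤ 0)
    (hC : ConstantInTime Tmax (fun t => T ι l (X t) (ν t))) {t : ℝ} (ht : t ∈ openTime Tmax)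
    (x : M) : sourceAt X ν ι l t x = 0 :=
  neg_eq_zero.1 (h.eq_zero_of_surfaceIntegral_eq_zero (openTime_subset ht)
    (f := fun x => -sourceAt X ν ι l t x) (fun x => neg_nonneg.2 (hs t ht x))
    (fun c => (h.continuousOn_sourceAt ι hl hpos ht c).neg)
    (by rw [surfaceIntegral_neg, h.surfaceIntegral_sourceAt_eq_zero hl hpos hC ht, neg_zero]) x)

end IsSmoothFamily

set_option linter.unusedSectionVars false in
theorem area_eq_T_zero (l : ℕ) (X ν : M → Amb n) : area X = T 0 l X ν := by
  simp only [area, T, Real.rpow_zero]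

theorem T_index_zero (h : IsSmoothFamily Tmax X ν) (ι : ℝ) {t : ℝ} (ht : t ∈ timeInterval Tmax) :
    T ι 0 (X t) (ν t) = area (X t) := by
  simp only [area, T, p_zero h ht, Real.one_rpow]

namespace IsInverseFlow

variable {ι : ℝ} {l : ℕ}

set_option linter.unusedSectionVars false in
theorem allRoundSpheres_of_umbilic [ConnectedSpace M] (h : IsInverseFlow k Tmax X ν)
    (hT : 0 < Tmax) (hk : 0 < k) (hkn : k ≤ n)
    (hc : ∀ t ∈ timeInterval Tmax, KConvex k (X t) (ν t))
    (hu : ∀ t ∈ openTime Tmax, ∀ x, IsUmbilicAt (X t) (ν t) x) : AllRoundSpheres Tmax X := by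
  have hn := hk.trans_le hkn
  intro t ht
  exact h.isRoundSphere_of_isSpherical hn ht (h.isSpherical_of_openTime hn hT (fun t ht =>
    h.isSpherical_of_umbilic hn (openTime_subset ht) (hu t ht)) t ht)
    fun x => hc t ht x 1 le_rfl hk

-- On a sphere of radius `1/a` one has `p_j = a^j` and `F = a⁻¹`, so `F p_{l+1} = p_l`, `F p_1 = 1`
-- and `dp_l = 0`; for `l = n` the factor `n - l` replaces the missing `p_{n+1}`.
set_option linter.unusedSectionVars false in
theorem sourceAt_eq_zero_of_allRoundSpheres (h : IsInverseFlow k Tmax X ν)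
    (hk : 0 < k) (hkn : k ≤ n) (hc : ∀ t ∈ timeInterval Tmax, KConvex k (X t) (ν t))
    (hS : AllRoundSpheres Tmax X) (hl : l ≤ n) {t : ℝ} (ht : t ∈ openTime Tmax) (x : M) :
    sourceAt X ν ι l t x = 0 := by
  have hn := hk.trans_le hkn
  have ht' := openTime_subset ht
  obtain ⟨a, ha, hp⟩ := h.p_of_isRoundSphere hn ht' (hS t ht') fun x => hc t ht' x 1 le_rfl hk
  have hF : p k (X t) (ν t) x ^ (-(1 / (k : ℝ))) = a⁻¹ := by
    rw [hp x k hkn, Real.rpow_neg (pow_pos ha k).le, one_div,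
      Real.pow_rpow_inv_natCast ha.le hk.ne']
  have hd : chartDeriv (n := n) (p l (X t) (ν t)) x = 0 := by
    have e : p l (X t) (ν t) ∘ (chartAt (Par n) x).symm = fun _ => a ^ l := by
      ext y; exact hp _ l hl
    rw [chartDeriv, e]; simp
  have hg : gradientPart X ν l t x = 0 := by
    rw [gradientPart, hd, fluxCoef_zero, fluxCoef_zero]; simp
  rw [h.sourceAt_eq_terms ι l ht, hg, hF, hp x 1 hn, pow_one, inv_mul_cancel₀ ha.ne']
  have h1 : ((n : ℝ) - l) * (a⁻¹ * p (l + 1) (X t) (ν t) x - p l (X t) (ν t) x) = 0 := by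
    rcases hl.eq_or_lt with rfl | hlt
    · simp
    · rw [hp x (l + 1) hlt, hp x l hl, pow_succ]
      field_simp
      simp
  rw [h1]
  simp

theorem antitoneOn_T_and_rigidity [ConnectedSpace M] (h : IsInverseFlow k Tmax X ν) (hT : 0 < Tmax)
    (hk : 0 < k) (hkn : k ≤ n) (hc : ∀ t ∈ timeInterval Tmax, KConvex k (X t) (ν t)) (hl : l ≤ n)
    (hpos : ∀ t ∈ timeInterval Tmax, ∀ x, 0 < p l (X t) (ν t) x)
    (hs : ∀ t ∈ openTime Tmax, ∀ x, sourceAt X ν ι l t x ≤ 0 ∧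
      (sourceAt X ν ι l t x = 0 → IsUmbilicAt (X t) (ν t) x)) :
    AntitoneOn (fun t => T ι l (X t) (ν t)) (timeInterval Tmax) ∧
      (ConstantInTime Tmax (fun t => T ι l (X t) (ν t)) ↔ AllRoundSpheres Tmax X) := by
  refine ⟨h.antitoneOn_T hT hl hpos fun t ht x => (hs t ht x).1, fun hC => ?_, fun hS => ?_⟩
  · exact h.allRoundSpheres_of_umbilic hT hk hkn hc fun t ht x => (hs t ht x).2
      (h.sourceAt_eq_zero_of_nonpos hl hpos (fun t ht x => (hs t ht x).1) hC ht x)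
  · exact h.constantInTime_T hT hl hpos fun t ht x =>
      h.sourceAt_eq_zero_of_allRoundSpheres hk hkn hc hS hl ht x

theorem monotoneOn_T_and_rigidity [ConnectedSpace M] (h : IsInverseFlow k Tmax X ν) (hT : 0 < Tmax)
    (hk : 0 < k) (hkn : k ≤ n) (hc : ∀ t ∈ timeInterval Tmax, KConvex k (X t) (ν t)) (hl : l ≤ n)
    (hpos : ∀ t ∈ timeInterval Tmax, ∀ x, 0 < p l (X t) (ν t) x)
    (hs : ∀ t ∈ openTime Tmax, ∀ x, 0 ≤ sourceAt X ν ι l t x ∧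
      (sourceAt X ν ι l t x = 0 → IsUmbilicAt (X t) (ν t) x)) :
    MonotoneOn (fun t => T ι l (X t) (ν t)) (timeInterval Tmax) ∧
      (ConstantInTime Tmax (fun t => T ι l (X t) (ν t)) ↔ AllRoundSpheres Tmax X) := by
  refine ⟨h.monotoneOn_T hT hl hpos fun t ht x => (hs t ht x).1, fun hC => ?_, fun hS => ?_⟩
  · exact h.allRoundSpheres_of_umbilic hT hk hkn hc fun t ht x => (hs t ht x).2
      (h.sourceAt_eq_zero_of_nonneg hl hpos (fun t ht x => (hs t ht x).1) hC ht x)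
  · exact h.constantInTime_T hT hl hpos fun t ht x =>
      h.sourceAt_eq_zero_of_allRoundSpheres hk hkn hc hS hl ht x

/-- The behaviour of the area, for any function which agrees with it. -/
theorem area_monotone [ConnectedSpace M] (h : IsInverseFlow k Tmax X ν) (hT : 0 < Tmax)
    (hk : 0 < k) (hkn : k ≤ n) (hc : ∀ t ∈ timeInterval Tmax, KConvex k (X t) (ν t)) {F : ℝ → ℝ}
    (hF : ∀ t ∈ timeInterval Tmax, F t = area (X t)) :
    (1 < k → MonotoneOn F (timeInterval Tmax) ∧
      (ConstantInTime Tmax F ↔ AllRoundSpheres Tmax X)) ∧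
    (k = 1 → ConstantInTime Tmax F) := by
  have hF' : ∀ t ∈ timeInterval Tmax, F t = T 0 0 (X t) (ν t) := fun t ht => by
    rw [hF t ht, area_eq_T_zero]
  have hpos : ∀ t ∈ timeInterval Tmax, ∀ x, 0 < p 0 (X t) (ν t) x := fun t ht x => by
    rw [p_zero h.toIsSmoothFamily ht]; exact one_pos
  refine ⟨fun hk1 => ?_, fun hk1 => ?_⟩
  · obtain ⟨h1, h2⟩ := h.monotoneOn_T_and_rigidity (ι := 0) hT hk hkn hc (Nat.zero_le n) hpos
      fun t ht x => ⟨(h.sourceAt_zero_nonneg hk hkn ht (hc t (openTime_subset ht)) x).1,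
        (h.sourceAt_zero_nonneg hk hkn ht (hc t (openTime_subset ht)) x).2 hk1⟩
    exact ⟨h1.congr fun t ht => (hF' t ht).symm, fun hC => h2.1 (hC.congr hF'),
      fun hS => (h2.2 hS).congr fun t ht => (hF' t ht).symm⟩
  · subst hk1
    exact (h.constantInTime_T (ι := 0) hT (Nat.zero_le n) hpos fun t ht x =>
      h.sourceAt_zero_one ht x).congr fun t ht => (hF' t ht).symm

end IsInverseFlow

theorem esymm_pos_of_forall_pos (s : Multiset ℝ) (hs : ∀ a ∈ s, 0 < a) :
    ∀ i ≤ Multiset.card s, 0 < s.esymm i := by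
  induction s using Multiset.induction with
  | empty =>
    intro i hi
    obtain rfl : i = 0 := by simpa using hi
    simp [esymm_zero']
  | cons a s ih =>
    have ih' := ih fun b hb => hs b (Multiset.mem_cons_of_mem hb)
    have ha := hs a (Multiset.mem_cons_self a s)
    intro i hi
    rw [Multiset.card_cons] at hi
    cases i with
    | zero => simp [esymm_zero']
    | succ i =>
      rw [esymm_cons_succ]
      have h1 := mul_pos ha (ih' i (by omega))
      rcases Nat.lt_or_ge (Multiset.card s) (i + 1) with hlt | hge
      · rw [esymm_eq_zero_of_card_lt hlt]; linarith
      · linarith [ih' (i + 1) hge]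

theorem esymm_card_of_zero_mem {s : Multiset ℝ} (hs : (0 : ℝ) ∈ s) :
    s.esymm (Multiset.card s) = 0 := by
  obtain ⟨t, rfl⟩ := Multiset.exists_cons_of_mem hs
  rw [Multiset.card_cons, esymm_cons_succ, esymm_eq_zero_of_card_lt (Nat.lt_succ_self _)]
  simp

set_option linter.unusedSectionVars false in
/-- Convexity together with `p_n > 0` gives positive principal curvatures. -/
theorem IsSmoothFamily.kConvex_of_isConvex (h : IsSmoothFamily Tmax X ν) {t : ℝ}
    (ht : t ∈ timeInterval Tmax) (hconv : IsConvex (X t) (ν t))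
    (hpos : ∀ x, 0 < p n (X t) (ν t) x) : KConvex n (X t) (ν t) := by
  intro x i _ hi
  have hcard := h.card_principalCurvatures ht x
  have hne : (0 : ℝ) ∉ principalCurvatures (X t) (ν t) x := fun h0 => by
    have h1 := esymm_card_of_zero_mem h0
    have h2 := hpos x
    rw [hcard] at h1
    rw [p, h1, zero_div] at h2
    exact lt_irrefl _ h2
  have h3 := esymm_pos_of_forall_pos (principalCurvatures (X t) (ν t) x)
    (fun a ha => lt_of_le_of_ne (hconv x a ha) fun h0 => hne (h0 ▸ ha)) i (by rwa [hcard])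
  exact div_pos h3 (by exact_mod_cast Nat.choose_pos hi)

end Monotonicity

end InverseCurvatureFlow

end

/-! ### The theorem -/

open InverseCurvatureFlow in
theorem theorem1p5 {n : ℕ} {M : Type*} [TopologicalSpace M]
    [ChartedSpace (EuclideanSpace ℝ (Fin n)) M] [IsManifold (𝓡 n) ∞ M]
    [CompactSpace M] [T2Space M] [ConnectedSpace M]
    (k : ℕ) (hk0 : 0 < k) (hkn : k ≤ n) (Tmax : EReal) (hT : 0 < Tmax)
    (X ν : ℝ → M → Amb n)
    (hflow : SolvesRescaledFlow k Tmax X ν ∨ SolvesNormalFlow k Tmax X ν) :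
    -- (i) `ι > 1`
    (KConvex k (X 0) (ν 0) → ∀ ι : ℝ, 1 < ι →
      AntitoneOn (fun t => T ι k (X t) (ν t)) (timeInterval Tmax) ∧
      (ConstantInTime Tmax (fun t => T ι k (X t) (ν t)) ↔ AllRoundSpheres Tmax X)) ∧
    -- (ii) `ι = 1`
    (KConvex k (X 0) (ν 0) →
      AntitoneOn (fun t => T 1 k (X t) (ν t)) (timeInterval Tmax) ∧
      (k < n →
        (ConstantInTime Tmax (fun t => T 1 k (X t) (ν t)) ↔ AllRoundSpheres Tmax X)) ∧
      (k = n → ConstantInTime Tmax (fun t => T 1 k (X t) (ν t))) ∧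
      (1 < k →
        AntitoneOn (fun t => T 1 (k - 1) (X t) (ν t)) (timeInterval Tmax) ∧
        (ConstantInTime Tmax (fun t => T 1 (k - 1) (X t) (ν t)) ↔ AllRoundSpheres Tmax X))) ∧
    -- (iii) `0 < ι < 1`, `k = n`
    (k = n → IsConvex (X 0) (ν 0) → ∀ ι : ℝ, 0 < ι → ι < 1 →
      MonotoneOn (fun t => T ι n (X t) (ν t)) (timeInterval Tmax) ∧
      (ConstantInTime Tmax (fun t => T ι n (X t) (ν t)) ↔ AllRoundSpheres Tmax X)) ∧
    -- (iv) the exponent `0`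
    (KConvex k (X 0) (ν 0) → ∀ l : ℕ, l ≤ n →
      (∀ t ∈ timeInterval Tmax, T 0 l (X t) (ν t) = area (X t)) ∧
      (1 < k →
        MonotoneOn (fun t => T 0 l (X t) (ν t)) (timeInterval Tmax) ∧
        (ConstantInTime Tmax (fun t => T 0 l (X t) (ν t)) ↔ AllRoundSpheres Tmax X)) ∧
      (k = 1 → ConstantInTime Tmax (fun t => T 0 l (X t) (ν t)))) ∧
    -- (v) the index `0`, any exponent
    (KConvex k (X 0) (ν 0) → ∀ ι : ℝ,
      (∀ t ∈ timeInterval Tmax, T ι 0 (X t) (ν t) = area (X t)) ∧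
      (1 < k →
        MonotoneOn (fun t => T ι 0 (X t) (ν t)) (timeInterval Tmax) ∧
        (ConstantInTime Tmax (fun t => T ι 0 (X t) (ν t)) ↔ AllRoundSpheres Tmax X)) ∧
      (k = 1 → ConstantInTime Tmax (fun t => T ι 0 (X t) (ν t)))) := by
  have h : IsInverseFlow k Tmax X ν := hflow.elim (fun h => h.isInverseFlow) fun h => h.isInverseFlow
  have hcvx : KConvex k (X 0) (ν 0) → ∀ t ∈ timeInterval Tmax, KConvex k (X t) (ν t) :=
    fun h0 t ht => h.kConvex hT hk0 hkn h0 ht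
  refine ⟨fun h0 ι hι => ?_, fun h0 => ⟨?_, fun hlt => ?_, fun hkn' => ?_, fun hk1 => ?_⟩,
    fun hkn' hconv ι hι0 hι1 => ?_, fun h0 l hl => ?_, fun h0 ι => ?_⟩
  · exact h.antitoneOn_T_and_rigidity hT hk0 hkn (hcvx h0) hkn h.p_pos fun t ht x =>
      h.sourceAt_nonpos hk0 hkn ht (hcvx h0 t (openTime_subset ht)) hι x
  · exact h.antitoneOn_T hT hkn h.p_pos fun t ht x =>
      (h.sourceAt_one_nonpos hk0 hkn ht (hcvx h0 t (openTime_subset ht)) x).1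
  · exact (h.antitoneOn_T_and_rigidity hT hk0 hkn (hcvx h0) hkn h.p_pos fun t ht x =>
      ⟨(h.sourceAt_one_nonpos hk0 hkn ht (hcvx h0 t (openTime_subset ht)) x).1,
        (h.sourceAt_one_nonpos hk0 hkn ht (hcvx h0 t (openTime_subset ht)) x).2 hlt⟩).2
  · subst hkn'
    exact h.constantInTime_T hT le_rfl h.p_pos fun t ht x => h.sourceAt_one_top ht x
  · exact h.antitoneOn_T_and_rigidity hT hk0 hkn (hcvx h0) (by omega)
      (fun t ht x => hcvx h0 t ht x (k - 1) (by omega) (by omega)) fun t ht x =>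
        h.sourceAt_pred_nonpos hk1 hkn ht (hcvx h0 t (openTime_subset ht)) x
  · subst hkn'
    -- Nonnegative curvatures with positive product are all positive, so convexity at time zero is
    -- upgraded to `n`-convexity, which then persists.
    have h0 := h.kConvex_of_isConvex (zero_mem_timeInterval hT) hconv
      (h.p_pos 0 (zero_mem_timeInterval hT))
    exact h.monotoneOn_T_and_rigidity hT hk0 le_rfl (hcvx h0) le_rfl h.p_pos fun t ht x =>
      h.sourceAt_top_nonneg hk0 ht (hcvx h0 t (openTime_subset ht)) hι0 hι1 x
  · have e : ∀ t ∈ timeInterval Tmax, T 0 l (X t) (ν t) = area (X t) := fun t _ =>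
      (area_eq_T_zero l (X t) (ν t)).symm
    exact ⟨e, h.area_monotone hT hk0 hkn (hcvx h0) e⟩
  · have e : ∀ t ∈ timeInterval Tmax, T ι 0 (X t) (ν t) = area (X t) := fun t ht =>
      T_index_zero h.toIsSmoothFamily ι ht
    exact ⟨e, h.area_monotone hT hk0 hkn (hcvx h0) e⟩
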